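/- **Setting.** For positive integers $k,d$ let $\Gamma=\langle s_1,\dots,s_d : s_1^k=\dots=s_d^k=1\rangle$. For a homomorphism $\sigma:\Gamma\to\mathrm{Sym}(V)$ let $G_\sigma$ be the hypergraph with vertex set $V$ whose edges are the sets $\{\sigma(s_i^j)v : 0\le j\le k-1\}$ with $1\le i\le d$, $v\in V$. Call $\sigma$ uniform if every edge of $G_\sigma$ has exactly $k$ elements. A coloring $\chi:V\to\{0,1\}$ is proper for $G_\sigma$ if no edge $e$ satisfies $|\chi(e)|=1$, and is equitable if $|\chi^{-1}(0)|=|\chi^{-1}(1)|$. For $n\in 2\mathbb Z\cap k\mathbb Z$ positive and an equitable $\chi:[n]\to\{0,1\}$, the planted model $\mathbb P^\chi_n$ is the uniform probability measure on the set of all uniform homomorphisms $\sigma:\Gamma\to\mathrm{Sym}(n)$ such that $\chi$ is proper for $G_\sigma$. Let $\chi$ be a proper coloring of a hypergraph with vertex set $V$. A vertex $v$ supports an edge $e$ if $v\in e$ and $\chi(v)\notin\chi(e\setminus\{v\})$. The depth-$l$ cores are $C_0(\chi)=V$ and $$C_{l+1}(\chi)=\{v\in V : v\text{ supports at least 3 edges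 } e \text{ with } e\setminus\{v\}\subset C_l(\chi)\}.$$ The set $A_l(\chi)$ of attached vertices consists of all $v\notin C_l(\chi)$ that support some edge $e$ with $e\setminus\{v\}\subset C_{l-1}(\chi)$ (and $A_0(\chi)=\emptyset$). The set $A'_l(\chi)$ consists of all $v\in A_l(\chi)$ for which there are $w\in A_l(\chi)$, $w\neq v$, and edges $e_v,e_w$ supported by $v,w$ respectively, such that $e_v\setminus\{v\}$ and $e_w\setminus\{w\}$ are contained in $C_{l-1}(\chi)$ and $e_v\cap e_w\neq\emptyset$. Put $\lambda=d/(2^{k-1}-1)$. **Lemma 5.1.** Let $0<\eta_0<\eta_1<(1-\log 2)/2$ and $\delta>0$. There exists $k_0$ (depending on $\eta_0,\eta_1,\delta$) such that for all $k\ge k_0$ and all $d$ with $$\frac dk=\frac{\log 2}{2}\,2^k-\frac{1+\log 2}{2}+\eta\qquad\text{for some }\eta\in[\eta_0,\eta_1],$$ and for any choice of an equitable coloring $\chi=\chi_n$ of $[n]$ for each $n$, $$\lim_{l\to\infty}\ \liminf_{n\to\infty}\ \mathbb P^{\chi}_n\left(\frac{|C_l(\chi)\cup (A_l(\chi)\setminus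 A'_l(\chi))|}{n}>1-e^{-\lambda}(1+\delta)\right)=1,$$ where $n$ runs over $2\mathbb Z\cap k\mathbb Z$ and the sets are taken in the hypergraph $G_\sigma$ of the random homomorphism $\sigma$. -/

import Mathlib

open Filter Topology

namespace PlantedColoring

/-! Two-colorings of hypergraphs -/

section Coloring

variable {V : Type*}

/-- Every edge has exactly `k` vertices. -/
def IsUniform (H : Hypergraph V) (k : ℕ) : Prop :=
  ∀ e ∈ H.edgeSet, e.encard = k

/-- An edge is monochromatic when it carries exactly one color. -/
def IsMonochromatic (χ : V → Fin 2) (e : Set V) : Prop :=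
  (χ '' e).encard = 1

/-- A coloring is proper when no edge is monochromatic. -/
def IsProper (H : Hypergraph V) (χ : V → Fin 2) : Prop :=
  ∀ e ∈ H.edgeSet, ¬ IsMonochromatic χ e

/-- Both colors are used equally often. -/
def IsEquitable (χ : V → Fin 2) : Prop :=
  (χ ⁻¹' {0}).ncard = (χ ⁻¹' {1}).ncard

/-- The vertex `v` supports the edge `e` with respect to `χ`: it lies on `e`, and no other
vertex of `e` has the color of `v`. -/
def Supports (H : Hypergraph V) (χ : V → Fin 2) (v : V) (e : Set V) : Prop :=
  e ∈ H.edgeSet ∧ v ∈ e ∧ χ v ∉ χ '' (e \ {v})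

/-- The depth `l` core `C_l(χ)`. -/
def core (H : Hypergraph V) (χ : V → Fin 2) : ℕ → Set V
  | 0 => H.vertexSet
  | l + 1 => {v ∈ H.vertexSet | 3 ≤ {e | Supports H χ v e ∧ e \ {v} ⊆ core H χ l}.encard}

/-- The attached vertices `A_l(χ)`. For `l = 0` this is empty, because `C_0(χ)` is the whole
vertex set; so the value of `l - 1` at `l = 0` does not matter. -/
def attached (H : Hypergraph V) (χ : V → Fin 2) (l : ℕ) : Set V :=
  {v ∈ H.vertexSet | v ∉ core H χ l ∧ ∃ e, Supports H χ v e ∧ e \ {v} ⊆ core H χ (l - 1)}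

/-- The overlapping attached vertices `A'_l(χ)`. -/
def overlapping (H : Hypergraph V) (χ : V → Fin 2) (l : ℕ) : Set V :=
  {v ∈ attached H χ l | ∃ w ∈ attached H χ l, w ≠ v ∧
    ∃ e f, Supports H χ v e ∧ Supports H χ w f ∧
      e \ {v} ⊆ core H χ (l - 1) ∧ f \ {w} ⊆ core H χ (l - 1) ∧ (e ∩ f).Nonempty}

end Coloring

/-! The planted model -/

/-- The group `⟨s_1, …, s_d : s_1^k = ⋯ = s_d^k = 1⟩`, the free product of `d` copies of `ℤ/kℤ`. -/
abbrev Gam (k d : ℕ) : Type :=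
  PresentedGroup (Set.range fun i : Fin d => FreeGroup.of i ^ k)

/-- The generator `s_i`. -/
def gen (k d : ℕ) (i : Fin d) : Gam k d := PresentedGroup.of i

/-- The hypergraph `G_σ` of a homomorphism `σ : Γ → Sym(V)`: all points are vertices, and the
edges are the orbits `{σ(s_i^j) v : 0 ≤ j ≤ k - 1}` of the generator subgroups. -/
def actionHypergraph {k d : ℕ} {V : Type*} (σ : Gam k d →* Equiv.Perm V) : Hypergraph V where
  vertexSet := Set.univ
  edgeSet := {e | ∃ (i : Fin d) (v : V), e = {w | ∃ j < k, w = σ (gen k d i ^ j) v}}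
  subset_vertexSet_of_mem_edgeSet' _ _ := Set.subset_univ _

/-- `Hom_χ(Γ, Sym(n))`: the homomorphisms `σ` such that `G_σ` is `k`-uniform and `χ` is a proper
coloring of `G_σ`. -/
def plantedHom (k d : ℕ) {n : ℕ} (χ : Fin n → Fin 2) : Set (Gam k d →* Equiv.Perm (Fin n)) :=
  {σ | IsUniform (actionHypergraph σ) k ∧ IsProper (actionHypergraph σ) χ}

instance measurableSpaceHom (k d n : ℕ) : MeasurableSpace (Gam k d →* Equiv.Perm (Fin n)) := ⊤

/-- The planted model: the uniform probability measure on `Hom_χ(Γ, Sym(n))`. -/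
noncomputable def plantedMeasure (k d : ℕ) {n : ℕ} (χ : Fin n → Fin 2) :
    MeasureTheory.Measure (Gam k d →* Equiv.Perm (Fin n)) :=
  ProbabilityTheory.uniformOn (plantedHom k d χ)

/-- `λ = d / (2^(k-1) - 1)`. -/
noncomputable def lam (k d : ℕ) : ℝ := (d : ℝ) / ((2 : ℝ) ^ (k - 1) - 1)

/-- The event that `C_l(χ) ∪ A_l(χ) \ A'_l(χ)` has density greater than `1 - e^(-λ) (1 + δ)`. -/
def denseEvent (k d : ℕ) {n : ℕ} (χ : Fin n → Fin 2) (δ : ℝ) (l : ℕ) :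
    Set (Gam k d →* Equiv.Perm (Fin n)) :=
  {σ | ((core (actionHypergraph σ) χ l ∪
          (attached (actionHypergraph σ) χ l \ overlapping (actionHypergraph σ) χ l)).ncard : ℝ) / n
        > 1 - Real.exp (-lam k d) * (1 + δ)}

/-- `n → ∞` along the common multiples of `2` and `k`. -/
def sizes (k : ℕ) : Filter ℕ := atTop ⊓ 𝓟 {n | 2 ∣ n ∧ k ∣ n}

end PlantedColoring

/-! A point of the planted model is encoded by `d` bijections from the vertices to arrays of `r`
rows of length `k`, where `n = r * k`. The `i`-th generator rotates the rows of the `i`-th array, so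
the edges are the rows. All homomorphisms have equally many encodings, hence the planted measure
becomes counting over families of bijections without monochromatic rows (`plantedMeasure_le`). The
count is conditioned on the colors of the slots. Outside an exponentially small proportion of color
arrays, about a fraction `1 / (2 ^ (k - 1) - 1)` of the slots of each color carry a color unique in
their row (`eventually_card_not_typical_le`). Given such arrays, the bijections are uniform among
the color-preserving ones, and the positions of boundedly many vertices are almost independent
(`card_sat_le`). The number of edges supported by a vertex is thus nearly Poisson with mean `λ`, and
vertices supporting no edge have density about `e^(-λ)`. The remaining uncovered vertices must be
shown to be of smaller order.

Away from short cycles, a vertex outside a core has a finite witness. Either it supports at most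
three edges, which has probability at most some `P` of the form `poly(k) e^(-λ)`, or two of its
supported edges contain vertices that fail one level down. Iteration gives a binary tree
(`exists_tree`). The total weight `A` of the trees hanging from a given position obeys a recursion
`A ≤ θ (P + κ² A²)` with `θ` close to 1 and `κ` polynomial in `k`; it closes at `A = 4 P`, uniformly
in the depth (`WeightBounds.sum_tree_le`). An uncovered vertex that supports an edge combines two
such rare events: two trees, or few supported edges and one tree (`exists_witness`). This costs
`poly(k) e^(-2λ)`, negligible against `δ e^(-λ)` for large `k` since `λ ≥ k / 2` (`lam_bounds`).

An expectation bound of `(1 + δ/4) e^(-λ) n` does not by itself make a slightly larger count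
unlikely. Therefore `card_many_bad_mul_le` counts `p`-tuples of vertex-disjoint witnesses: their
number is at most the `p`-th power of the expectation, which leaves a probability of order `q ^ p`
with `q < 1`. Vertices near short cycles are handled by Markov's inequality, the expected number of
short loops being bounded in `n`. Thus the event has probability tending to 1 for each fixed depth
`l`. -/

open scoped Finset

namespace PlantedColoring

set_option linter.unusedSectionVars false

/-! ### Near independence of the positions of few vertices -/

section Placements

open Classical in
/-- The families of color-preserving bijections from the vertices to colored slots. -/
noncomputable def placements {V S : Type*} [Fintype V] [Fintype S] {d : ℕ}
    (χ : V → Fin 2) (c : Fin d → S → Fin 2) : Finset (Fin d → V ≃ S) :=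
  Finset.univ.filter fun β => ∀ i v, c i (β i v) = χ v

/-- A vertex together with the set of allowed positions in the `d` slot arrays. -/
abbrev Constraint (V S : Type*) (d : ℕ) := V × Set (Fin d → S)

/-- The family of bijections satisfies all constraints of the list. -/
def Sat {V S : Type*} {d : ℕ} (β : Fin d → V ≃ S) (L : List (Constraint V S d)) : Prop :=
  ∀ p ∈ L, (fun i => β i p.1) ∈ p.2

open Classical in
/-- The number of color-respecting positions allowed by a constraint. -/
noncomputable def numChoices {V S : Type*} [Fintype S] {d : ℕ}
    (χ : V → Fin 2) (c : Fin d → S → Fin 2) (p : Constraint V S d) : ℕ :=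
  #{y : Fin d → S | (∀ i, c i (y i) = χ p.1) ∧ y ∈ p.2}

/-- The normalized weight of a constraint list. -/
noncomputable def listWeight {V S : Type*} [Fintype S] {d : ℕ}
    (χ : V → Fin 2) (c : Fin d → S → Fin 2) (D : ℝ) (L : List (Constraint V S d)) : ℝ :=
  (L.map fun p => (numChoices χ c p : ℝ) / D).prod

/-- The family of bijections takes the prescribed values. -/
def Fits {V S : Type*} {d : ℕ} (β : Fin d → V ≃ S) (P : List (V × (Fin d → S))) : Prop :=
  ∀ p ∈ P, (fun i => β i p.1) = p.2

variable {V S : Type*} [Fintype V] [Fintype S] {d : ℕ} {χ : V → Fin 2} {c : Fin d → S → Fin 2}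

lemma mem_placements {β : Fin d → V ≃ S} :
    β ∈ placements χ c ↔ ∀ i v, c i (β i v) = χ v := by
  simp [placements]

lemma listWeight_nonneg {D : ℝ} (hD : 0 ≤ D) (L : List (Constraint V S d)) :
    0 ≤ listWeight χ c D L := by
  apply List.prod_nonneg
  intro a ha
  obtain ⟨p, -, rfl⟩ := List.mem_map.1 ha
  positivity

@[simp] lemma listWeight_nil {D : ℝ} : listWeight χ c D [] = 1 := rfl

@[simp] lemma listWeight_cons {D : ℝ} (p : Constraint V S d) (L : List (Constraint V S d)) :
    listWeight χ c D (p :: L) = numChoices χ c p / D * listWeight χ c D L := by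
  simp [listWeight]

@[simp] lemma listWeight_append {D : ℝ} (L L' : List (Constraint V S d)) :
    listWeight χ c D (L ++ L') = listWeight χ c D L * listWeight χ c D L' := by
  simp [listWeight]

lemma sat_append {β : Fin d → V ≃ S} {L L' : List (Constraint V S d)} :
    Sat β (L ++ L') ↔ Sat β L ∧ Sat β L' := by
  simp only [Sat, List.mem_append]
  constructor
  · exact fun H => ⟨fun p hp => H p (Or.inl hp), fun p hp => H p (Or.inr hp)⟩
  · rintro ⟨H, H'⟩ p (hp | hp)
    exacts [H p hp, H' p hp]

lemma sat_cons {β : Fin d → V ≃ S} {p : Constraint V S d} {L : List (Constraint V S d)} :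
    Sat β (p :: L) ↔ (fun i => β i p.1) ∈ p.2 ∧ Sat β L := by
  simp [Sat]

open Classical in
-- Switching argument. A placement sending `x` to `y` is composed with the swaps of `y i` and `y'
-- i`, where `y' i` has the color of `x` and is not prescribed by `P`. The result still fits `P` and
-- sends `x` to `y'`, so it determines `y'` and then the original placement. Each array offers at
-- least `h - m` such slots.
lemma card_fits_cons_mul_le {h m : ℕ} (hc : ∀ i a, h ≤ #{s | c i s = a})
    (P : List (V × (Fin d → S))) (hP : P.length ≤ m) (x : V) (hx : x ∉ P.map Prod.fst)
    (y : Fin d → S) :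
    #{β ∈ placements χ c | Fits β ((x, y) :: P)} * (h - m) ^ d
      ≤ #{β ∈ placements χ c | Fits β P} := by
  set Y : Finset (Fin d → S) := Fintype.piFinset fun i =>
    (Finset.univ.filter fun s => c i s = χ x) \ (P.map fun q => q.2 i).toFinset with hY
  have hYc : (h - m) ^ d ≤ #Y := by
    rw [hY, Fintype.card_piFinset]
    calc (h - m) ^ d = ∏ _i : Fin d, (h - m) := by simp
      _ ≤ _ := by
        apply Finset.prod_le_prod' fun i _ => ?_
        refine le_trans ?_ (Finset.le_card_sdiff _ _)
        have h1 := hc i (χ x)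
        have h2 := List.toFinset_card_le (P.map fun q => q.2 i)
        rw [List.length_map] at h2
        omega
  refine (Nat.mul_le_mul_left _ hYc).trans ?_
  rw [← Finset.card_product]
  refine Finset.card_le_card_of_injOn
    (fun q => fun i => (q.1 i).trans (Equiv.swap (y i) (q.2 i))) ?_ ?_
  · rintro ⟨β, y'⟩ hq
    simp only [Finset.coe_product, Set.mem_prod, Finset.mem_coe, Finset.mem_filter,
      mem_placements, hY, Fintype.mem_piFinset, Finset.mem_sdiff, Finset.mem_univ, true_and,
      List.mem_toFinset, List.mem_map, not_exists, not_and] at hq ⊢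
    obtain ⟨⟨hβ, hf⟩, hy'⟩ := hq
    have hxy : ∀ i, β i x = y i := fun i => congrFun (hf (x, y) (by simp)) i
    constructor
    · intro i v
      simp only [Equiv.trans_apply]
      rw [Equiv.swap_apply_def]
      split_ifs with h1 h2
      · rw [(hy' i).1, ← hxy i] at *
        rw [(β i).injective h1]
      · rw [← hxy i, hβ i x, ← (hy' i).1, ← h2, hβ]
      · exact hβ i v
    · rintro ⟨v, z⟩ hvz
      have hvx : v ≠ x := by
        rintro rfl
        exact hx (List.mem_map.2 ⟨_, hvz, rfl⟩)
      have hv : ∀ i, β i v = z i := fun i => congrFun (hf (v, z) (by simp [hvz])) i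
      funext i
      simp only [Equiv.trans_apply]
      rw [hv i, Equiv.swap_apply_of_ne_of_ne]
      · rw [← hv i, ← hxy i]
        exact fun h => hvx ((β i).injective h)
      · exact (hy' i).2 (v, z) hvz
  · rintro ⟨β, y'⟩ hq ⟨β', z'⟩ hq' heq
    simp only [Finset.coe_product, Set.mem_prod, Finset.mem_coe, Finset.mem_filter] at hq hq'
    have hxy : ∀ i, β i x = y i := fun i => congrFun (hq.1.2 (x, y) (by simp)) i
    have hxy' : ∀ i, β' i x = y i := fun i => congrFun (hq'.1.2 (x, y) (by simp)) i
    have hyz : y' = z' := by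
      funext i
      have := congrArg (fun e : V ≃ S => e x) (congrFun heq i)
      simpa [hxy, hxy'] using this
    subst hyz
    congr 1
    funext i
    have := congrFun heq i
    ext v
    have := congrArg (fun e : V ≃ S => e v) this
    simpa using this

open Classical in
-- The constrained vertices are exposed one at a time, and `P` records the positions already
-- exposed. Each exposure is a union over the admissible positions, every one of which is controlled
-- by the switching bound.
lemma card_fits_sat_mul_le {h m : ℕ} (hc : ∀ i a, h ≤ #{s | c i s = a})
    (L : List (Constraint V S d)) :
    ∀ (P : List (V × (Fin d → S))), P.length + L.length ≤ m →
      (P.map Prod.fst ++ L.map Prod.fst).Nodup →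
    #{β ∈ placements χ c | Fits β P ∧ Sat β L} * ((h - m) ^ d) ^ L.length
      ≤ #{β ∈ placements χ c | Fits β P} * (L.map (numChoices χ c)).prod := by
  induction L with
  | nil => intro P _ _; simp [Sat]
  | cons p L ih =>
    intro P hm hnd
    obtain ⟨x, F⟩ := p
    simp only [List.map_cons, List.length_cons] at hm hnd ⊢
    have hnd' : (P.map Prod.fst ++ x :: L.map Prod.fst).Perm
      ((x :: P.map Prod.fst) ++ L.map Prod.fst) := List.perm_middle
    have hnd2 := hnd'.nodup_iff.1 hnd
    set Y : Finset (Fin d → S) :=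
      {y : Fin d → S | (∀ i, c i (y i) = χ x) ∧ y ∈ F} with hY
    have hsub : ({β ∈ placements χ c | Fits β P ∧ Sat β ((x, F) :: L)} : Finset _) ⊆
        Y.biUnion fun y => {β ∈ placements χ c | Fits β ((x, y) :: P) ∧ Sat β L} := by
      intro β hβ
      simp only [Finset.mem_filter, Finset.mem_biUnion, sat_cons, mem_placements] at hβ ⊢
      refine ⟨fun i => β i x, ?_, hβ.1, ?_, hβ.2.2.2⟩
      · simp only [hY, Finset.mem_filter, Finset.mem_univ, true_and]
        exact ⟨fun i => hβ.1 i x, hβ.2.2.1⟩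
      · intro q hq
        rcases List.mem_cons.1 hq with rfl | hq
        · rfl
        · exact hβ.2.1 q hq
    have hcard := (Finset.card_le_card hsub).trans Finset.card_biUnion_le
    calc _ ≤ (∑ y ∈ Y, #{β ∈ placements χ c | Fits β ((x, y) :: P) ∧ Sat β L})
            * ((h - m) ^ d) ^ (L.length + 1) := Nat.mul_le_mul_right _ hcard
      _ = ∑ y ∈ Y, (#{β ∈ placements χ c | Fits β ((x, y) :: P) ∧ Sat β L}
            * ((h - m) ^ d) ^ L.length) * (h - m) ^ d := by
          rw [Finset.sum_mul]
          exact Finset.sum_congr rfl fun y _ => by ring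
      _ ≤ ∑ y ∈ Y, (#{β ∈ placements χ c | Fits β ((x, y) :: P)}
            * (L.map (numChoices χ c)).prod) * (h - m) ^ d := by
          refine Finset.sum_le_sum fun y _ => Nat.mul_le_mul_right _ ?_
          apply ih
          · simp only [List.length_cons]; omega
          · simpa using hnd2
      _ = ∑ y ∈ Y, (#{β ∈ placements χ c | Fits β ((x, y) :: P)} * (h - m) ^ d)
            * (L.map (numChoices χ c)).prod := Finset.sum_congr rfl fun y _ => by ring
      _ ≤ ∑ y ∈ Y, #{β ∈ placements χ c | Fits β P} * (L.map (numChoices χ c)).prod := by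
          refine Finset.sum_le_sum fun y _ => Nat.mul_le_mul_right _ ?_
          apply card_fits_cons_mul_le hc P (by omega)
          rw [List.cons_append, List.nodup_cons] at hnd2
          exact fun hx => hnd2.1 (List.mem_append_left _ hx)
      _ = _ := by
          rw [Finset.sum_const, smul_eq_mul, List.prod_cons]
          have : numChoices χ c (x, F) = #Y := rfl
          rw [this]
          ring

open Classical in
/-- Constraints on distinct vertices are satisfied at most as often as if the positions of the
vertices were independent, up to the choice of the normalization. -/
lemma card_sat_le {h m : ℕ} (hc : ∀ i a, h ≤ #{s | c i s = a}) (hm : m < h)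
    (L : List (Constraint V S d)) (hL : L.length ≤ m) (hnd : (L.map Prod.fst).Nodup) :
    (#{β ∈ placements χ c | Sat β L} : ℝ)
      ≤ #(placements χ c) * listWeight χ c (((h - m : ℕ) : ℝ) ^ d) L := by
  have key := card_fits_sat_mul_le (χ := χ) hc L [] (by simpa using hL) (by simpa using hnd)
  simp only [Fits, List.not_mem_nil, false_imp_iff, implies_true, true_and,
    Finset.filter_true] at key
  have hD : (0 : ℝ) < (((h - m : ℕ) : ℝ) ^ d) := by
    have : 0 < h - m := by omega
    positivity
  have e : listWeight χ c (((h - m : ℕ) : ℝ) ^ d) L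
      = ((L.map (numChoices χ c)).prod : ℕ) / (((h - m : ℕ) : ℝ) ^ d) ^ L.length := by
    clear key hnd hL
    induction L with
    | nil => simp
    | cons p L ih => rw [listWeight_cons, ih]; simp [pow_succ]; field_simp
  rw [e, ← mul_div_assoc, le_div_iff₀ (by positivity)]
  exact_mod_cast key

end Placements

/-! ### Moment method with disjoint witnesses -/

section Moment

variable {V S : Type*} [Fintype V] [Fintype S] {d : ℕ} {χ : V → Fin 2} {c : Fin d → S → Fin 2}
  {ι : Type*} [Fintype ι]

open Classical in
/-- The number of `p`-tuples of satisfied constraint lists that extend `L₀` by new vertices. -/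
noncomputable def disjointTuples (lst : ι → List (Constraint V S d)) (β : Fin d → V ≃ S) :
    ℕ → List (Constraint V S d) → ℕ
  | 0, _ => 1
  | p + 1, L₀ => ∑ T : ι, if Sat β (lst T) ∧ ((L₀ ++ lst T).map Prod.fst).Nodup then
      disjointTuples lst β p (L₀ ++ lst T) else 0

open Classical in
-- Weights of lists on disjoint vertex sets multiply, so each of the `p` successive choices
-- contributes a factor `W`. The condition `L₀.length + p * M ≤ m` keeps all exposed vertices within
-- the normalization.
lemma sum_disjointTuples_le {h m M : ℕ} (hc : ∀ i a, h ≤ #{s | c i s = a}) (hm : m < h)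
    (lst : ι → List (Constraint V S d)) (hM : ∀ T, (lst T).length ≤ M) {W : ℝ}
    (hW : ∑ T, listWeight χ c (((h - m : ℕ) : ℝ) ^ d) (lst T) ≤ W) (p : ℕ) :
    ∀ L₀ : List (Constraint V S d), L₀.length + p * M ≤ m → (L₀.map Prod.fst).Nodup →
      (∑ β ∈ placements χ c with Sat β L₀, (disjointTuples lst β p L₀ : ℝ))
        ≤ #(placements χ c) * listWeight χ c (((h - m : ℕ) : ℝ) ^ d) L₀ * W ^ p := by
  set D : ℝ := ((h - m : ℕ) : ℝ) ^ d
  have hD : 0 ≤ D := by positivity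
  have hW0 : 0 ≤ W := (Finset.sum_nonneg fun T _ => listWeight_nonneg hD _).trans hW
  induction p with
  | zero =>
    intro L₀ h1 h2
    simp only [disjointTuples, Nat.cast_one, Finset.sum_const, nsmul_eq_mul, mul_one, pow_zero]
    exact card_sat_le hc hm L₀ (by omega) h2
  | succ p ih =>
    intro L₀ h1 h2
    simp only [disjointTuples, Nat.cast_sum]
    rw [Finset.sum_comm]
    calc _ ≤ ∑ T : ι, #(placements χ c) * (listWeight χ c D L₀ * listWeight χ c D (lst T))
              * W ^ p := by
          refine Finset.sum_le_sum fun T _ => ?_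
          by_cases hnd : ((L₀ ++ lst T).map Prod.fst).Nodup
          · have := ih (L₀ ++ lst T) (by
              have := hM T
              rw [List.length_append]
              nlinarith) hnd
            rw [listWeight_append] at this
            refine le_trans (le_of_eq ?_) this
            simp only [hnd, and_true, sat_append, Finset.sum_filter]
            refine Finset.sum_congr rfl fun β _ => ?_
            by_cases ha : Sat β L₀ <;> by_cases hb : Sat β (lst T) <;> simp [ha, hb]
          · simp only [hnd, and_false, if_false, Nat.cast_zero, Finset.sum_const_zero]
            have := listWeight_nonneg (χ := χ) (c := c) hD L₀
            have := listWeight_nonneg (χ := χ) (c := c) hD (lst T)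
            positivity
      _ = #(placements χ c) * listWeight χ c D L₀ * W ^ p
            * ∑ T : ι, listWeight χ c D (lst T) := by
          rw [Finset.mul_sum]
          exact Finset.sum_congr rfl fun T _ => by ring
      _ ≤ #(placements χ c) * listWeight χ c D L₀ * W ^ p * W := by
          have := listWeight_nonneg (χ := χ) (c := c) hD L₀
          gcongr
      _ = _ := by ring

open Classical in
-- Greedy selection. A list can meet the vertices already used only if its root is near one of them,
-- and each used vertex spoils at most `C` roots. Hence each of the `p` choices has at least `N - C
-- * (L₀.length + p * M)` options.
lemma pow_le_disjointTuples {M C N : ℕ} (lst : ι → List (Constraint V S d))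
    (hM : ∀ T, (lst T).length ≤ M) (β : Fin d → V ≃ S) (bad : Finset V) (near : V → Finset V)
    (hnear : ∀ x, #(near x) ≤ C)
    (hbad : ∀ v ∈ bad, ∃ T, Sat β (lst T) ∧ ((lst T).map Prod.fst).Nodup ∧
      ((lst T).map Prod.fst).head? = some v ∧ ∀ x ∈ (lst T).map Prod.fst, v ∈ near x)
    (hN : N ≤ #bad) (p : ℕ) :
    ∀ L₀ : List (Constraint V S d), (L₀.map Prod.fst).Nodup →
      (N - C * (L₀.length + p * M)) ^ p ≤ disjointTuples lst β p L₀ := by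
  rcases isEmpty_or_nonempty ι with hι | hι
  · have hb : bad = ∅ := Finset.eq_empty_of_forall_notMem fun v hv =>
      hι.false (hbad v hv).choose
    have hN0 : N = 0 := by simpa [hb] using hN
    intro L₀ _
    cases p <;> simp [disjointTuples, hN0]
  choose! T hT1 hT2 hT3 hT4 using hbad
  induction p with
  | zero => intro L₀ _; simp [disjointTuples]
  | succ p ih =>
    intro L₀ hL₀
    simp only [disjointTuples]
    set U : Finset V := bad \ (L₀.map Prod.fst).toFinset.biUnion near with hU
    have hUc : N - C * L₀.length ≤ #U := by
      refine le_trans ?_ (Finset.le_card_sdiff _ _)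
      have : #((L₀.map Prod.fst).toFinset.biUnion near) ≤ L₀.length * C := by
        refine Finset.card_biUnion_le_card_mul _ _ C (fun x _ => hnear x) |>.trans ?_
        gcongr
        simpa using List.toFinset_card_le (L₀.map Prod.fst)
      rw [mul_comm] at this
      omega
    -- A list determines its root, which is its head.
    have hinj : Set.InjOn T (U : Set V) := by
      intro v hv w hw hvw
      simp only [hU, Finset.coe_sdiff, Set.mem_sdiff, Finset.mem_coe] at hv hw
      have h1 := hT3 v hv.1
      have h2 := hT3 w hw.1
      rw [hvw, h2] at h1
      simpa using h1.symm
    calc (N - C * (L₀.length + (p + 1) * M)) ^ (p + 1)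
        ≤ #U * (N - C * (L₀.length + (p + 1) * M)) ^ p := by
          rw [pow_succ, mul_comm]
          gcongr
          refine le_trans ?_ hUc
          apply Nat.sub_le_sub_left
          gcongr
          omega
      _ = ∑ _v ∈ U, (N - C * (L₀.length + (p + 1) * M)) ^ p := by simp
      _ ≤ ∑ v ∈ U, disjointTuples lst β p (L₀ ++ lst (T v)) := by
          refine Finset.sum_le_sum fun v hv => ?_
          have hv' := hv
          simp only [hU, Finset.mem_sdiff, Finset.mem_biUnion, not_exists, not_and,
            List.mem_toFinset] at hv'
          refine le_trans ?_ (ih (L₀ ++ lst (T v)) ?_)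
          · apply Nat.pow_le_pow_left
            apply Nat.sub_le_sub_left
            apply Nat.mul_le_mul_left
            have := hM (T v)
            rw [List.length_append, Nat.succ_mul]
            omega
          · rw [List.map_append]
            refine List.nodup_append.2 ⟨hL₀, hT2 v hv'.1, ?_⟩
            rintro a ha _ hb rfl
            exact hv'.2 a ha (hT4 v hv'.1 a hb)
      _ = ∑ t ∈ U.image T, disjointTuples lst β p (L₀ ++ lst t) := by
          rw [Finset.sum_image hinj]
      _ = ∑ t ∈ U.image T, if Sat β (lst t) ∧ ((L₀ ++ lst t).map Prod.fst).Nodup then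
            disjointTuples lst β p (L₀ ++ lst t) else 0 := by
          refine Finset.sum_congr rfl fun t ht => ?_
          obtain ⟨v, hv, rfl⟩ := Finset.mem_image.1 ht
          have hv' := hv
          simp only [hU, Finset.mem_sdiff, Finset.mem_biUnion, not_exists, not_and,
            List.mem_toFinset] at hv'
          rw [if_pos]
          refine ⟨hT1 v hv'.1, ?_⟩
          rw [List.map_append]
          refine List.nodup_append.2 ⟨hL₀, hT2 v hv'.1, ?_⟩
          rintro a ha _ hb rfl
          exact hv'.2 a ha (hT4 v hv'.1 a hb)
      _ ≤ _ := Finset.sum_le_sum_of_subset (Finset.subset_univ _)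

open Classical in
/-- If every bad vertex is the root of a satisfied constraint list on nearby vertices, then it is
unlikely that there are many more bad vertices than the total weight of all lists. -/
lemma card_many_bad_mul_le {h m M C N : ℕ} (hc : ∀ i a, h ≤ #{s | c i s = a}) (hm : m < h)
    (lst : ι → List (Constraint V S d)) (hM : ∀ T, (lst T).length ≤ M) {W : ℝ}
    (hW : ∑ T, listWeight χ c (((h - m : ℕ) : ℝ) ^ d) (lst T) ≤ W) (p : ℕ) (hp : p * M ≤ m)
    (bad : (Fin d → V ≃ S) → Finset V) (near : (Fin d → V ≃ S) → V → Finset V)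
    (hnear : ∀ β x, #(near β x) ≤ C)
    (hbad : ∀ β ∈ placements χ c, ∀ v ∈ bad β, ∃ T, Sat β (lst T) ∧
      ((lst T).map Prod.fst).Nodup ∧ ((lst T).map Prod.fst).head? = some v ∧
      ∀ x ∈ (lst T).map Prod.fst, v ∈ near β x) :
    (#{β ∈ placements χ c | N ≤ #(bad β)} : ℝ) * ((N - C * (p * M) : ℕ) : ℝ) ^ p
      ≤ #(placements χ c) * W ^ p := by
  have h1 := sum_disjointTuples_le (χ := χ) hc hm lst hM hW p [] (by simpa using hp) (by simp)
  simp only [listWeight_nil, mul_one] at h1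
  refine le_trans ?_ h1
  calc _ = ∑ β ∈ placements χ c with N ≤ #(bad β), ((N - C * (p * M) : ℕ) : ℝ) ^ p := by simp
    _ ≤ ∑ β ∈ placements χ c with N ≤ #(bad β), (disjointTuples lst β p [] : ℝ) := by
        refine Finset.sum_le_sum fun β hβ => ?_
        rw [Finset.mem_filter] at hβ
        have := pow_le_disjointTuples lst hM β (bad β) (near β) (hnear β) (hbad β hβ.1) hβ.2 p []
          (by simp)
        simp only [List.length_nil, zero_add] at this
        exact_mod_cast this
    _ ≤ _ := by
        apply Finset.sum_le_sum_of_subset_of_nonneg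
        · intro β hβ
          rw [Finset.mem_filter] at hβ ⊢
          exact ⟨hβ.1, by simp [Sat]⟩
        · intros; positivity

end Moment


/-! ### Slot arrays, their rows as edges, and reduced walks -/

section Blocks

/-- The slots of a perfect `k`-uniform partition: `r` rows of length `k`. -/
abbrev Slot (r k : ℕ) := Fin r × ZMod k

/-- The slot carries a color that occurs nowhere else in its row. -/
def IsSupportSlot {r k : ℕ} (c : Slot r k → Fin 2) (s : Slot r k) : Prop :=
  ∀ s', s'.1 = s.1 → s' ≠ s → c s' ≠ c s

variable {V : Type*} {r k d : ℕ}

/-- The vertices placed in the same row as `v` by the `i`-th bijection. -/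
def block (β : Fin d → V ≃ Slot r k) (i : Fin d) (v : V) : Set V :=
  {w | (β i w).1 = (β i v).1}

/-- The hypergraph whose edges are the rows of all bijections. -/
def blockHypergraph (β : Fin d → V ≃ Slot r k) : Hypergraph V where
  vertexSet := Set.univ
  edgeSet := {e | ∃ i v, e = block β i v}
  subset_vertexSet_of_mem_edgeSet' _ _ := Set.subset_univ _

/-- Two distinct vertices in the same row of the `i`-th bijection. -/
def Step (β : Fin d → V ≃ Slot r k) (i : Fin d) (x y : V) : Prop :=
  x ≠ y ∧ (β i x).1 = (β i y).1

lemma Step.symm {β : Fin d → V ≃ Slot r k} {i : Fin d} {x y : V} (h : Step β i x y) :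
    Step β i y x := ⟨h.1.symm, h.2.symm⟩

/-- Reduced walks `x → y` of given length with given first and last label; consecutive steps
have different labels. -/
inductive RWalk (β : Fin d → V ≃ Slot r k) : ℕ → Fin d → V → Fin d → V → Prop
  | single {i x y} : Step β i x y → RWalk β 1 i x i y
  | cons {i j f x y z m} : Step β i x y → i ≠ j → RWalk β m j y f z → RWalk β (m + 1) i x f z

/-- Equal vertices, or vertices in a common row. -/
def Adjacent (β : Fin d → V ≃ Slot r k) (x y : V) : Prop :=
  x = y ∨ ∃ i, (β i x).1 = (β i y).1

/-- `y` has distance at most `R` from `x`. -/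
def Near (β : Fin d → V ≃ Slot r k) : ℕ → V → V → Prop
  | 0, x, y => x = y
  | R + 1, x, y => ∃ z, Adjacent β x z ∧ Near β R z y

/-- No closed reduced walk of length at most `M` starts at `y`. -/
def NoCycle (β : Fin d → V ≃ Slot r k) (M : ℕ) (y : V) : Prop :=
  ∀ m i f, m ≤ M → ¬ RWalk β m i y f y

/-- No vertex within distance `R` of `x` lies on a closed reduced walk of length at most `M`. -/
def Clean (β : Fin d → V ≃ Slot r k) (M R : ℕ) (x : V) : Prop :=
  ∀ y, Near β R x y → NoCycle β M y

variable {β : Fin d → V ≃ Slot r k}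

lemma RWalk.append {m m' : ℕ} {i f j g : Fin d} {x y z : V} (h : RWalk β m i x f y)
    (hfj : f ≠ j) (h' : RWalk β m' j y g z) : RWalk β (m + m') i x g z := by
  induction h with
  | single hs => rw [add_comm]; exact .cons hs hfj h'
  | cons hs hne _ ih => rw [add_right_comm]; exact .cons hs hne (ih hfj h')

lemma RWalk.reverse {m : ℕ} {i f : Fin d} {x y : V} (h : RWalk β m i x f y) :
    RWalk β m f y i x := by
  induction h with
  | single hs => exact .single hs.symm
  | cons hs hne _ ih => exact ih.append hne.symm (.single hs.symm)

lemma Adjacent.symm {x y : V} (h : Adjacent β x y) : Adjacent β y x := by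
  rcases h with rfl | ⟨i, hi⟩
  exacts [Or.inl rfl, Or.inr ⟨i, hi.symm⟩]

lemma Near.trans {R R' : ℕ} {x y z : V} (h : Near β R x y) (h' : Near β R' y z) :
    Near β (R + R') x z := by
  induction R generalizing x with
  | zero => cases h; rwa [zero_add]
  | succ R ih =>
    obtain ⟨w, hw, hy⟩ := h
    rw [add_right_comm]
    exact ⟨w, hw, ih hy⟩

lemma Adjacent.near {x y : V} (h : Adjacent β x y) : Near β 1 x y := ⟨y, h, rfl⟩

lemma Near.refl (R : ℕ) (x : V) : Near β R x x := by
  induction R with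
  | zero => rfl
  | succ R ih => exact ⟨x, Or.inl rfl, ih⟩

lemma Near.mono {R R' : ℕ} {x y : V} (h : Near β R x y) (hR : R ≤ R') : Near β R' x y := by
  obtain ⟨t, rfl⟩ := Nat.exists_eq_add_of_le hR
  exact h.trans (Near.refl t y)

lemma Near.symm {R : ℕ} {x y : V} (h : Near β R x y) : Near β R y x := by
  induction R generalizing x with
  | zero => cases h; rfl
  | succ R ih =>
    obtain ⟨w, hw, hy⟩ := h
    exact (ih hy).trans hw.symm.near

lemma Step.near {i : Fin d} {x y : V} (h : Step β i x y) : Near β 1 x y :=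
  Adjacent.near (Or.inr ⟨i, h.2⟩)

lemma RWalk.near {m : ℕ} {i f : Fin d} {x y : V} (h : RWalk β m i x f y) : Near β m x y := by
  induction h with
  | single hs => exact hs.near
  | cons hs _ _ ih => rw [add_comm]; exact hs.near.trans ih

lemma Clean.of_near {M R R' : ℕ} {x y : V} (h : Clean β M (R + R') x) (hxy : Near β R x y) :
    Clean β M R' y := fun z hz => h z (hxy.trans hz)

lemma Clean.noCycle {M R : ℕ} {x : V} (h : Clean β M R x) : NoCycle β M x :=
  h x (Near.refl R x)

open Classical in
lemma card_near_le [Fintype V] [NeZero k] (R : ℕ) (x : V) :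
    #{y | Near β R x y} ≤ (d * k + 1) ^ R := by
  induction R generalizing x with
  | zero =>
    refine (Finset.card_le_card (t := {x}) fun y hy => ?_).trans (by simp)
    rw [Finset.mem_filter] at hy
    exact Finset.mem_singleton.2 hy.2.symm
  | succ R ih =>
    have hrow : ∀ i, #{z | (β i x).1 = (β i z).1} ≤ k := by
      intro i
      calc _ ≤ #(Finset.univ : Finset (ZMod k)) := by
            apply Finset.card_le_card_of_injOn (fun z => (β i z).2) (by simp)
            intro a ha b hb hab
            simp only [Finset.coe_filter, Finset.mem_univ, true_and, Set.mem_ofPred_eq] at ha hb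
            exact (β i).injective (Prod.ext (ha.symm.trans hb) hab)
        _ = k := by simp [ZMod.card]
    have hadj : #{z | Adjacent β x z} ≤ d * k + 1 := by
      have hs : ({z | Adjacent β x z} : Finset V) ⊆
          insert x (Finset.univ.biUnion fun i => {z | (β i x).1 = (β i z).1}) := by
        intro z hz
        simp only [Finset.mem_filter, Finset.mem_univ, true_and, Finset.mem_insert,
          Finset.mem_biUnion] at hz ⊢
        rcases hz with rfl | h
        exacts [Or.inl rfl, Or.inr h]
      refine (Finset.card_le_card hs).trans ((Finset.card_insert_le _ _).trans ?_)
      gcongr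
      refine (Finset.card_biUnion_le_card_mul _ _ k fun i _ => hrow i).trans ?_
      simp
    have hs : ({y | Near β (R + 1) x y} : Finset V) ⊆
        ({z | Adjacent β x z} : Finset V).biUnion fun z => {y | Near β R z y} := by
      intro y hy
      simp only [Finset.mem_filter, Finset.mem_univ, true_and, Finset.mem_biUnion] at hy ⊢
      exact hy
    refine (Finset.card_le_card hs).trans ?_
    refine (Finset.card_biUnion_le_card_mul _ _ _ fun z _ => ih z).trans ?_
    rw [pow_succ']
    gcongr

lemma mem_block_self (i : Fin d) (v : V) : v ∈ block β i v := rfl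

lemma block_eq {i : Fin d} {v w : V} (h : w ∈ block β i v) : block β i v = block β i w := by
  ext x
  simp only [block, Set.mem_ofPred_eq] at h ⊢
  rw [h]

lemma mem_block_diff {i : Fin d} {v w : V} : w ∈ block β i v \ {v} ↔ Step β i v w := by
  simp only [block, Step, Set.mem_sdiff, Set.mem_ofPred_eq, Set.mem_singleton_iff]
  constructor
  · exact fun h => ⟨fun e => h.2 e.symm, h.1.symm⟩
  · exact fun h => ⟨h.2.symm, fun e => h.1 e.symm⟩

end Blocks

/-! ### Supported edges and vertices leaving the core -/

section Supports

variable {V : Type*} [Fintype V] {r k d : ℕ} [NeZero k] {β : Fin d → V ≃ Slot r k}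
  {χ : V → Fin 2} {c : Fin d → Slot r k → Fin 2}

lemma supports_iff (hβ : β ∈ placements χ c) {v : V} {e : Set V} :
    Supports (blockHypergraph β) χ v e ↔
      ∃ i, e = block β i v ∧ IsSupportSlot (c i) (β i v) := by
  rw [mem_placements] at hβ
  constructor
  · rintro ⟨⟨i, v', rfl⟩, hv, hχ⟩
    refine ⟨i, block_eq hv, fun s' h1 h2 h3 => hχ ⟨(β i).symm s', ⟨?_, ?_⟩, ?_⟩⟩
    · rw [block_eq hv]
      simp [block, h1]
    · rw [Set.mem_singleton_iff]
      rintro rfl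
      simp at h2
    · rw [← hβ i, ← hβ i v, ← h3]
      simp
  · rintro ⟨i, rfl, hs⟩
    refine ⟨⟨i, v, rfl⟩, rfl, ?_⟩
    rintro ⟨w, ⟨hw1, hw2⟩, hw⟩
    refine hs (β i w) hw1 (fun h => hw2 ((β i).injective h)) ?_
    rw [hβ, hβ, hw]

/-- On a row of length at least three, at most one slot carries a unique color. -/
lemma IsSupportSlot.not_of_ne (hk : 3 ≤ k) {c : Slot r k → Fin 2} {s s' : Slot r k}
    (hs : IsSupportSlot c s) (h1 : s'.1 = s.1) (h2 : s' ≠ s) : ¬ IsSupportSlot c s' := by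
  intro hs'
  have : ∃ b : ZMod k, b ≠ s.2 ∧ b ≠ s'.2 := by
    by_contra! hcon
    have hsub : (Finset.univ : Finset (ZMod k)) ⊆ {s.2, s'.2} := by
      intro b _
      by_cases hb : b = s.2
      · simp [hb]
      · simp [hcon b hb]
    have := (Finset.card_le_card hsub).trans Finset.card_le_two
    simp [ZMod.card] at this
    omega
  obtain ⟨b, hb, hb'⟩ := this
  have e1 := hs (s.1, b) rfl (fun h => hb (congrArg Prod.snd h))
  have e2 := hs' (s.1, b) h1.symm (fun h => hb' (congrArg Prod.snd h))
  have e3 := hs s' h1 h2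
  generalize c (s.1, b) = p at *
  generalize c s = q at *
  generalize c s' = t at *
  revert e1 e2 e3
  revert p q t
  decide

open Classical in
-- Three supported rows inside the core of depth `l` would put `x` into the core of depth `l + 1`.
-- So at most two of the four or more supported rows are of this kind, and two others remain. The
-- core counts edges as sets; the absence of closed walks of length two makes rows with different
-- labels different edges.
lemma exists_two_bad_blocks (hβ : β ∈ placements χ c) (hk : 3 ≤ k) {l : ℕ} {x : V} {M : ℕ}
    (hM : 2 ≤ M) (hx : NoCycle β M x) (hcore : x ∉ core (blockHypergraph β) χ (l + 1))
    (hI : 4 ≤ #{i | IsSupportSlot (c i) (β i x)}) :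
    ∃ i j, i ≠ j ∧ (∃ u, IsSupportSlot (c i) (β i x) ∧ Step β i x u ∧
        u ∉ core (blockHypergraph β) χ l) ∧
      ∃ u, IsSupportSlot (c j) (β j x) ∧ Step β j x u ∧ u ∉ core (blockHypergraph β) χ l := by
  set I : Finset (Fin d) := {i | IsSupportSlot (c i) (β i x)} with hIdef
  set G : Finset (Fin d) := {i ∈ I | ∀ u, Step β i x u → u ∈ core (blockHypergraph β) χ l}
  have hG : #G ≤ 2 := by
    by_contra! h3
    apply hcore
    refine ⟨trivial, ?_⟩
    have hinj : Set.InjOn (fun i => block β i x) (G : Set (Fin d)) := by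
      intro i _ j _ hij
      by_contra hne
      have hb : ∃ b : ZMod k, b ≠ (β i x).2 := by
        have : Fact (1 < k) := ⟨by omega⟩
        exact exists_ne _
      obtain ⟨b, hb⟩ := hb
      set u := (β i).symm ((β i x).1, b) with hu
      have hstep : Step β i x u := by
        constructor
        · intro hxu
          apply hb
          rw [hu] at hxu
          have := congrArg (β i) hxu
          rw [Equiv.apply_symm_apply] at this
          rw [this]
        · simp [hu]
      have hstep' : Step β j x u := by
        rw [← mem_block_diff] at hstep ⊢
        exact ⟨(show block β i x = block β j x from hij) ▸ hstep.1, hstep.2⟩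
      -- If the rows of `x` in arrays `i` and `j` coincided, `x → u → x` would be a closed reduced
      -- walk.
      exact hx 2 i j hM (.cons hstep hne (.single hstep'.symm))
    have : ((fun i => block β i x) '' (G : Set (Fin d))).encard = #G := by
      rw [hinj.encard_image, Set.encard_coe_eq_coe_finsetCard]
    refine le_trans ?_ (Set.encard_le_encard (s := (fun i => block β i x) '' (G : Set (Fin d))) ?_)
    · rw [this]
      exact_mod_cast h3
    · rintro _ ⟨i, hi, rfl⟩
      simp only [G, hIdef, Finset.coe_filter, Finset.mem_filter, Finset.mem_univ, true_and,
        Set.mem_ofPred_eq] at hi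
      exact ⟨(supports_iff hβ).2 ⟨i, rfl, hi.1⟩, fun u hu => hi.2 u (mem_block_diff.1 hu)⟩
  have h2 : 1 < #(I \ G) := by
    have := Finset.le_card_sdiff G I
    omega
  obtain ⟨i, hi, j, hj, hij⟩ := Finset.one_lt_card.1 h2
  refine ⟨i, j, hij, ?_, ?_⟩
  · simp only [G, hIdef, Finset.mem_sdiff, Finset.mem_filter, Finset.mem_univ, true_and,
      not_and, not_forall] at hi
    obtain ⟨u, hu, hu'⟩ := hi.2 hi.1
    exact ⟨u, hi.1, hu, hu'⟩
  · simp only [G, hIdef, Finset.mem_sdiff, Finset.mem_filter, Finset.mem_univ, true_and,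
      not_and, not_forall] at hj
    obtain ⟨u, hu, hu'⟩ := hj.2 hj.1
    exact ⟨u, hj.1, hu, hu'⟩

lemma core_succ_subset {V : Type*} (H : Hypergraph V) (χ : V → Fin 2) (l : ℕ) :
    core H χ (l + 1) ⊆ core H χ l := by
  induction l with
  | zero => exact fun v hv => hv.1
  | succ l ih =>
    intro v hv
    refine ⟨hv.1, hv.2.trans (Set.encard_le_encard fun e he => ⟨he.1, he.2.trans ih⟩)⟩

end Supports

/-! ### Tree witnesses for vertices outside the core -/

section Trees

variable {V : Type} {r k d : ℕ}

/-- A pair of distinct slots in a common row, one of which has a unique color in its row. -/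
def Linked (c : Fin d → Slot r k → Fin 2) (e : Fin d × Slot r k × Slot r k) : Prop :=
  e.2.1.1 = e.2.2.1 ∧ e.2.1 ≠ e.2.2 ∧
    (IsSupportSlot (c e.1) e.2.1 ∨ IsSupportSlot (c e.1) e.2.2)

open Classical in
/-- Position `q` in one array and at most three support slots in the others. -/
def lowSet (c : Fin d → Slot r k → Fin 2) (q : Fin d × Slot r k) : Set (Fin d → Slot r k) :=
  {y | y q.1 = q.2 ∧ #{j | j ≠ q.1 ∧ IsSupportSlot (c j) (y j)} ≤ 3}

/-- Position `q` in one array and links `e`, `e'` starting in two others. -/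
def forkSet (c : Fin d → Slot r k → Fin 2) (q : Fin d × Slot r k)
    (e e' : Fin d × Slot r k × Slot r k) : Set (Fin d → Slot r k) :=
  {y | y q.1 = q.2 ∧ y e.1 = e.2.1 ∧ y e'.1 = e'.2.1 ∧ q.1 ≠ e.1 ∧ q.1 ≠ e'.1 ∧ e.1 ≠ e'.1 ∧
    Linked c e ∧ Linked c e'}

/-- Labelled binary trees of depth at most `l`, the witnesses for vertices outside the core. -/
def WTree (V : Type) (r k d : ℕ) : ℕ → Type
  -- There is nothing to witness at depth zero, where the core is the whole vertex set.
  | 0 => PEmpty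
  | l + 1 => V ⊕ (V × (Fin d × Slot r k × Slot r k) × (Fin d × Slot r k × Slot r k) ×
      WTree V r k d l × WTree V r k d l)

noncomputable instance WTree.fintype (V : Type) [Fintype V] (r k d : ℕ) [NeZero k] :
    ∀ l, Fintype (WTree V r k d l)
  | 0 => inferInstanceAs (Fintype PEmpty)
  | l + 1 => by
    have := WTree.fintype V r k d l
    exact inferInstanceAs (Fintype (V ⊕ (V × (Fin d × Slot r k × Slot r k) ×
      (Fin d × Slot r k × Slot r k) × WTree V r k d l × WTree V r k d l)))

/-- The constraints expressed by a tree whose root is entered at position `q`. -/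
def treeList (c : Fin d → Slot r k → Fin 2) :
    ∀ l, WTree V r k d l → Fin d × Slot r k → List (Constraint V (Slot r k) d)
  | 0, T, _ => PEmpty.elim T
  | _ + 1, Sum.inl x, q => [(x, lowSet c q)]
  | l + 1, Sum.inr (x, e, e', T, T'), q =>
      (x, forkSet c q e e') :: treeList c l T (e.1, e.2.2) ++ treeList c l T' (e'.1, e'.2.2)

lemma length_treeList (c : Fin d → Slot r k → Fin 2) :
    ∀ (l : ℕ) (T : WTree V r k d l) (q : Fin d × Slot r k),
      (treeList c l T q).length + 1 ≤ 2 ^ (l + 1)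
  | 0, T, _ => PEmpty.elim T
  | l + 1, Sum.inl x, q => by
    have : 1 ≤ 2 ^ l := Nat.one_le_two_pow
    simp only [treeList, List.length_singleton, pow_succ]
    omega
  | l + 1, Sum.inr (x, e, e', T, T'), q => by
    have h1 := length_treeList c l T (e.1, e.2.2)
    have h2 := length_treeList c l T' (e'.1, e'.2.2)
    simp only [treeList, List.length_append, List.length_cons, pow_succ] at h1 h2 ⊢
    omega

/-- The vertices of a constraint list are reached from `x` by reduced walks of length at most `l`
that do not start with the label `i`. -/
def Reaches (β : Fin d → V ≃ Slot r k) (l : ℕ) (i : Fin d) (x : V)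
    (L : List (Constraint V (Slot r k) d)) : Prop :=
  ∀ y ∈ L.map Prod.fst, y = x ∨ ∃ m j f, m ≤ l ∧ j ≠ i ∧ RWalk β m j x f y

variable {β : Fin d → V ≃ Slot r k} {χ : V → Fin 2} {c : Fin d → Slot r k → Fin 2}

lemma Reaches.walk {l : ℕ} {i : Fin d} {x u y : V} {L : List (Constraint V (Slot r k) d)}
    (h : Reaches β l i u L) (hs : Step β i x u) (hy : y ∈ L.map Prod.fst) :
    ∃ m f, m ≤ l + 1 ∧ RWalk β m i x f y := by
  rcases h y hy with rfl | ⟨m, j, f, hm, hj, hw⟩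
  · exact ⟨1, i, by omega, .single hs⟩
  · exact ⟨m + 1, f, by omega, .cons hs hj.symm hw⟩

/-- Two branches that leave a clean vertex through different labels are disjoint. -/
lemma nodup_fork {l M : ℕ} {i j : Fin d} {x u w : V} (hM : 2 * l + 2 ≤ M)
    (hclean : Clean β M (l + 1) x) (hij : i ≠ j) (hu : Step β i x u) (hw : Step β j x w)
    {L L' : List (Constraint V (Slot r k) d)} (hL : Reaches β l i u L) (hL' : Reaches β l j w L')
    (hnd : (L.map Prod.fst).Nodup) (hnd' : (L'.map Prod.fst).Nodup) (p : Set (Fin d → Slot r k)) :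
    ((((x, p) :: L) ++ L').map Prod.fst).Nodup := by
  rw [List.map_append, List.map_cons, List.cons_append, List.nodup_cons, List.nodup_append]
  refine ⟨?_, hnd, hnd', ?_⟩
  · intro hx
    rcases List.mem_append.1 hx with hx | hx
    · obtain ⟨m, f, hm, hr⟩ := hL.walk hu hx
      exact hclean.noCycle _ _ _ (by omega) hr
    · obtain ⟨m, f, hm, hr⟩ := hL'.walk hw hx
      exact hclean.noCycle _ _ _ (by omega) hr
  · rintro y hy _ hy' rfl
    obtain ⟨m, f, hm, hr⟩ := hL.walk hu hy
    obtain ⟨m', f', hm', hr'⟩ := hL'.walk hw hy'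
    exact hclean y (hr.near.mono hm) _ _ _ (by omega) (hr.reverse.append hij hr')

lemma reaches_fork {l : ℕ} {i j i₀ : Fin d} {x u w : V} (hi : i ≠ i₀) (hj : j ≠ i₀)
    (hu : Step β i x u) (hw : Step β j x w)
    {L L' : List (Constraint V (Slot r k) d)} (hL : Reaches β l i u L) (hL' : Reaches β l j w L')
    (p : Set (Fin d → Slot r k)) : Reaches β (l + 1) i₀ x (((x, p) :: L) ++ L') := by
  intro y hy
  rw [List.map_append, List.map_cons, List.mem_append, List.mem_cons] at hy
  rcases hy with (rfl | hy) | hy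
  · exact Or.inl rfl
  · obtain ⟨m, f, hm, hr⟩ := hL.walk hu hy
    exact Or.inr ⟨m, i, f, hm, hi, hr⟩
  · obtain ⟨m, f, hm, hr⟩ := hL'.walk hw hy
    exact Or.inr ⟨m, j, f, hm, hj, hr⟩

lemma Step.linked {i : Fin d} {x u : V} (h : Step β i x u)
    (hs : IsSupportSlot (c i) (β i x) ∨ IsSupportSlot (c i) (β i u)) :
    Linked c (i, β i x, β i u) :=
  ⟨h.2, fun e => h.1 ((β i).injective e), hs⟩

lemma Step.not_isSupportSlot [NeZero k] (hk : 3 ≤ k) {i : Fin d} {x u : V} (h : Step β i x u)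
    (hs : IsSupportSlot (c i) (β i x)) : ¬ IsSupportSlot (c i) (β i u) :=
  hs.not_of_ne hk h.2.symm fun e => h.1 ((β i).injective e).symm

variable [Fintype V] [NeZero k]

/-- A clean vertex outside the core is the root of a witness tree. The label `i₀` through which it
is entered must not be one of the reasons for it to be outside the core. -/
lemma exists_tree (hβ : β ∈ placements χ c) (hk : 3 ≤ k) {M : ℕ} :
    ∀ (l : ℕ) (x : V) (i₀ : Fin d), 2 * l ≤ M → Clean β M l x →
      x ∉ core (blockHypergraph β) χ l →
      (IsSupportSlot (c i₀) (β i₀ x) → ∀ u, Step β i₀ x u →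
        u ∈ core (blockHypergraph β) χ (l - 1)) →
      ∃ T : WTree V r k d l, Sat β (treeList c l T (i₀, β i₀ x)) ∧
        ((treeList c l T (i₀, β i₀ x)).map Prod.fst).Nodup ∧
        Reaches β l i₀ x (treeList c l T (i₀, β i₀ x)) := by
  classical
  intro l
  induction l with
  | zero => exact fun x _ _ _ hx => absurd trivial hx
  | succ l ih =>
    intro x i₀ hM hclean hx hinc
    -- At most three supported rows give a leaf; otherwise two supported rows leave the core one
    -- level down and the tree forks.
    by_cases hI : #{i | IsSupportSlot (c i) (β i x)} ≤ 3
    · refine ⟨Sum.inl x, ?_, by simp [treeList], ?_⟩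
      · simp only [treeList, sat_cons]
        refine ⟨⟨rfl, (Finset.card_le_card fun j hj => ?_).trans hI⟩, by simp [Sat]⟩
        simp only [Finset.mem_filter, Finset.mem_univ, true_and] at hj ⊢
        exact hj.2
      · intro y hy
        simp only [treeList, List.map_cons, List.map_nil, List.mem_singleton] at hy
        exact Or.inl hy
    · obtain ⟨i, j, hij, ⟨u, hiu, hu, hu'⟩, ⟨w, hjw, hw, hw'⟩⟩ :=
        exists_two_bad_blocks hβ hk (by omega) hclean.noCycle hx (by omega)
      -- The hypothesis on the entrance label excludes it from the bad rows, so a fork pins its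
      -- vertex in three different arrays.
      have hi : i₀ ≠ i := by
        rintro rfl
        exact hu' (hinc hiu u hu)
      have hj : i₀ ≠ j := by
        rintro rfl
        exact hw' (hinc hjw w hw)
      rw [add_comm] at hclean
      -- The child lies in a row supported by `x` and so cannot support that row itself; the
      -- condition on its entrance label is vacuous.
      obtain ⟨T, hT1, hT2, hT3⟩ := ih u i (by omega) (hclean.of_near hu.near) hu'
        fun h => absurd h (hu.not_isSupportSlot hk hiu)
      obtain ⟨T', hT1', hT2', hT3'⟩ := ih w j (by omega) (hclean.of_near hw.near) hw'
        fun h => absurd h (hw.not_isSupportSlot hk hjw)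
      rw [add_comm] at hclean
      refine ⟨Sum.inr (x, (i, β i x, β i u), (j, β j x, β j w), T, T'), ?_, ?_, ?_⟩
      · simp only [treeList, List.cons_append, sat_cons, sat_append]
        exact ⟨⟨rfl, rfl, rfl, hi, hj, hij, hu.linked (Or.inl hiu), hw.linked (Or.inl hjw)⟩,
          hT1, hT1'⟩
      · exact nodup_fork (by omega) hclean hij hu hw hT3 hT3' hT2 hT2' _
      · exact reaches_fork hi.symm hj.symm hu hw hT3 hT3' _

end Trees

/-! ### Witnesses for uncovered vertices -/

section Uncovered

variable {V : Type} {r k d : ℕ}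

/-- The witnesses for a vertex that is neither in the core nor properly attached: it supports no
edge; or two branches to trees leave it; or it supports few edges and is linked to a tree,
directly or through another vertex. -/
abbrev Witness (V : Type) (r k d l : ℕ) : Type :=
  V ⊕ (V × (Fin d × Slot r k × Slot r k) × (Fin d × Slot r k × Slot r k) ×
      WTree V r k d l × WTree V r k d l) ⊕
    (V × (Fin d × Slot r k × Slot r k) × WTree V r k d l) ⊕
    (V × (Fin d × Slot r k × Slot r k) × V × (Fin d × Slot r k × Slot r k) × WTree V r k d l)

/-- No support slot at all. -/
def isolatedSet (c : Fin d → Slot r k → Fin 2) : Set (Fin d → Slot r k) :=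
  {y | ∀ j, ¬ IsSupportSlot (c j) (y j)}

/-- Two links starting in different arrays. -/
def rootSet (c : Fin d → Slot r k → Fin 2) (e e' : Fin d × Slot r k × Slot r k) :
    Set (Fin d → Slot r k) :=
  {y | y e.1 = e.2.1 ∧ y e'.1 = e'.2.1 ∧ e.1 ≠ e'.1 ∧ Linked c e ∧ Linked c e'}

/-- Few support slots and the beginning of a link. -/
def lowLinkSet (c : Fin d → Slot r k → Fin 2) (e : Fin d × Slot r k × Slot r k) :
    Set (Fin d → Slot r k) :=
  {y | y ∈ lowSet c (e.1, e.2.1) ∧ Linked c e}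

/-- The end of the link `e` and the beginning of the link `e'`. -/
def passSet (c : Fin d → Slot r k → Fin 2) (e e' : Fin d × Slot r k × Slot r k) :
    Set (Fin d → Slot r k) :=
  {y | y e.1 = e.2.2 ∧ y e'.1 = e'.2.1 ∧ e.1 ≠ e'.1 ∧ Linked c e'}

/-- The constraints expressed by a witness. -/
def witnessList (c : Fin d → Slot r k → Fin 2) (l : ℕ) :
    Witness V r k d l → List (Constraint V (Slot r k) d)
  | Sum.inl x => [(x, isolatedSet c)]
  | Sum.inr (Sum.inl (x, e, e', T, T')) =>
      (x, rootSet c e e') :: treeList c l T (e.1, e.2.2) ++ treeList c l T' (e'.1, e'.2.2)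
  | Sum.inr (Sum.inr (Sum.inl (x, e, T))) =>
      (x, lowLinkSet c e) :: treeList c l T (e.1, e.2.2)
  | Sum.inr (Sum.inr (Sum.inr (x, e, z, e', T))) =>
      (x, lowLinkSet c e) :: (z, passSet c e e') :: treeList c l T (e'.1, e'.2.2)

lemma length_witnessList (c : Fin d → Slot r k → Fin 2) (l : ℕ) (T : Witness V r k d l) :
    (witnessList c l T).length ≤ 2 ^ (l + 2) := by
  have h2 : 2 ^ (l + 2) = 2 ^ (l + 1) + 2 ^ (l + 1) := by ring
  have h3 : 2 ≤ 2 ^ (l + 1) := by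
    have : 1 ≤ 2 ^ l := Nat.one_le_two_pow
    rw [pow_succ]; omega
  rcases T with x | ⟨x, e, e', T, T'⟩ | ⟨x, e, T⟩ | ⟨x, e, z, e', T⟩
  · simp only [witnessList, List.length_singleton]; omega
  · have h1 := length_treeList c l T (e.1, e.2.2)
    have h1' := length_treeList c l T' (e'.1, e'.2.2)
    simp only [witnessList, List.length_append, List.length_cons]; omega
  · have h1 := length_treeList c l T (e.1, e.2.2)
    simp only [witnessList, List.length_cons]; omega
  · have h1 := length_treeList c l T (e'.1, e'.2.2)
    simp only [witnessList, List.length_cons]; omega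

variable [Fintype V] [NeZero k] {β : Fin d → V ≃ Slot r k} {χ : V → Fin 2}
  {c : Fin d → Slot r k → Fin 2}

/-- The part of the vertex set whose density is to be estimated. -/
def covered (H : Hypergraph V) (χ : V → Fin 2) (l : ℕ) : Set V :=
  core H χ l ∪ (attached H χ l \ overlapping H χ l)

/-- This produces witnesses of the third kind. The link may be supported at either end. If `u`
supports it, `hinc` says that the shared row is not a reason for `u` to fail, so the tree at `u`
continues through other labels. -/
lemma exists_witness_of_link (hβ : β ∈ placements χ c) (hk : 3 ≤ k) {l M : ℕ}
    (hM : 2 * l + 4 ≤ M) {x u : V} (hclean : Clean β M (l + 2) x) {i : Fin d}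
    (hlow : (fun j => β j x) ∈ lowSet c (i, β i x)) (hu : Step β i x u)
    (hlink : IsSupportSlot (c i) (β i x) ∨ IsSupportSlot (c i) (β i u))
    (hcore : u ∉ core (blockHypergraph β) χ l)
    (hinc : IsSupportSlot (c i) (β i u) → ∀ z, Step β i u z →
        z ∈ core (blockHypergraph β) χ (l - 1)) :
    ∃ T : Witness V r k d l, Sat β (witnessList c l T) ∧
      ((witnessList c l T).map Prod.fst).Nodup ∧
      ((witnessList c l T).map Prod.fst).head? = some x ∧
      ∀ y ∈ (witnessList c l T).map Prod.fst, Near β (l + 2) y x := by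
  have hclean1 : Clean β M (l + 1) u :=
    Clean.of_near (R := 1) (by rwa [show 1 + (l + 1) = l + 2 by ring]) hu.near
  obtain ⟨T, hT1, hT2, hT3⟩ := exists_tree hβ hk (M := M) l u i (by omega)
    (fun y hy => hclean1 y (hy.mono (by omega))) hcore hinc
  refine ⟨Sum.inr (Sum.inr (Sum.inl (x, (i, β i x, β i u), T))), ?_, ?_, rfl, ?_⟩
  · simp only [witnessList, sat_cons]
    exact ⟨⟨hlow, hu.linked hlink⟩, hT1⟩
  · simp only [witnessList, List.map_cons, List.nodup_cons]
    refine ⟨fun hx => ?_, hT2⟩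
    obtain ⟨m, f, hm, hr⟩ := hT3.walk hu hx
    exact hclean.noCycle _ _ _ (by omega) hr
  · intro y hy
    simp only [witnessList, List.map_cons, List.mem_cons] at hy
    rcases hy with rfl | hy
    · exact Near.refl _ _
    · obtain ⟨m, f, hm, hr⟩ := hT3.walk hu hy
      exact (hr.near.mono (by omega)).symm

/-- Every clean vertex that is not covered is the root of a witness. -/
lemma exists_witness (hβ : β ∈ placements χ c) (hk : 3 ≤ k) {l M : ℕ} (hM : 2 * l + 4 ≤ M)
    {x : V} (hclean : Clean β M (l + 2) x) (hx : x ∉ covered (blockHypergraph β) χ l) :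
    ∃ T : Witness V r k d l, Sat β (witnessList c l T) ∧
      ((witnessList c l T).map Prod.fst).Nodup ∧
      ((witnessList c l T).map Prod.fst).head? = some x ∧
      ∀ y ∈ (witnessList c l T).map Prod.fst, Near β (l + 2) y x := by
  classical
  have hcore : x ∉ core (blockHypergraph β) χ l := fun h => hx (Or.inl h)
  obtain ⟨l, rfl⟩ : ∃ l', l = l' + 1 := by
    cases l with
    | zero => exact absurd trivial hcore
    | succ l => exact ⟨l, rfl⟩
  have hsub := core_succ_subset (blockHypergraph β) χ l
  have hnear : ∀ {u i}, Step β i x u → Clean β M (l + 2) u := fun {u i} hu =>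
    Clean.of_near (R := 1) (by rwa [show 1 + (l + 2) = l + 1 + 2 by ring]) hu.near
  by_cases hI4 : 4 ≤ #{i | IsSupportSlot (c i) (β i x)}
  · obtain ⟨i, j, hij, ⟨u, hiu, hu, hu'⟩, ⟨w, hjw, hw, hw'⟩⟩ :=
      exists_two_bad_blocks hβ hk (by omega) hclean.noCycle hcore hI4
    -- The failure of `u` occurs at depth `l`. As cores decrease it persists at depth `l + 1`, so
    -- all witnesses can use trees of the same depth.
    obtain ⟨T, hT1, hT2, hT3⟩ := exists_tree hβ hk (M := M) (l + 1) u i (by omega)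
      (fun y hy => hnear hu y (hy.mono (by omega))) (fun h => hu' (hsub h))
      fun h => absurd h (hu.not_isSupportSlot hk hiu)
    obtain ⟨T', hT1', hT2', hT3'⟩ := exists_tree hβ hk (M := M) (l + 1) w j (by omega)
      (fun y hy => hnear hw y (hy.mono (by omega))) (fun h => hw' (hsub h))
      fun h => absurd h (hw.not_isSupportSlot hk hjw)
    refine ⟨Sum.inr (Sum.inl (x, (i, β i x, β i u), (j, β j x, β j w), T, T')), ?_, ?_, rfl, ?_⟩
    · simp only [witnessList, List.cons_append, sat_cons, sat_append]
      exact ⟨⟨rfl, rfl, hij, hu.linked (Or.inl hiu), hw.linked (Or.inl hjw)⟩, hT1, hT1'⟩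
    · exact nodup_fork (l := l + 1) (by omega) (fun y hy => hclean y (hy.mono (by omega)))
        hij hu hw hT3 hT3' hT2 hT2' _
    · intro y hy
      simp only [witnessList, List.map_append, List.map_cons, List.mem_append,
        List.mem_cons] at hy
      rcases hy with (rfl | hy) | hy
      · exact Near.refl _ _
      · obtain ⟨m, f, hm, hr⟩ := hT3.walk hu hy
        exact (hr.near.mono (by omega)).symm
      · obtain ⟨m, f, hm, hr⟩ := hT3'.walk hw hy
        exact (hr.near.mono (by omega)).symm
  have hlow : ∀ i, (fun j => β j x) ∈ lowSet c (i, β i x) := by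
    refine fun i => ⟨rfl, (Finset.card_le_card (t := {i | IsSupportSlot (c i) (β i x)})
      fun j hj => ?_).trans (by omega)⟩
    simp only [Finset.mem_filter, Finset.mem_univ, true_and] at hj ⊢
    exact hj.2
  by_cases hI0 : ∀ i, ¬ IsSupportSlot (c i) (β i x)
  · refine ⟨Sum.inl x, ?_, by simp [witnessList], rfl, ?_⟩
    · simp only [witnessList, sat_cons]
      exact ⟨hI0, by simp [Sat]⟩
    · intro y hy
      simp only [witnessList, List.map_cons, List.map_nil, List.mem_singleton] at hy
      subst hy
      exact Near.refl _ _
  push Not at hI0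
  obtain ⟨i, hi⟩ := hI0
  -- An attached vertex is uncovered only because it overlaps with another attached vertex `w`,
  -- which is outside the core and hence the root of a tree. The two edges meet at `w`, at `x`, or
  -- at a third vertex `z`, which then becomes the intermediate vertex of a witness of the fourth
  -- kind.
  by_cases hatt : x ∈ attached (blockHypergraph β) χ (l + 1)
  · have hover : x ∈ overlapping (blockHypergraph β) χ (l + 1) := by
      by_contra h
      exact hx (Or.inr ⟨hatt, h⟩)
    obtain ⟨-, w, hw, hwx, e, f, he, hf, hec, hfc, z, hze, hzf⟩ := hover
    obtain ⟨i, rfl, hi⟩ := (supports_iff hβ).1 he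
    obtain ⟨j, rfl, hj⟩ := (supports_iff hβ).1 hf
    have hwc := hw.2.1
    have hwgood : ∀ u, Step β j w u → u ∈ core (blockHypergraph β) χ l :=
      fun u hu => hfc (mem_block_diff.2 hu)
    by_cases hzw : z = w
    · subst hzw
      have hs : Step β i x z := mem_block_diff.1 ⟨hze, hwx⟩
      exact exists_witness_of_link hβ hk hM hclean (hlow i) hs (Or.inl hi) hwc
        fun h => absurd h (hs.not_isSupportSlot hk hi)
    by_cases hzx : z = x
    · subst hzx
      have hs : Step β j w z := mem_block_diff.1 ⟨hzf, hwx.symm⟩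
      exact exists_witness_of_link hβ hk hM hclean (hlow j) hs.symm (Or.inr hj) hwc
        fun _ => hwgood
    have hs : Step β i x z := mem_block_diff.1 ⟨hze, hzx⟩
    have hs' : Step β j w z := mem_block_diff.1 ⟨hzf, hzw⟩
    -- Otherwise `x` and `w` would both have a unique color in the same row.
    have hij : i ≠ j := by
      rintro rfl
      have hxw : Step β i x w := ⟨hwx.symm, hs.2.trans hs'.2.symm⟩
      exact hxw.not_isSupportSlot hk hi hj
    have hclw : Clean β M (l + 1) w := by
      have h1 : Clean β M (1 + (l + 1)) z := by
        rw [show 1 + (l + 1) = l + 2 by ring]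
        exact hnear hs
      exact h1.of_near hs'.symm.near
    obtain ⟨T, hT1, hT2, hT3⟩ := exists_tree hβ hk (M := M) (l + 1) w j (by omega) hclw hwc
      fun _ => hwgood
    have hreach : ∀ y ∈ (treeList c (l + 1) T (j, β j w)).map Prod.fst,
        ∃ m f, m ≤ l + 3 ∧ RWalk β m i x f y := by
      intro y hy
      obtain ⟨m, f, hm, hr⟩ := hT3.walk hs'.symm hy
      exact ⟨m + 1, f, by omega, .cons hs hij hr⟩
    refine ⟨Sum.inr (Sum.inr (Sum.inr (x, (i, β i x, β i z), z, (j, β j z, β j w), T))),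
      ?_, ?_, rfl, ?_⟩
    · simp only [witnessList, sat_cons]
      exact ⟨⟨hlow i, hs.linked (Or.inl hi)⟩, ⟨rfl, rfl, hij, hs'.symm.linked (Or.inr hj)⟩, hT1⟩
    · simp only [witnessList, List.map_cons, List.nodup_cons, List.mem_cons, not_or]
      refine ⟨⟨hs.1, fun h => ?_⟩, fun h => ?_, hT2⟩
      · obtain ⟨m, f, hm, hr⟩ := hreach x h
        exact hclean.noCycle _ _ _ (by omega) hr
      · obtain ⟨m, f, hm, hr⟩ := hT3.walk hs'.symm h
        exact (hnear hs).noCycle _ _ _ (by omega) hr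
    · intro y hy
      simp only [witnessList, List.map_cons, List.mem_cons] at hy
      rcases hy with rfl | rfl | hy
      · exact Near.refl _ _
      · exact (hs.near.mono (by omega)).symm
      · obtain ⟨m, f, hm, hr⟩ := hreach y hy
        exact (hr.near.mono (by omega)).symm
  · have hbad : ∃ u, Step β i x u ∧ u ∉ core (blockHypergraph β) χ l := by
      by_contra! hcon
      exact hatt ⟨trivial, hcore, block β i x, (supports_iff hβ).2 ⟨i, rfl, hi⟩,
        fun u hu => hcon u (mem_block_diff.1 hu)⟩
    obtain ⟨u, hu, hu'⟩ := hbad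
    exact exists_witness_of_link hβ hk hM hclean (hlow i) hu (Or.inl hi) (fun h => hu' (hsub h))
      fun h => absurd h (hu.not_isSupportSlot hk hi)

end Uncovered

/-! ### The cost of prescribing positions -/

section Pinned

variable {V S : Type*} [Fintype V] [Fintype S] {d : ℕ} {χ : V → Fin 2} {c : Fin d → S → Fin 2}

open Classical in
lemma numChoices_mul_pow_le {h : ℕ} (hc : ∀ i a, #{s | c i s = a} ≤ h) (J : Finset (Fin d))
    (q : Fin d → S) {F : Set (Fin d → S)} (hF : ∀ y ∈ F, ∀ j ∈ J, y j = q j) (x : V) :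
    numChoices χ c (x, F) * h ^ #J ≤ h ^ d := by
  have h1 : numChoices χ c (x, F) ≤
      ∏ j, #(if j ∈ J then {q j} else Finset.univ.filter fun s => c j s = χ x) := by
    rw [← Fintype.card_piFinset]
    apply Finset.card_le_card
    intro y hy
    simp only [Finset.mem_filter, Finset.mem_univ, true_and] at hy
    rw [Fintype.mem_piFinset]
    intro j
    split_ifs with hj
    · simpa using hF y hy.2 j hj
    · simpa using hy.1 j
  have h2 : h ^ #J = ∏ j : Fin d, if j ∈ J then h else 1 := by
    rw [Finset.prod_ite_mem, Finset.univ_inter, Finset.prod_const]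
  calc _ ≤ (∏ j, #(if j ∈ J then {q j} else Finset.univ.filter fun s => c j s = χ x)) *
        ∏ j : Fin d, if j ∈ J then h else 1 := by rw [h2]; gcongr
    _ ≤ ∏ _j : Fin d, h := by
        rw [← Finset.prod_mul_distrib]
        apply Finset.prod_le_prod' fun j _ => ?_
        split_ifs with hj
        · simp
        · simpa using hc j (χ x)
    _ = h ^ d := by simp

lemma numChoices_eq_zero {x : V} {F : Set (Fin d → S)}
    (hF : ∀ y ∈ F, ∃ i, c i (y i) ≠ χ x) : numChoices χ c (x, F) = 0 := by
  classical
  rw [numChoices, Finset.card_eq_zero, Finset.filter_eq_empty_iff]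
  rintro y - ⟨h1, h2⟩
  obtain ⟨i, hi⟩ := hF y h2
  exact hi (h1 i)

/-- Pinning the positions in the arrays `J` divides the number of choices by `h ^ #J`. -/
lemma numChoices_div_le {h : ℕ} {D θ : ℝ} (hh : 0 < h) (hD : 0 < D) (hθ : (h : ℝ) ^ d ≤ θ * D)
    (hc : ∀ i a, Fintype.card {s // c i s = a} ≤ h) (J : Finset (Fin d))
    (q : Fin d → S) {F : Set (Fin d → S)} (hF : ∀ y ∈ F, ∀ j ∈ J, y j = q j) (x : V) :
    (numChoices χ c (x, F) : ℝ) / D ≤ θ / (h : ℝ) ^ #J := by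
  classical
  have h1 := numChoices_mul_pow_le (χ := χ)
    (fun i a => by simpa [Fintype.card_subtype] using hc i a) J q hF x
  rw [div_le_div_iff₀ hD (by positivity)]
  refine le_trans ?_ hθ
  exact_mod_cast h1

end Pinned

/-! ### First moment bound -/

section Markov

variable {V S : Type*} [Fintype V] [Fintype S] {d : ℕ} {χ : V → Fin 2} {c : Fin d → S → Fin 2}
  {ι : Type*} [Fintype ι]

open Classical in
/-- Markov's inequality for the number of roots of satisfied constraint lists. -/
lemma card_many_roots_mul_le {h m N : ℕ} (hc : ∀ i a, h ≤ #{s | c i s = a}) (hm : m < h)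
    (lst : ι → List (Constraint V S d)) (hM : ∀ T, (lst T).length ≤ m) {W : ℝ}
    (hW : ∑ T, listWeight χ c (((h - m : ℕ) : ℝ) ^ d) (lst T) ≤ W)
    (bad : (Fin d → V ≃ S) → Finset V)
    (hbad : ∀ β, ∀ v ∈ bad β, ∃ T, Sat β (lst T) ∧
      ((lst T).map Prod.fst).Nodup ∧ ((lst T).map Prod.fst).head? = some v) :
    (#{β ∈ placements χ c | N ≤ #(bad β)} : ℝ) * N ≤ #(placements χ c) * W := by
  have hmarkov : #{β ∈ placements χ c | N ≤ #(bad β)} * N ≤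
      ∑ β ∈ placements χ c, #(bad β) := by
    calc _ = ∑ β ∈ placements χ c with N ≤ #(bad β), N := by simp
      _ ≤ ∑ β ∈ placements χ c with N ≤ #(bad β), #(bad β) :=
          Finset.sum_le_sum fun β hβ => (Finset.mem_filter.1 hβ).2
      _ ≤ _ := Finset.sum_le_sum_of_subset (Finset.filter_subset _ _)
  have hcount : ∀ β, #(bad β) ≤ ∑ T : ι, if Sat β (lst T) ∧ ((lst T).map Prod.fst).Nodup
      then 1 else 0 := by
    intro β
    rw [← Finset.card_filter]
    -- Different roots are heads of different satisfied lists.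
    have hsub : (bad β).map ⟨some, Option.some_injective V⟩ ⊆
        ({T | Sat β (lst T) ∧ ((lst T).map Prod.fst).Nodup} : Finset ι).image
          fun T => ((lst T).map Prod.fst).head? := by
      intro o ho
      obtain ⟨v, hv, rfl⟩ := Finset.mem_map.1 ho
      obtain ⟨T, h1, h2, h3⟩ := hbad β v hv
      exact Finset.mem_image.2 ⟨T, by simp [h1, h2], h3⟩
    have := Finset.card_le_card hsub
    rw [Finset.card_map] at this
    exact this.trans Finset.card_image_le
  calc _ ≤ ((∑ β ∈ placements χ c, #(bad β) : ℕ) : ℝ) := by exact_mod_cast hmarkov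
    _ ≤ ((∑ β ∈ placements χ c, ∑ T : ι,
          (if Sat β (lst T) ∧ ((lst T).map Prod.fst).Nodup then 1 else 0) : ℕ) : ℝ) := by
        exact_mod_cast Finset.sum_le_sum fun β _ => hcount β
    _ = ∑ T : ι, ∑ β ∈ placements χ c,
          (if Sat β (lst T) ∧ ((lst T).map Prod.fst).Nodup then (1 : ℝ) else 0) := by
        rw [Finset.sum_comm]
        push_cast
        rfl
    _ ≤ ∑ T : ι, #(placements χ c) * listWeight χ c (((h - m : ℕ) : ℝ) ^ d) (lst T) := by
        refine Finset.sum_le_sum fun T _ => ?_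
        by_cases hnd : ((lst T).map Prod.fst).Nodup
        · refine le_trans (le_of_eq ?_) (card_sat_le hc hm (lst T) (hM T) hnd)
          simp [hnd]
        · simp only [hnd, and_false, if_false, Finset.sum_const_zero]
          have := listWeight_nonneg (χ := χ) (c := c)
            (D := ((h - m : ℕ) : ℝ) ^ d) (by positivity) (lst T)
          positivity
    _ ≤ _ := by rw [← Finset.mul_sum]; gcongr

end Markov

/-! ### Short cycles -/

section Loops

variable {V : Type*} {r k d : ℕ}

/-- A closed walk through distinct vertices; labels of cyclically consecutive steps differ. -/
def IsLoop (β : Fin d → V ≃ Slot r k) {m : ℕ} (x : Fin (m + 1) → V) (i : Fin (m + 1) → Fin d) :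
    Prop :=
  x.Injective ∧ ∀ t, Step β (i t) (x t) (x (t + 1)) ∧ i t ≠ i (t + 1)

variable {β : Fin d → V ≃ Slot r k}

lemma RWalk.exists_fun {m : ℕ} {i f : Fin d} {x y : V} (h : RWalk β m i x f y) :
    ∃ (p : ℕ → V) (lab : ℕ → Fin d), p 0 = x ∧ p m = y ∧ lab 0 = i ∧ 0 < m ∧
      (∀ t < m, Step β (lab t) (p t) (p (t + 1))) ∧ ∀ t, t + 1 < m → lab t ≠ lab (t + 1) := by
  induction h with
  | @single i x y hs =>
    refine ⟨fun t => if t = 0 then x else y, fun _ => i, by simp, by simp, rfl, by simp, ?_, ?_⟩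
    · intro t ht
      obtain rfl : t = 0 := by omega
      simpa using hs
    · intro t ht
      omega
  | @cons i j f x y z m hs hne _ ih =>
    obtain ⟨p, lab, h0, hm, hl, hpos, hstep, hlab⟩ := ih
    refine ⟨fun t => Nat.casesOn t x p, fun t => Nat.casesOn t i lab, rfl, hm, rfl, by omega,
      ?_, ?_⟩
    · rintro (_ | t) ht
      · simpa [h0] using hs
      · exact hstep t (by omega)
    · rintro (_ | t) ht
      · simpa [hl] using hne
      · exact hlab t (by omega)

lemma near_of_steps {p : ℕ → V} {lab : ℕ → Fin d} :
    ∀ {t : ℕ}, (∀ s < t, Step β (lab s) (p s) (p (s + 1))) → Near β t (p 0) (p t)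
  | 0, _ => rfl
  | t + 1, h => (near_of_steps fun s hs => h s (by omega)).trans (h t (by omega)).near

/-- Strong induction on the length. A repeated vertex cuts out a shorter closed walk. Without
repetitions the only defect can be that the last and the first label agree; then the last and the
first step lie in one row, and merging them bypasses `p 0` and shortens the walk by one. The
distance from `p 0` to the loop is paid for by the steps removed. -/
lemma exists_loop_of_fun (m : ℕ) : ∀ (p : ℕ → V) (lab : ℕ → Fin d), p 0 = p m → 0 < m →
    (∀ t < m, Step β (lab t) (p t) (p (t + 1))) → (∀ t, t + 1 < m → lab t ≠ lab (t + 1)) →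
    ∃ m' < m, ∃ (x : Fin (m' + 1) → V) (i : Fin (m' + 1) → Fin d),
      IsLoop β x i ∧ Near β m (p 0) (x 0) := by
  induction m using Nat.strong_induction_on with
  | _ m ih =>
  intro p lab hp hm hstep hlab
  by_cases hrep : ∃ a b, a < b ∧ b ≤ m ∧ b - a < m ∧ p a = p b
  · obtain ⟨a, b, hab, hbm, hlt, hpab⟩ := hrep
    obtain ⟨m', hm', x, i, hx, hn⟩ := ih (b - a) hlt (fun t => p (a + t)) (fun t => lab (a + t))
      (by simp only [add_zero]; rw [hpab]; congr 1; omega) (by omega)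
      (fun t ht => hstep (a + t) (by omega)) (fun t ht => hlab (a + t) (by omega))
    refine ⟨m', by omega, x, i, hx, ?_⟩
    have h1 : Near β a (p 0) (p a) := near_of_steps fun s hs => hstep s (by omega)
    exact (h1.trans hn).mono (by omega)
  push Not at hrep
  obtain ⟨m, rfl⟩ : ∃ m', m = m' + 1 := ⟨m - 1, by omega⟩
  have hm0 : m ≠ 0 := by
    rintro rfl
    exact (hstep 0 (by omega)).1 hp
  by_cases hwrap : lab m = lab 0
  · have hm1 : m ≠ 1 := by
      rintro rfl
      exact hlab 0 (by omega) hwrap.symm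
    obtain ⟨m', hm', x, i, hx, hn⟩ := ih m (by omega)
      (fun t => if t = m then p 1 else p (t + 1)) (fun t => lab (t + 1))
      (by simp [Ne.symm hm0]) (by omega)
      (by
        intro t ht
        simp only [ht.ne, if_false]
        by_cases htm : t + 1 = m
        · rw [if_pos htm, htm, hwrap]
          refine ⟨fun h => hrep 1 m (by omega) (by omega) (by omega) h.symm, ?_⟩
          have h1 := hstep 0 (by omega)
          have h2 := hstep m (by omega)
          rw [hwrap, ← hp] at h2
          exact h2.2.trans h1.2
        · rw [if_neg htm]
          exact hstep (t + 1) (by omega))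
      (fun t ht => hlab (t + 1) (by omega))
    simp only [Ne.symm hm0, if_false, zero_add] at hn
    refine ⟨m', by omega, x, i, hx, ?_⟩
    exact ((hstep 0 (by omega)).near.trans hn).mono (by omega)
  · refine ⟨m, by omega, fun t => p t, fun t => lab t, ⟨?_, ?_⟩, by simpa using Near.refl _ _⟩
    · intro a b hab
      by_contra hne
      have ha := a.2
      have hb := b.2
      rcases lt_or_gt_of_ne (fun h => hne (Fin.ext h) : (a : ℕ) ≠ b) with h | h
      · exact hrep a b h (by omega) (by omega) hab
      · exact hrep b a h (by omega) (by omega) hab.symm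
    · intro t
      have ht := t.2
      by_cases htm : (t : ℕ) = m
      · have e : t + 1 = 0 := by
          have : t = Fin.last m := Fin.ext htm
          rw [this, Fin.last_add_one]
        simp only [e, Fin.val_zero, htm]
        refine ⟨?_, hwrap⟩
        rw [hp]
        exact hstep m (by omega)
      · have e : ((t + 1 : Fin (m + 1)) : ℕ) = t + 1 := by
          apply Fin.val_add_one_of_lt
          rw [Fin.lt_def, Fin.val_last]
          omega
        dsimp only
        rw [e]
        exact ⟨hstep t ht, hlab t (by omega)⟩

open Classical in
/-- The starting points of loops of length at most `M`. -/
noncomputable def loopRoots [Fintype V] (M : ℕ) (β : Fin d → V ≃ Slot r k) : Finset V :=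
  {v | ∃ m < M, ∃ (x : Fin (m + 1) → V) (i : Fin (m + 1) → Fin d), x 0 = v ∧ IsLoop β x i}

open Classical in
-- A closed reduced walk yields a loop starting near its base point, so every vertex that is not
-- clean lies within `R + M` of a loop root.
lemma card_not_clean_le [Fintype V] [NeZero k] (M R : ℕ) (β : Fin d → V ≃ Slot r k) :
    #{v | ¬ Clean β M R v} ≤ #(loopRoots M β) * (d * k + 1) ^ (R + M) := by
  refine (Finset.card_le_card
    (t := (loopRoots M β).biUnion fun z => {v | Near β (R + M) z v}) ?_).trans
    (Finset.card_biUnion_le_card_mul _ _ _ fun z _ => card_near_le _ _)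
  intro v hv
  simp only [Finset.mem_filter, Finset.mem_univ, true_and, Clean, NoCycle, not_forall,
    not_not] at hv
  obtain ⟨y, hvy, m, i, f, hm, hw⟩ := hv
  obtain ⟨p, lab, h0, h1, -, hpos, hstep, hlab⟩ := hw.exists_fun
  obtain ⟨m', hm', x, j, hx, hn⟩ := exists_loop_of_fun m p lab (h0.trans h1.symm) hpos hstep hlab
  rw [h0] at hn
  simp only [Finset.mem_biUnion, Finset.mem_filter, Finset.mem_univ, true_and, loopRoots]
  exact ⟨x 0, ⟨m', by omega, x, j, rfl, hx⟩, ((hvy.trans hn).mono (by omega)).symm⟩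

/-- Labelled loops of length at most `M` with the positions of their vertices. -/
abbrev LoopData (V : Type*) (r k d M : ℕ) : Type _ :=
  Σ m : Fin M, ((Fin (m + 1) → V) × (Fin (m + 1) → Fin d)) ×
    ((Fin (m + 1) → Slot r k) × (Fin (m + 1) → ZMod k))

/-- The end of the previous step and the beginning of the next step of a loop. -/
def loopSet {m : ℕ} (i : Fin (m + 1) → Fin d) (s : Fin (m + 1) → Slot r k)
    (b : Fin (m + 1) → ZMod k) (t : Fin (m + 1)) : Set (Fin d → Slot r k) :=
  {y | y (i t) = s t ∧ y (i (t - 1)) = ((s (t - 1)).1, b (t - 1)) ∧ i (t - 1) ≠ i t}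

/-- The constraints expressed by a loop. -/
def loopList {M : ℕ} (T : LoopData V r k d M) : List (Constraint V (Slot r k) d) :=
  List.ofFn fun t => (T.2.1.1 t, loopSet T.2.1.2 T.2.2.1 T.2.2.2 t)

variable [Fintype V] [NeZero k] {χ : V → Fin 2} {c : Fin d → Slot r k → Fin 2}

lemma exists_loopList {M : ℕ} {v : V} (hv : v ∈ loopRoots M β) :
    ∃ T : LoopData V r k d M, Sat β (loopList T) ∧ ((loopList T).map Prod.fst).Nodup ∧
      ((loopList T).map Prod.fst).head? = some v := by
  classical
  simp only [loopRoots, Finset.mem_filter, Finset.mem_univ, true_and] at hv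
  obtain ⟨m, hm, x, i, rfl, hinj, hloop⟩ := hv
  refine ⟨⟨⟨m, hm⟩, (x, i), (fun t => β (i t) (x t), fun t => (β (i t) (x (t + 1))).2)⟩,
    ?_, ?_, ?_⟩
  · intro p hp
    simp only [loopList, List.mem_ofFn] at hp
    obtain ⟨t, rfl⟩ := hp
    have h1 := hloop (t - 1)
    rw [sub_add_cancel] at h1
    refine ⟨rfl, ?_, h1.2⟩
    change β (i (t - 1)) (x t)
      = ((β (i (t - 1)) (x (t - 1))).1, (β (i (t - 1)) (x (t - 1 + 1))).2)
    rw [sub_add_cancel]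
    exact Prod.ext h1.1.2.symm rfl
  · rw [loopList, List.map_ofFn, List.nodup_ofFn]
    exact hinj
  · simp [loopList, List.ofFn_succ]

/-- Each vertex of a loop has two pinned positions, of weight `θ / h ^ 2`, against `2h` choices of
the vertex, `d` of the label, `2h` of a slot and `k` of a column. The powers of `h` cancel, so the
expected number of short loops stays bounded as `n` grows. -/
lemma sum_loopList_le {h : ℕ} {D θ : ℝ} (hh : 0 < h) (hD : 0 < D) (hθ : (h : ℝ) ^ d ≤ θ * D)
    (hc : ∀ i a, Fintype.card {s // c i s = a} ≤ h) (hV : Fintype.card V = 2 * h)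
    (hr : r * k = 2 * h) (M : ℕ) :
    ∑ T : LoopData V r k d M, listWeight χ c D (loopList T)
      ≤ ∑ m : Fin M, (4 * d * k * θ) ^ (m + 1 : ℕ) := by
  have hθ0 : 0 ≤ θ := by
    by_contra! hneg
    have : (0 : ℝ) ≤ (h : ℝ) ^ d := by positivity
    nlinarith
  rw [Fintype.sum_sigma]
  refine Finset.sum_le_sum fun m _ => ?_
  have hb : ∀ T : ((Fin (m + 1) → V) × (Fin (m + 1) → Fin d)) ×
      ((Fin (m + 1) → Slot r k) × (Fin (m + 1) → ZMod k)),
      listWeight χ c D (loopList (⟨m, T⟩ : LoopData V r k d M))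
        ≤ (θ / (h : ℝ) ^ 2) ^ (m + 1 : ℕ) := by
    rintro ⟨⟨x, i⟩, s, b⟩
    simp only [listWeight, loopList, List.map_ofFn, List.prod_ofFn, Function.comp_apply]
    calc _ ≤ ∏ _t : Fin (m + 1), θ / (h : ℝ) ^ 2 := by
          refine Finset.prod_le_prod (fun t _ => by positivity) fun t _ => ?_
          by_cases hne : i (t - 1) = i t
          · have : numChoices χ c (x t, loopSet i s b t) = 0 :=
              numChoices_eq_zero fun y hy => absurd hne hy.2.2
            rw [this]
            simp only [Nat.cast_zero, zero_div]
            positivity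
          · have hJ : #({i t, i (t - 1)} : Finset (Fin d)) = 2 :=
              Finset.card_pair fun e => hne e.symm
            rw [← hJ]
            refine numChoices_div_le hh hD hθ hc _
              (fun j => if j = i t then s t else ((s (t - 1)).1, b (t - 1))) ?_ _
            intro y hy j hj
            rw [Finset.mem_insert, Finset.mem_singleton] at hj
            rcases hj with rfl | rfl
            · simpa using hy.1
            · rw [if_neg hne]
              exact hy.2.1
      _ = _ := by simp [div_pow]
  refine (Finset.sum_le_sum fun T _ => hb T).trans (le_of_eq ?_)
  rw [Finset.sum_const, nsmul_eq_mul, Finset.card_univ]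
  simp only [Fintype.card_prod, Fintype.card_fun, Fintype.card_fin, hV, ZMod.card, hr]
  push_cast
  rw [← mul_pow, ← mul_pow, ← mul_pow, ← mul_pow]
  congr 1
  have : (h : ℝ) ≠ 0 := by positivity
  field_simp
  ring

end Loops

/-! ### Counting positions with few or no support slots -/

section LowDegree

variable {V : Type} [Fintype V] {r k d : ℕ} [NeZero k] {χ : V → Fin 2}
  {c : Fin d → Slot r k → Fin 2}

open Classical in
-- The count factorizes over the arrays. Each has at most `(1 - ρ) h ≤ h e^(-ρ)` slots of the right
-- color that are not support slots.
lemma numChoices_isolatedSet_le {h : ℕ} {ρ : ℝ}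
    (hc : ∀ i a, Fintype.card {s // c i s = a} = h)
    (hsup : ∀ i a, ρ * h ≤ #{s | c i s = a ∧ IsSupportSlot (c i) s}) (x : V) :
    (numChoices χ c (x, isolatedSet c) : ℝ) ≤ (h : ℝ) ^ d * Real.exp (-(ρ * d)) := by
  have h1 : numChoices χ c (x, isolatedSet c) ≤
      ∏ j, #{s | c j s = χ x ∧ ¬ IsSupportSlot (c j) s} := by
    rw [← Fintype.card_piFinset]
    apply Finset.card_le_card
    intro y hy
    simp only [Finset.mem_filter, Finset.mem_univ, true_and] at hy
    rw [Fintype.mem_piFinset]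
    intro j
    simpa using ⟨hy.1 j, hy.2 j⟩
  have h2 : ∀ j, (#{s | c j s = χ x ∧ ¬ IsSupportSlot (c j) s} : ℝ) ≤ h * Real.exp (-ρ) := by
    intro j
    have e1 : #{s | c j s = χ x ∧ IsSupportSlot (c j) s} +
        #{s | c j s = χ x ∧ ¬ IsSupportSlot (c j) s} = h := by
      rw [← hc j (χ x), Fintype.card_subtype, ← Finset.filter_filter, ← Finset.filter_filter]
      exact Finset.card_filter_add_card_filter_not _
    have e2 : (#{s | c j s = χ x ∧ IsSupportSlot (c j) s} : ℝ) +
        #{s | c j s = χ x ∧ ¬ IsSupportSlot (c j) s} = h := by exact_mod_cast e1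
    have e3 := hsup j (χ x)
    have e4 := Real.add_one_le_exp (-ρ)
    have : (0 : ℝ) ≤ h := by positivity
    nlinarith
  calc (numChoices χ c (x, isolatedSet c) : ℝ)
      ≤ ∏ j, (#{s | c j s = χ x ∧ ¬ IsSupportSlot (c j) s} : ℝ) := by exact_mod_cast h1
    _ ≤ ∏ _j : Fin d, (h * Real.exp (-ρ)) :=
        Finset.prod_le_prod (fun _ _ => by positivity) fun j _ => h2 j
    _ = _ := by
        rw [Finset.prod_const, mul_pow, ← Real.exp_nat_mul]
        simp only [Finset.card_univ, Fintype.card_fin]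
        ring_nf

open Classical in
-- Exponential weighting: every support slot outside the pinned array gets weight `1 / k`. A tuple
-- with at most three of them has weight at least `k ^ (-3)`, while the total weight factorizes,
-- each free array contributing at most `h (1 - ρ (1 - 1/k)) ≤ B`.
lemma numChoices_lowSet_mul_le {h : ℕ} {ρ : ℝ} (hρ0 : 0 ≤ ρ) (hρ : ρ ≤ 1)
    (hc : ∀ i a, Fintype.card {s // c i s = a} = h)
    (hsup : ∀ i a, ρ * h ≤ #{s | c i s = a ∧ IsSupportSlot (c i) s}) (x : V)
    (q : Fin d × Slot r k) :
    (numChoices χ c (x, lowSet c q) : ℝ) * h ≤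
      (h : ℝ) ^ d * (Real.exp 1 * k ^ 3 * Real.exp (-(ρ * (1 - 1 / k) * d))) := by
  have hk0 : (0 : ℝ) < k := by exact_mod_cast Nat.pos_of_ne_zero (NeZero.ne k)
  have hk1 : (1 : ℝ) ≤ k := by exact_mod_cast Nat.pos_of_ne_zero (NeZero.ne k)
  have hkinv : (1 : ℝ) / k ≤ 1 := by rw [div_le_one hk0]; exact hk1
  have hkinv0 : (0 : ℝ) < 1 / k := by positivity
  set g : Fin d → Slot r k → ℝ := fun j s =>
    if j = q.1 then (if s = q.2 then 1 else 0) else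
      if c j s = χ x then (if IsSupportSlot (c j) s then 1 / k else 1) else 0 with hg
  have hg0 : ∀ j s, 0 ≤ g j s := by
    intro j s
    simp only [hg]
    split_ifs <;> positivity
  set B : ℝ := h * Real.exp (-(ρ * (1 - 1 / k))) with hB
  have hB0 : 0 ≤ B := by positivity
  have hsum : ∀ j, ∑ s, g j s ≤ if j = q.1 then 1 else B := by
    intro j
    by_cases hj : j = q.1
    · simp [hg, hj]
    · simp only [hg, hj, if_false]
      have e1 : #{s | c j s = χ x ∧ IsSupportSlot (c j) s} +
          #{s | c j s = χ x ∧ ¬ IsSupportSlot (c j) s} = h := by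
        rw [← hc j (χ x), Fintype.card_subtype, ← Finset.filter_filter, ← Finset.filter_filter]
        exact Finset.card_filter_add_card_filter_not _
      have e2 : (#{s | c j s = χ x ∧ IsSupportSlot (c j) s} : ℝ) +
          #{s | c j s = χ x ∧ ¬ IsSupportSlot (c j) s} = h := by exact_mod_cast e1
      have e3 := hsup j (χ x)
      have e4 := Real.add_one_le_exp (-(ρ * (1 - 1 / k)))
      have e5 : ∑ s, (if c j s = χ x then (if IsSupportSlot (c j) s then (1 : ℝ) / k else 1)
          else 0) = #{s | c j s = χ x ∧ IsSupportSlot (c j) s} * (1 / k) +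
            #{s | c j s = χ x ∧ ¬ IsSupportSlot (c j) s} := by
        rw [← Finset.sum_filter, Finset.sum_ite, Finset.filter_filter, Finset.filter_filter]
        simp
      rw [e5, hB]
      have e6 : (h : ℝ) * (-(ρ * (1 - 1 / k)) + 1) ≤
          h * Real.exp (-(ρ * (1 - 1 / k))) := by gcongr
      nlinarith
  have hle : (numChoices χ c (x, lowSet c q) : ℝ) ≤ k ^ 3 * ∏ j, ∑ s, g j s := by
    rw [Finset.prod_univ_sum, Finset.mul_sum, numChoices, Finset.card_filter, Nat.cast_sum,
      Fintype.piFinset_univ]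
    refine Finset.sum_le_sum fun y _ => ?_
    have hpos : 0 ≤ (k : ℝ) ^ 3 * ∏ j, g j (y j) :=
      mul_nonneg (by positivity) (Finset.prod_nonneg fun j _ => hg0 j _)
    split_ifs with hy
    · obtain ⟨hcol, hy1, hy2⟩ := hy
      have e : ∏ j, g j (y j) =
          (1 / (k : ℝ)) ^ #{j | j ≠ q.1 ∧ IsSupportSlot (c j) (y j)} := by
        rw [← Finset.prod_const, Finset.prod_filter]
        refine Finset.prod_congr rfl fun j _ => ?_
        by_cases hj : j = q.1
        · subst hj; simp [hg, hy1]
        · simp [hg, hj, hcol j]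
      rw [e]
      have e2 : (1 / (k : ℝ)) ^ 3 ≤
          (1 / (k : ℝ)) ^ #{j | j ≠ q.1 ∧ IsSupportSlot (c j) (y j)} :=
        pow_le_pow_of_le_one hkinv0.le hkinv hy2
      calc ((1 : ℕ) : ℝ) = k ^ 3 * (1 / (k : ℝ)) ^ 3 := by push_cast; field_simp
        _ ≤ _ := by gcongr
    · simpa using hpos
  have hprod : (∏ j, ∑ s, g j s) * B ≤ B ^ d := by
    calc _ ≤ (∏ j, if j = q.1 then 1 else B) * B := by
          refine mul_le_mul_of_nonneg_right (Finset.prod_le_prod (fun j _ => ?_)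
            fun j _ => hsum j) hB0
          exact Finset.sum_nonneg fun s _ => hg0 j s
      _ = (∏ j, if j = q.1 then 1 else B) * ∏ j, if j = q.1 then B else 1 := by
          rw [Finset.prod_ite_eq' Finset.univ q.1 fun _ => B]
          simp
      _ = ∏ _j : Fin d, B := by
          rw [← Finset.prod_mul_distrib]
          refine Finset.prod_congr rfl fun j _ => ?_
          split_ifs <;> simp
      _ = B ^ d := by simp
  -- The pinned array contributes no factor `B`. The factor `h` on the left of the claim supplies
  -- it, at the cost of `e`.
  have hBh : (h : ℝ) ≤ Real.exp 1 * B := by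
    rw [hB, ← mul_assoc, mul_comm (Real.exp 1), mul_assoc, ← Real.exp_add]
    apply le_mul_of_one_le_right (by positivity)
    apply Real.one_le_exp
    nlinarith
  have hBd : B ^ d = (h : ℝ) ^ d * Real.exp (-(ρ * (1 - 1 / k) * d)) := by
    rw [hB, mul_pow, ← Real.exp_nat_mul]
    ring_nf
  have hprod0 : 0 ≤ ∏ j, ∑ s, g j s :=
    Finset.prod_nonneg fun j _ => Finset.sum_nonneg fun s _ => hg0 j s
  calc (numChoices χ c (x, lowSet c q) : ℝ) * h
      ≤ (k ^ 3 * ∏ j, ∑ s, g j s) * (Real.exp 1 * B) := by gcongr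
    _ = Real.exp 1 * k ^ 3 * ((∏ j, ∑ s, g j s) * B) := by ring
    _ ≤ Real.exp 1 * k ^ 3 * B ^ d := by gcongr
    _ = _ := by rw [hBd]; ring

open Classical in
-- A link is determined by a support slot, a second slot of its row, and an orientation.
lemma card_linked_le {τ : ℝ} (hsup : ∀ i, (#{s | IsSupportSlot (c i) s} : ℝ) ≤ τ) :
    (#{e : Fin d × Slot r k × Slot r k | Linked c e} : ℝ) ≤ 2 * (d * τ * k) := by
  set Q : Finset (Fin d × Slot r k) := {p | IsSupportSlot (c p.1) p.2} with hQ
  have hQc : (#Q : ℝ) ≤ d * τ := by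
    have e : #Q = ∑ i : Fin d, #{s | IsSupportSlot (c i) s} := by
      simp only [hQ, Finset.card_filter, Fintype.sum_prod_type]
    rw [e]
    push_cast
    calc _ ≤ ∑ _i : Fin d, τ := Finset.sum_le_sum fun i _ => hsup i
      _ = _ := by simp
  have hs : ({e : Fin d × Slot r k × Slot r k | Linked c e} : Finset _) ⊆
      ((Q ×ˢ (Finset.univ : Finset (ZMod k))).image
        fun p => (p.1.1, p.1.2, (p.1.2.1, p.2))) ∪
      ((Q ×ˢ (Finset.univ : Finset (ZMod k))).image
        fun p => (p.1.1, (p.1.2.1, p.2), p.1.2)) := by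
    rintro ⟨i, s, s'⟩ he
    obtain ⟨h1, -, h2 | h2⟩ := (Finset.mem_filter.1 he).2
    · refine Finset.mem_union_left _ (Finset.mem_image.2 ⟨((i, s), s'.2), ?_, ?_⟩)
      · simp [hQ, h2]
      · have e : ((s.1, s'.2) : Slot r k) = s' := Prod.ext h1 rfl
        simp [e]
    · refine Finset.mem_union_right _ (Finset.mem_image.2 ⟨((i, s'), s.2), ?_, ?_⟩)
      · simp [hQ, h2]
      · have e : ((s'.1, s.2) : Slot r k) = s := Prod.ext h1.symm rfl
        simp [e]
  have hcard := (Finset.card_le_card hs).trans (Finset.card_union_le _ _)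
  have hcard2 : #{e : Fin d × Slot r k × Slot r k | Linked c e} ≤ 2 * (#Q * k) := by
    refine hcard.trans ?_
    rw [two_mul]
    gcongr <;>
    · refine Finset.card_image_le.trans ?_
      rw [Finset.card_product, Finset.card_univ, ZMod.card]
  calc (#{e : Fin d × Slot r k × Slot r k | Linked c e} : ℝ) ≤ 2 * (#Q * k) := by
        exact_mod_cast hcard2
    _ ≤ _ := by gcongr

end LowDegree

/-! ### Total weight of trees and witnesses -/

section Weights

variable {V : Type} [Fintype V] {r k d : ℕ} [NeZero k] {χ : V → Fin 2}
  {c : Fin d → Slot r k → Fin 2} {h : ℕ} {D θ : ℝ}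

open Classical in
/-- Indicator that `e` is a link starting at color `a`. -/
noncomputable def linkInd (c : Fin d → Slot r k → Fin 2) (e : Fin d × Slot r k × Slot r k)
    (a : Fin 2) : ℝ := if Linked c e ∧ c e.1 e.2.1 = a then 1 else 0

/-- Indicator that position `q` has the color of the vertex `x`. -/
def colorInd (χ : V → Fin 2) (c : Fin d → Slot r k → Fin 2) (q : Fin d × Slot r k) (x : V) : ℝ :=
  if c q.1 q.2 = χ x then 1 else 0

lemma linkInd_nonneg (e : Fin d × Slot r k × Slot r k) (a : Fin 2) : 0 ≤ linkInd c e a := by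
  unfold linkInd; split_ifs <;> norm_num

lemma colorInd_nonneg (q : Fin d × Slot r k) (x : V) : 0 ≤ colorInd χ c q x := by
  unfold colorInd; split_ifs <;> norm_num

/-- The bounds on the color arrays that enter the estimate of the witness weights: `P` bounds the
probability of having few support slots, `Z` that of having none, and `κ` the number of links at
a vertex. -/
structure WeightBounds (χ : V → Fin 2) (c : Fin d → Slot r k → Fin 2) (h : ℕ)
    (D θ P Z κ : ℝ) : Prop where
  h_pos : 0 < h
  D_pos : 0 < D
  θ_nonneg : 0 ≤ θ
  P_nonneg : 0 ≤ P
  κ_nonneg : 0 ≤ κ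
  pow_le : (h : ℝ) ^ d ≤ θ * D
  card_slot : ∀ i a, Fintype.card {s // c i s = a} ≤ h
  card_vertex : ∀ a, Fintype.card {x // χ x = a} = h
  low : ∀ x q, (numChoices χ c (x, lowSet c q) : ℝ) / D ≤ P * θ / h
  isolated : ∀ x, (numChoices χ c (x, isolatedSet c) : ℝ) / D ≤ Z
  links : ∀ a, ∑ e, linkInd c e a ≤ κ * h

variable {P Z κ : ℝ}

lemma WeightBounds.sum_colorInd_le (B : WeightBounds χ c h D θ P Z κ) (q : Fin d × Slot r k) :
    ∑ x, colorInd χ c q x ≤ h := by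
  have := B.card_vertex (c q.1 q.2)
  rw [Fintype.card_subtype] at this
  simp only [colorInd, Finset.sum_boole]
  rw [← this]
  simp only [eq_comm, le_refl]

lemma WeightBounds.card_eq (B : WeightBounds χ c h D θ P Z κ) : Fintype.card V = 2 * h := by
  classical
  have h1 := Fintype.card_congr (Equiv.sigmaFiberEquiv χ)
  rw [Fintype.card_sigma] at h1
  rw [← h1, Finset.sum_congr rfl fun a _ => B.card_vertex a]
  simp

lemma WeightBounds.low_le (B : WeightBounds χ c h D θ P Z κ) (x : V) (q : Fin d × Slot r k) :
    (numChoices χ c (x, lowSet c q) : ℝ) / D ≤ colorInd χ c q x * (P * θ / h) := by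
  by_cases hx : c q.1 q.2 = χ x
  · rw [colorInd, if_pos hx, one_mul]
    exact B.low x q
  · have : numChoices χ c (x, lowSet c q) = 0 :=
      numChoices_eq_zero fun y hy => ⟨q.1, by rwa [hy.1]⟩
    simp [this, colorInd, hx]

lemma WeightBounds.lowLink_le (B : WeightBounds χ c h D θ P Z κ) (x : V)
    (e : Fin d × Slot r k × Slot r k) :
    (numChoices χ c (x, lowLinkSet c e) : ℝ) / D ≤ linkInd c e (χ x) * (P * θ / h) := by
  classical
  by_cases he : Linked c e ∧ c e.1 e.2.1 = χ x
  · rw [linkInd, if_pos he, one_mul]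
    refine le_trans ?_ (B.low x (e.1, e.2.1))
    have := B.D_pos
    gcongr
    refine Finset.card_le_card fun y hy => ?_
    simp only [Finset.mem_filter] at hy ⊢
    exact ⟨hy.1, hy.2.1, hy.2.2.1⟩
  · have : numChoices χ c (x, lowLinkSet c e) = 0 := by
      refine numChoices_eq_zero fun y hy => ⟨e.1, fun hcol => he ⟨hy.2, ?_⟩⟩
      rwa [hy.1.1] at hcol
    simp [this, linkInd, he]

/-- Three pinned positions cost `θ / h ^ 3`, and no position is admissible unless they lie in
distinct arrays and carry the color of `x`. The indicators keep this restriction available for the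
sums over `x` and over links. -/
lemma WeightBounds.fork_le (B : WeightBounds χ c h D θ P Z κ) (x : V) (q : Fin d × Slot r k)
    (e e' : Fin d × Slot r k × Slot r k) :
    (numChoices χ c (x, forkSet c q e e') : ℝ) / D ≤
      colorInd χ c q x * (linkInd c e (χ x) * linkInd c e' (χ x)) * (θ / h ^ 3) := by
  classical
  by_cases hall : c q.1 q.2 = χ x ∧ (Linked c e ∧ c e.1 e.2.1 = χ x) ∧
      (Linked c e' ∧ c e'.1 e'.2.1 = χ x) ∧ q.1 ≠ e.1 ∧ q.1 ≠ e'.1 ∧ e.1 ≠ e'.1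
  · obtain ⟨h1, h2, h3, h4, h5, h6⟩ := hall
    rw [colorInd, if_pos h1, linkInd, if_pos h2, linkInd, if_pos h3, one_mul, one_mul, one_mul]
    have hJ : #({q.1, e.1, e'.1} : Finset (Fin d)) = 3 :=
      Finset.card_eq_three.2 ⟨_, _, _, h4, h5, h6, rfl⟩
    rw [← hJ]
    refine numChoices_div_le B.h_pos B.D_pos B.pow_le B.card_slot _
      (fun j => if j = q.1 then q.2 else if j = e.1 then e.2.1 else e'.2.1) ?_ _
    intro y hy j hj
    simp only [Finset.mem_insert, Finset.mem_singleton] at hj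
    rcases hj with rfl | rfl | rfl
    · simpa using hy.1
    · simpa [h4.symm] using hy.2.1
    · simpa [h5.symm, h6.symm] using hy.2.2.1
  · have : numChoices χ c (x, forkSet c q e e') = 0 := by
      refine numChoices_eq_zero fun y hy => ?_
      by_contra! hcol
      obtain ⟨y1, y2, y3, h4, h5, h6, h7, h8⟩ := hy
      refine hall ⟨?_, ⟨h7, ?_⟩, ⟨h8, ?_⟩, h4, h5, h6⟩
      · rw [← y1, hcol]
      · rw [← y2, hcol]
      · rw [← y3, hcol]
    rw [this, Nat.cast_zero, zero_div]
    have := colorInd_nonneg (χ := χ) (c := c) q x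
    have := linkInd_nonneg (c := c) e (χ x)
    have := linkInd_nonneg (c := c) e' (χ x)
    have := B.θ_nonneg
    positivity

lemma WeightBounds.root_le (B : WeightBounds χ c h D θ P Z κ) (x : V)
    (e e' : Fin d × Slot r k × Slot r k) :
    (numChoices χ c (x, rootSet c e e') : ℝ) / D ≤
      linkInd c e (χ x) * linkInd c e' (χ x) * (θ / h ^ 2) := by
  classical
  by_cases hall : (Linked c e ∧ c e.1 e.2.1 = χ x) ∧
      (Linked c e' ∧ c e'.1 e'.2.1 = χ x) ∧ e.1 ≠ e'.1
  · obtain ⟨h2, h3, h6⟩ := hall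
    rw [linkInd, if_pos h2, linkInd, if_pos h3, one_mul, one_mul]
    rw [← Finset.card_pair h6]
    refine numChoices_div_le B.h_pos B.D_pos B.pow_le B.card_slot _
      (fun j => if j = e.1 then e.2.1 else e'.2.1) ?_ _
    intro y hy j hj
    simp only [Finset.mem_insert, Finset.mem_singleton] at hj
    rcases hj with rfl | rfl
    · simpa using hy.1
    · simpa [h6.symm] using hy.2.1
  · have : numChoices χ c (x, rootSet c e e') = 0 := by
      refine numChoices_eq_zero fun y hy => ?_
      by_contra! hcol
      obtain ⟨y2, y3, h6, h7, h8⟩ := hy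
      refine hall ⟨⟨h7, ?_⟩, ⟨h8, ?_⟩, h6⟩
      · rw [← y2, hcol]
      · rw [← y3, hcol]
    rw [this, Nat.cast_zero, zero_div]
    have := linkInd_nonneg (c := c) e (χ x)
    have := linkInd_nonneg (c := c) e' (χ x)
    have := B.θ_nonneg
    positivity

lemma WeightBounds.pass_le (B : WeightBounds χ c h D θ P Z κ) (x : V)
    (e e' : Fin d × Slot r k × Slot r k) :
    (numChoices χ c (x, passSet c e e') : ℝ) / D ≤
      colorInd χ c (e.1, e.2.2) x * linkInd c e' (χ x) * (θ / h ^ 2) := by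
  classical
  by_cases hall : c e.1 e.2.2 = χ x ∧ (Linked c e' ∧ c e'.1 e'.2.1 = χ x) ∧ e.1 ≠ e'.1
  · obtain ⟨h2, h3, h6⟩ := hall
    rw [colorInd, if_pos h2, linkInd, if_pos h3, one_mul, one_mul]
    rw [← Finset.card_pair h6]
    refine numChoices_div_le B.h_pos B.D_pos B.pow_le B.card_slot _
      (fun j => if j = e.1 then e.2.2 else e'.2.1) ?_ _
    intro y hy j hj
    simp only [Finset.mem_insert, Finset.mem_singleton] at hj
    rcases hj with rfl | rfl
    · simpa using hy.1
    · simpa [h6.symm] using hy.2.1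
  · have : numChoices χ c (x, passSet c e e') = 0 := by
      refine numChoices_eq_zero fun y hy => ?_
      by_contra! hcol
      obtain ⟨y2, y3, h6, h8⟩ := hy
      refine hall ⟨?_, ⟨h8, ?_⟩, h6⟩
      · rw [← y2, hcol]
      · rw [← y3, hcol]
    rw [this, Nat.cast_zero, zero_div]
    have := colorInd_nonneg (χ := χ) (c := c) (e.1, e.2.2) x
    have := linkInd_nonneg (c := c) e' (χ x)
    have := B.θ_nonneg
    positivity

/-- By `hA`, `A` is a supersolution of the recursion for tree weights, hence a bound independent of
the depth. For a given entrance `q` the root has at most `h` choices and each of the two links at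
most `κ h`. Against `θ / h ^ 3` for the pinned positions this leaves `θ κ² A²` for a fork. -/
lemma WeightBounds.sum_tree_le (B : WeightBounds χ c h D θ P Z κ) {A : ℝ} (hA0 : 0 ≤ A)
    (hA : θ * (P + κ ^ 2 * A ^ 2) ≤ A) :
    ∀ (l : ℕ) (q : Fin d × Slot r k),
      ∑ T : WTree V r k d l, listWeight χ c D (treeList c l T q) ≤ A := by
  have hD := B.D_pos
  have hθ := B.θ_nonneg
  have hP := B.P_nonneg
  have hκ := B.κ_nonneg
  have hh : (0 : ℝ) < h := by exact_mod_cast B.h_pos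
  intro l
  induction l with
  | zero =>
    intro q
    refine le_trans (le_of_eq ?_) hA0
    exact Fintype.sum_empty (ι := PEmpty) _
  | succ l ih =>
    intro q
    refine le_trans (le_of_eq (Fintype.sum_sum_type _)) ?_
    suffices hsum : (∑ x : V, listWeight χ c D (treeList c (l + 1) (Sum.inl x) q) ≤ θ * P) ∧
        ∑ p : V × (Fin d × Slot r k × Slot r k) × (Fin d × Slot r k × Slot r k) ×
          WTree V r k d l × WTree V r k d l,
          listWeight χ c D (treeList c (l + 1) (Sum.inr p) q) ≤ θ * (κ ^ 2 * A ^ 2) by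
      refine (add_le_add hsum.1 hsum.2).trans ?_
      linarith
    constructor
    · calc ∑ x : V, listWeight χ c D (treeList c (l + 1) (Sum.inl x) q)
          ≤ ∑ x : V, colorInd χ c q x * (P * θ / h) := by
            refine Finset.sum_le_sum fun x _ => ?_
            simpa [treeList] using B.low_le x q
        _ = (∑ x : V, colorInd χ c q x) * (P * θ / h) := by rw [Finset.sum_mul]
        _ ≤ h * (P * θ / h) := by
            gcongr
            exact B.sum_colorInd_le q
        _ = θ * P := by field_simp
    · calc _ = ∑ x : V, ∑ e, ∑ e', (numChoices χ c (x, forkSet c q e e') : ℝ) / D *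
              ((∑ T : WTree V r k d l, listWeight χ c D (treeList c l T (e.1, e.2.2))) *
              ∑ T : WTree V r k d l, listWeight χ c D (treeList c l T (e'.1, e'.2.2))) := by
            rw [Fintype.sum_prod_type]
            refine Finset.sum_congr rfl fun x _ => ?_
            rw [Fintype.sum_prod_type]
            refine Finset.sum_congr rfl fun e _ => ?_
            rw [Fintype.sum_prod_type]
            refine Finset.sum_congr rfl fun e' _ => ?_
            rw [Fintype.sum_prod_type, Finset.sum_mul_sum, Finset.mul_sum]
            refine Finset.sum_congr rfl fun T _ => ?_
            rw [Finset.mul_sum]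
            refine Finset.sum_congr rfl fun T' _ => ?_
            simp only [treeList, listWeight_append, listWeight_cons]
            ring
        _ ≤ ∑ x : V, ∑ e, ∑ e', colorInd χ c q x * (linkInd c e (χ x) * linkInd c e' (χ x)) *
              (θ / h ^ 3) * (A * A) := by
            refine Finset.sum_le_sum fun x _ => Finset.sum_le_sum fun e _ =>
              Finset.sum_le_sum fun e' _ => ?_
            have hnn : ∀ q, 0 ≤ ∑ T : WTree V r k d l, listWeight χ c D (treeList c l T q) :=
              fun q => Finset.sum_nonneg fun T _ => listWeight_nonneg hD.le _
            have h0 := linkInd_nonneg (c := c) e (χ x)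
            have h1 := linkInd_nonneg (c := c) e' (χ x)
            have h2 := colorInd_nonneg (χ := χ) (c := c) q x
            exact mul_le_mul (B.fork_le x q e e') (mul_le_mul (ih _) (ih _) (hnn _) hA0)
              (mul_nonneg (hnn _) (hnn _)) (by positivity)
        _ = ∑ x : V, colorInd χ c q x * ((∑ e, linkInd c e (χ x)) * ∑ e, linkInd c e (χ x))
              * (θ / h ^ 3 * A ^ 2) := by
            refine Finset.sum_congr rfl fun x _ => ?_
            rw [Finset.sum_mul_sum, Finset.mul_sum, Finset.sum_mul]
            refine Finset.sum_congr rfl fun e _ => ?_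
            rw [Finset.mul_sum, Finset.sum_mul]
            exact Finset.sum_congr rfl fun e' _ => by ring
        _ ≤ ∑ x : V, colorInd χ c q x * ((κ * h) * (κ * h)) * (θ / h ^ 3 * A ^ 2) := by
            refine Finset.sum_le_sum fun x _ => ?_
            have h0 : 0 ≤ ∑ e, linkInd c e (χ x) :=
              Finset.sum_nonneg fun e _ => linkInd_nonneg e _
            have h1 := B.links (χ x)
            have h2 := colorInd_nonneg (χ := χ) (c := c) q x
            gcongr
        _ = (∑ x : V, colorInd χ c q x) * (((κ * h) * (κ * h)) * (θ / h ^ 3 * A ^ 2)) := by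
            rw [Finset.sum_mul]
            exact Finset.sum_congr rfl fun x _ => by ring
        _ ≤ h * (((κ * h) * (κ * h)) * (θ / h ^ 3 * A ^ 2)) := by
            gcongr
            exact B.sum_colorInd_le q
        _ = θ * (κ ^ 2 * A ^ 2) := by field_simp

/-- The total weight of all witnesses. -/
lemma WeightBounds.sum_witness_le (B : WeightBounds χ c h D θ P Z κ) {A : ℝ} (hA0 : 0 ≤ A)
    (hA : θ * (P + κ ^ 2 * A ^ 2) ≤ A) (l : ℕ) :
    ∑ T : Witness V r k d l, listWeight χ c D (witnessList c l T) ≤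
      2 * h * (Z + κ ^ 2 * θ * A ^ 2 + κ * θ * P * A + κ ^ 2 * θ ^ 2 * P * A) := by
  have hD := B.D_pos
  have hθ := B.θ_nonneg
  have hP := B.P_nonneg
  have hκ := B.κ_nonneg
  have hh : (0 : ℝ) < h := by exact_mod_cast B.h_pos
  have hV : (Fintype.card V : ℝ) = 2 * h := by exact_mod_cast B.card_eq
  have htree := B.sum_tree_le hA0 hA l
  have hlink0 : ∀ a, 0 ≤ ∑ e, linkInd c e a := fun a => Finset.sum_nonneg fun e _ =>
    linkInd_nonneg e _
  have htree0 : ∀ q, 0 ≤ ∑ T : WTree V r k d l, listWeight χ c D (treeList c l T q) :=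
    fun q => Finset.sum_nonneg fun T _ => listWeight_nonneg hD.le _
  rw [Fintype.sum_sum_type, Fintype.sum_sum_type, Fintype.sum_sum_type]
  -- Only this term is of leading order: each of the other three contains two of the small factors
  -- `P` and `A`.
  have h1 : ∑ x : V, listWeight χ c D (witnessList (r := r) (k := k) c l (Sum.inl x)) ≤
      2 * h * Z := by
    calc _ ≤ ∑ _x : V, Z := by
          refine Finset.sum_le_sum fun x _ => ?_
          simpa [witnessList] using B.isolated x
      _ = _ := by simp [hV]
  have h2 : ∑ p : V × (Fin d × Slot r k × Slot r k) × (Fin d × Slot r k × Slot r k) ×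
      WTree V r k d l × WTree V r k d l,
        listWeight χ c D (witnessList c l (Sum.inr (Sum.inl p))) ≤
      2 * h * (κ ^ 2 * θ * A ^ 2) := by
    calc _ = ∑ x : V, ∑ e, ∑ e', (numChoices χ c (x, rootSet c e e') : ℝ) / D *
            ((∑ T : WTree V r k d l, listWeight χ c D (treeList c l T (e.1, e.2.2))) *
            ∑ T : WTree V r k d l, listWeight χ c D (treeList c l T (e'.1, e'.2.2))) := by
          rw [Fintype.sum_prod_type]
          refine Finset.sum_congr rfl fun x _ => ?_
          rw [Fintype.sum_prod_type]
          refine Finset.sum_congr rfl fun e _ => ?_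
          rw [Fintype.sum_prod_type]
          refine Finset.sum_congr rfl fun e' _ => ?_
          rw [Fintype.sum_prod_type, Finset.sum_mul_sum, Finset.mul_sum]
          refine Finset.sum_congr rfl fun T _ => ?_
          rw [Finset.mul_sum]
          refine Finset.sum_congr rfl fun T' _ => ?_
          simp only [witnessList, listWeight_append, listWeight_cons]
          ring
      _ ≤ ∑ x : V, ∑ e, ∑ e', linkInd c e (χ x) * linkInd c e' (χ x) * (θ / h ^ 2) *
            (A * A) := by
          refine Finset.sum_le_sum fun x _ => Finset.sum_le_sum fun e _ =>
            Finset.sum_le_sum fun e' _ => ?_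
          have := linkInd_nonneg (c := c) e (χ x)
          have := linkInd_nonneg (c := c) e' (χ x)
          exact mul_le_mul (B.root_le x e e') (mul_le_mul (htree _) (htree _) (htree0 _) hA0)
            (mul_nonneg (htree0 _) (htree0 _)) (by positivity)
      _ = ∑ x : V, (∑ e, linkInd c e (χ x)) * (∑ e, linkInd c e (χ x)) *
            (θ / h ^ 2 * (A * A)) := by
          refine Finset.sum_congr rfl fun x _ => ?_
          rw [Finset.sum_mul_sum, Finset.sum_mul]
          refine Finset.sum_congr rfl fun e _ => ?_
          rw [Finset.sum_mul]
          exact Finset.sum_congr rfl fun e' _ => by ring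
      _ ≤ ∑ _x : V, (κ * h) * (κ * h) * (θ / h ^ 2 * (A * A)) := by
          refine Finset.sum_le_sum fun x _ => ?_
          have := B.links (χ x)
          have := hlink0 (χ x)
          gcongr
      _ = _ := by
          rw [Finset.sum_const, Finset.card_univ, nsmul_eq_mul, hV]
          field_simp
  have h3 : ∑ p : V × (Fin d × Slot r k × Slot r k) × WTree V r k d l,
        listWeight χ c D (witnessList c l (Sum.inr (Sum.inr (Sum.inl p)))) ≤
      2 * h * (κ * θ * P * A) := by
    calc _ = ∑ x : V, ∑ e, (numChoices χ c (x, lowLinkSet c e) : ℝ) / D *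
            (∑ T : WTree V r k d l, listWeight χ c D (treeList c l T (e.1, e.2.2))) := by
          rw [Fintype.sum_prod_type]
          refine Finset.sum_congr rfl fun x _ => ?_
          rw [Fintype.sum_prod_type]
          refine Finset.sum_congr rfl fun e _ => ?_
          rw [Finset.mul_sum]
          refine Finset.sum_congr rfl fun T _ => ?_
          simp only [witnessList, listWeight_cons]
      _ ≤ ∑ x : V, ∑ e, linkInd c e (χ x) * (P * θ / h) * A := by
          refine Finset.sum_le_sum fun x _ => Finset.sum_le_sum fun e _ => ?_
          have := linkInd_nonneg (c := c) e (χ x)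
          exact mul_le_mul (B.lowLink_le x e) (htree _) (htree0 _) (by positivity)
      _ = ∑ x : V, (∑ e, linkInd c e (χ x)) * (P * θ / h * A) := by
          refine Finset.sum_congr rfl fun x _ => ?_
          rw [Finset.sum_mul]
          exact Finset.sum_congr rfl fun e _ => by ring
      _ ≤ ∑ _x : V, (κ * h) * (P * θ / h * A) := by
          refine Finset.sum_le_sum fun x _ => ?_
          have := B.links (χ x)
          gcongr
      _ = _ := by
          rw [Finset.sum_const, Finset.card_univ, nsmul_eq_mul, hV]
          field_simp
  have h4 : ∑ p : V × (Fin d × Slot r k × Slot r k) × V × (Fin d × Slot r k × Slot r k) ×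
      WTree V r k d l,
        listWeight χ c D (witnessList c l (Sum.inr (Sum.inr (Sum.inr p)))) ≤
      2 * h * (κ ^ 2 * θ ^ 2 * P * A) := by
    calc _ = ∑ x : V, ∑ e, ∑ z : V, ∑ e', (numChoices χ c (x, lowLinkSet c e) : ℝ) / D *
            ((numChoices χ c (z, passSet c e e') : ℝ) / D *
            (∑ T : WTree V r k d l, listWeight χ c D (treeList c l T (e'.1, e'.2.2)))) := by
          rw [Fintype.sum_prod_type]
          refine Finset.sum_congr rfl fun x _ => ?_
          rw [Fintype.sum_prod_type]
          refine Finset.sum_congr rfl fun e _ => ?_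
          rw [Fintype.sum_prod_type]
          refine Finset.sum_congr rfl fun z _ => ?_
          rw [Fintype.sum_prod_type]
          refine Finset.sum_congr rfl fun e' _ => ?_
          rw [Finset.mul_sum, Finset.mul_sum]
          refine Finset.sum_congr rfl fun T _ => ?_
          simp only [witnessList, listWeight_cons]
      _ ≤ ∑ x : V, ∑ e, ∑ z : V, ∑ e', linkInd c e (χ x) * (P * θ / h) *
            (colorInd χ c (e.1, e.2.2) z * linkInd c e' (χ z) * (θ / h ^ 2) * A) := by
          refine Finset.sum_le_sum fun x _ => Finset.sum_le_sum fun e _ =>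
            Finset.sum_le_sum fun z _ => Finset.sum_le_sum fun e' _ => ?_
          have := linkInd_nonneg (c := c) e (χ x)
          have := linkInd_nonneg (c := c) e' (χ z)
          have := colorInd_nonneg (χ := χ) (c := c) (e.1, e.2.2) z
          have := htree0 (e'.1, e'.2.2)
          exact mul_le_mul (B.lowLink_le x e)
            (mul_le_mul (B.pass_le z e e') (htree _) (htree0 _) (by positivity))
            (by positivity) (by positivity)
      _ = ∑ x : V, ∑ e, linkInd c e (χ x) * (P * θ / h * (θ / h ^ 2) * A) *
            ∑ z : V, colorInd χ c (e.1, e.2.2) z * ∑ e', linkInd c e' (χ z) := by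
          refine Finset.sum_congr rfl fun x _ => Finset.sum_congr rfl fun e _ => ?_
          rw [Finset.mul_sum]
          refine Finset.sum_congr rfl fun z _ => ?_
          rw [Finset.mul_sum, Finset.mul_sum]
          exact Finset.sum_congr rfl fun e' _ => by ring
      _ ≤ ∑ x : V, ∑ e, linkInd c e (χ x) * (P * θ / h * (θ / h ^ 2) * A) *
            (h * (κ * h)) := by
          refine Finset.sum_le_sum fun x _ => Finset.sum_le_sum fun e _ => ?_
          have := linkInd_nonneg (c := c) e (χ x)
          gcongr
          calc _ ≤ ∑ z : V, colorInd χ c (e.1, e.2.2) z * (κ * h) := by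
                refine Finset.sum_le_sum fun z _ => ?_
                have := colorInd_nonneg (χ := χ) (c := c) (e.1, e.2.2) z
                have := B.links (χ z)
                gcongr
            _ = (∑ z : V, colorInd χ c (e.1, e.2.2) z) * (κ * h) := by rw [Finset.sum_mul]
            _ ≤ _ := by
                gcongr
                exact B.sum_colorInd_le _
      _ = ∑ x : V, (∑ e, linkInd c e (χ x)) * (P * θ / h * (θ / h ^ 2) * A *
            (h * (κ * h))) := by
          refine Finset.sum_congr rfl fun x _ => ?_
          rw [Finset.sum_mul]
          exact Finset.sum_congr rfl fun e _ => by ring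
      _ ≤ ∑ _x : V, (κ * h) * (P * θ / h * (θ / h ^ 2) * A * (h * (κ * h))) := by
          refine Finset.sum_le_sum fun x _ => ?_
          have := B.links (χ x)
          gcongr
      _ = _ := by
          rw [Finset.sum_const, Finset.card_univ, nsmul_eq_mul, hV]
          field_simp
  linarith

end Weights

/-! ### Zero sums and deviations in random sequences -/

section Sequences

variable {W : Type*} [Fintype W]

open Classical in
/-- Two independent copies of a symmetric bounded integer cancel with probability at least the
inverse of the number of possible values. -/
lemma card_sq_le_of_symmetric {X : Type*} [Fintype X] (g : X → ℤ) (B : ℕ)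
    (hB : ∀ x, |g x| ≤ B) (ι : X → X) (hι : Function.Involutive ι) (hg : ∀ x, g (ι x) = -g x) :
    Fintype.card X ^ 2 ≤ (2 * B + 1) * #{p : X × X | g p.1 + g p.2 = 0} := by
  set I : Finset ℤ := Finset.Icc (-(B : ℤ)) B with hI
  have hIc : #I = 2 * B + 1 := by
    rw [hI, Int.card_Icc]
    omega
  have hmaps : ∀ x ∈ (Finset.univ : Finset X), g x ∈ I := fun x _ => by
    rw [hI, Finset.mem_Icc]
    exact abs_le.1 (hB x)
  have h1 : Fintype.card X = ∑ z ∈ I, #{x | g x = z} := by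
    rw [← Finset.card_univ]
    exact Finset.card_eq_sum_card_fiberwise hmaps
  have h2 : #{p : X × X | g p.1 + g p.2 = 0} = ∑ z ∈ I, #{x | g x = z} ^ 2 := by
    -- The involution in the second coordinate turns cancelling pairs into pairs with equal values.
    have e1 : #{p : X × X | g p.1 + g p.2 = 0} = #{p : X × X | g p.1 = g p.2} := by
      refine Finset.card_bij' (fun p _ => (p.1, ι p.2)) (fun p _ => (p.1, ι p.2)) ?_ ?_ ?_ ?_
      · intro p hp
        simp only [Finset.mem_filter, Finset.mem_univ, true_and, hg] at hp ⊢
        omega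
      · intro p hp
        simp only [Finset.mem_filter, Finset.mem_univ, true_and, hg] at hp ⊢
        omega
      · intro p _; simp [hι p.2]
      · intro p _; simp [hι p.2]
    rw [e1, Finset.card_eq_sum_card_fiberwise (f := fun p => g p.1) (t := I)
      (fun p _ => hmaps p.1 (Finset.mem_univ _))]
    refine Finset.sum_congr rfl fun z _ => ?_
    rw [pow_two, ← Finset.card_product]
    congr 1
    ext p
    simp only [Finset.mem_filter, Finset.mem_univ, true_and, Finset.mem_product]
    constructor
    · rintro ⟨h1, h2⟩; exact ⟨h2, h1 ▸ h2⟩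
    · rintro ⟨h1, h2⟩; exact ⟨h1.trans h2.symm, h1⟩
  rw [h1, h2, ← hIc]
  -- Cauchy–Schwarz over the `2 * B + 1` possible values.
  exact sq_sum_le_card_mul_sum_sq

open Classical in
-- Zero-sum sequences form at least an inverse polynomial proportion. For even length the two halves
-- cancel as independent copies (`card_sq_le_of_symmetric`); for odd length a letter of value zero
-- is added. A polynomial loss is harmless against exponentially small deviation probabilities.
lemma card_pow_le_card_sum_zero (f : W → ℤ) {k : ℕ} (hf : ∀ w, |f w| ≤ k) (ι : W → W)
    (hι : Function.Involutive ι) (hfι : ∀ w, f (ι w) = -f w) (r : ℕ)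
    (hr : Even r ∨ ∃ w, f w = 0) :
    Fintype.card W ^ r ≤
      (Fintype.card W + 1) * (r * k + 1) * #{u : Fin r → W | ∑ a, f (u a) = 0} := by
  have heven : ∀ q : ℕ, Fintype.card W ^ (q + q) ≤
      ((q + q) * k + 1) * #{u : Fin (q + q) → W | ∑ a, f (u a) = 0} := by
    intro q
    have h1 := card_sq_le_of_symmetric (fun u : Fin q → W => ∑ a, f (u a)) (q * k)
      (fun u => by
        refine (Finset.abs_sum_le_sum_abs _ _).trans ?_
        refine (Finset.sum_le_sum fun a _ => hf (u a)).trans ?_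
        simp)
      (fun u a => ι (u a)) (fun u => funext fun a => hι (u a)) (fun u => by simp [hfι])
    rw [Fintype.card_fun, Fintype.card_fin, ← pow_mul, mul_two] at h1
    refine h1.trans ?_
    rw [← mul_assoc, two_mul]
    gcongr
    refine Finset.card_le_card_of_injOn (fun p => Fin.append p.1 p.2) ?_ ?_
    · intro p hp
      simp only [Finset.coe_filter, Finset.mem_univ, true_and, Set.mem_ofPred_eq] at hp ⊢
      rw [Fin.sum_univ_add]
      simpa only [Fin.append_left, Fin.append_right] using hp
    · rintro ⟨u, v⟩ _ ⟨u', v'⟩ _ h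
      refine Prod.ext (funext fun a => ?_) (funext fun a => ?_)
      · simpa only [Fin.append_left] using congrFun h (Fin.castAdd q a)
      · simpa only [Fin.append_right] using congrFun h (Fin.natAdd q a)
  rcases Nat.even_or_odd r with ⟨q, rfl⟩ | ⟨q, rfl⟩
  · refine (heven q).trans ?_
    gcongr
    nlinarith [Nat.zero_le (Fintype.card W * ((q + q) * k + 1))]
  · obtain ⟨w₀, hw₀⟩ : ∃ w, f w = 0 := by
      refine hr.resolve_left ?_
      rw [Nat.not_even_iff_odd]
      exact ⟨q, rfl⟩
    rw [two_mul, pow_succ]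
    have h1 : #{u : Fin (q + q) → W | ∑ a, f (u a) = 0} ≤
        #{u : Fin (q + q + 1) → W | ∑ a, f (u a) = 0} := by
      refine Finset.card_le_card_of_injOn (fun u => Fin.cons w₀ u) ?_ ?_
      · intro u hu
        simp only [Finset.coe_filter, Finset.mem_univ, true_and, Set.mem_ofPred_eq] at hu ⊢
        rw [Fin.sum_univ_succ]
        simpa [hw₀] using hu
      · intro u _ v _ h
        exact (Fin.cons_injective2 h).2
    calc _ ≤ ((q + q) * k + 1) * #{u : Fin (q + q) → W | ∑ a, f (u a) = 0} *
            Fintype.card W := by gcongr; exact heven q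
      _ ≤ ((q + q + 1) * k + 1) * #{u : Fin (q + q + 1) → W | ∑ a, f (u a) = 0} *
            (Fintype.card W + 1) := by
          refine Nat.mul_le_mul (Nat.mul_le_mul ?_ h1) (by omega)
          exact Nat.succ_le_succ (Nat.mul_le_mul_right _ (by omega))
      _ = _ := by ring

open Classical in
/-- Chernoff's bound for the number of letters of a given kind in a uniformly random sequence. -/
lemma card_deviation_le (g : W → ℕ) (hg : ∀ w, g w ≤ 1) {p ε s : ℝ} (hp : 0 ≤ p)
    (hgp : (∑ w, g w : ℕ) = p * Fintype.card W) (hε : ε ≤ 1)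
    (hs : |s| = ε / 2) (r : ℕ) :
    (#{u : Fin r → W | s * (p * r) + |s| * (ε * (p * r)) ≤ s * ((∑ a, g (u a) : ℕ) : ℝ)} : ℝ) ≤
      (Fintype.card W : ℝ) ^ r * Real.exp (-(ε ^ 2 / 4 * p) * r) := by
  have hs1 : |s| ≤ 1 := by rw [hs]; linarith
  have hexp : Real.exp s - 1 ≤ s + s ^ 2 := by
    have := (abs_le.1 (Real.abs_exp_sub_one_sub_id_le hs1)).2
    linarith
  have hss : s ^ 2 = ε ^ 2 / 4 := by rw [← sq_abs, hs]; ring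
  have hsum : ∑ u : Fin r → W, Real.exp (s * ((∑ a, g (u a) : ℕ) : ℝ)) =
      (∑ w, Real.exp (s * g w)) ^ r := by
    rw [Fintype.sum_pow]
    refine Finset.sum_congr rfl fun u _ => ?_
    rw [← Real.exp_sum, Nat.cast_sum, Finset.mul_sum]
  have hone : ∑ w, Real.exp (s * g w) ≤ Fintype.card W * Real.exp (p * (s + s ^ 2)) := by
    have e : ∀ w, Real.exp (s * g w) = 1 + g w * (Real.exp s - 1) := by
      intro w
      have := hg w
      interval_cases h : g w <;> simp
    calc ∑ w, Real.exp (s * g w) = Fintype.card W + (∑ w, g w : ℕ) * (Real.exp s - 1) := by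
          rw [Finset.sum_congr rfl fun w _ => e w, Finset.sum_add_distrib, ← Finset.sum_mul]
          simp
      _ = Fintype.card W * (p * (Real.exp s - 1) + 1) := by rw [hgp]; ring
      _ ≤ Fintype.card W * (p * (s + s ^ 2) + 1) := by gcongr
      _ ≤ _ := by
          gcongr
          exact Real.add_one_le_exp _
  set T : ℝ := s * (p * r) + |s| * (ε * (p * r)) with hT
  set U : Finset (Fin r → W) := {u | T ≤ s * ((∑ a, g (u a) : ℕ) : ℝ)} with hU
  have hmarkov : (#U : ℝ) * Real.exp T ≤
      ((Fintype.card W : ℝ) * Real.exp (p * (s + s ^ 2))) ^ r := by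
    calc (#U : ℝ) * Real.exp T = ∑ u ∈ U, Real.exp T := by simp
      _ ≤ ∑ u ∈ U, Real.exp (s * ((∑ a, g (u a) : ℕ) : ℝ)) := by
          refine Finset.sum_le_sum fun u hu => Real.exp_le_exp.2 ?_
          exact (Finset.mem_filter.1 hu).2
      _ ≤ ∑ u : Fin r → W, Real.exp (s * ((∑ a, g (u a) : ℕ) : ℝ)) :=
          Finset.sum_le_sum_of_subset_of_nonneg (Finset.subset_univ _)
            fun _ _ _ => (Real.exp_pos _).le
      _ ≤ _ := by
          rw [hsum]
          gcongr
  rw [← le_div_iff₀ (Real.exp_pos _)] at hmarkov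
  refine hmarkov.trans (le_of_eq ?_)
  rw [mul_pow, ← Real.exp_nat_mul, mul_div_assoc, ← Real.exp_sub]
  -- The exponent is `p r (s² - |s| ε)`, equal to `-(ε² / 4) p r` at `|s| = ε / 2`. The sign of `s`
  -- selects the tail.
  congr 2
  rw [hT, hs, hss]
  ring

end Sequences

/-! ### Typical color arrays -/

section Arrays

open Classical in
/-- The balanced colorings of the slots without monochromatic rows. -/
noncomputable def properArrays (r k : ℕ) [NeZero k] : Finset (Slot r k → Fin 2) :=
  {c | (∀ a, ∃ b b', c (a, b) ≠ c (a, b')) ∧ #{s | c s = 0} = #{s | c s = 1}}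

/-- The number of support slots of each color is close to its typical value `p * r`. -/
def IsTypical {r k : ℕ} [NeZero k] (p ε : ℝ) (c : Slot r k → Fin 2) : Prop :=
  ∀ a, (1 - ε) * (p * r) ≤ ({s | c s = a ∧ IsSupportSlot c s} : Set (Slot r k)).ncard ∧
    (({s | c s = a ∧ IsSupportSlot c s} : Set (Slot r k)).ncard : ℝ) ≤ (1 + ε) * (p * r)

/-- The words that are not constant. -/
abbrev Word (k : ℕ) : Type := {w : ZMod k → Fin 2 // ∃ b b', w b ≠ w b'}

variable {k : ℕ} [NeZero k]

/-- The surplus of zeros over ones. -/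
def surplus (w : ZMod k → Fin 2) : ℤ := ∑ b, if w b = 0 then 1 else -1

open Classical in
/-- The number of letters that equal `a` and occur only once. -/
noncomputable def uniqueLetters (a : Fin 2) (w : ZMod k → Fin 2) : ℕ :=
  #{b | w b = a ∧ ∀ b', b' ≠ b → w b' ≠ w b}

lemma uniqueLetters_le_one (a : Fin 2) (w : ZMod k → Fin 2) : uniqueLetters a w ≤ 1 := by
  classical
  refine Finset.card_le_one.2 fun b hb b' hb' => ?_
  simp only [Finset.mem_filter, Finset.mem_univ, true_and] at hb hb'
  by_contra hne
  exact hb'.2 b hne (hb.1.trans hb'.1.symm)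

lemma exists_ne_zmod (hk : 2 ≤ k) (b : ZMod k) : ∃ b', b' ≠ b := by
  have : Fact (1 < k) := ⟨hk⟩
  exact exists_ne b

/-- For each position exactly one word has `a` there and the other color elsewhere; it is not
constant because `k ≥ 2`. The mean number of unique letters of color `a` in a random word is thus `k
/ card (Word k)`, the value of `p` in what follows. -/
lemma sum_uniqueLetters (hk : 2 ≤ k) (a : Fin 2) :
    ∑ w : Word k, uniqueLetters a w.1 = k := by
  classical
  have h1 : ∀ b : ZMod k, #{w : Word k | w.1 b = a ∧ ∀ b', b' ≠ b → w.1 b' ≠ w.1 b} = 1 := by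
    intro b
    rw [Finset.card_eq_one]
    have hne : ∀ x : Fin 2, x + 1 ≠ x := by decide
    have huniq : ∀ x y : Fin 2, x ≠ y → x = y + 1 := by decide
    obtain ⟨b', hb'⟩ := exists_ne_zmod hk b
    refine ⟨⟨fun z => if z = b then a else a + 1, b', b, by simp [hb', hne]⟩, ?_⟩
    ext w
    simp only [Finset.mem_filter, Finset.mem_univ, true_and, Finset.mem_singleton]
    constructor
    · rintro ⟨h1, h2⟩
      apply Subtype.ext
      funext z
      by_cases hz : z = b
      · simp [hz, h1]
      · simp only [hz, if_false]
        rw [← h1]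
        exact huniq _ _ (h2 z hz)
    · rintro rfl
      refine ⟨by simp, fun z hz => by simp [hz, hne]⟩
  calc ∑ w : Word k, uniqueLetters a w.1
      = ∑ b : ZMod k, #{w : Word k | w.1 b = a ∧ ∀ b', b' ≠ b → w.1 b' ≠ w.1 b} := by
        simp only [uniqueLetters, Finset.card_filter]
        exact Finset.sum_comm
    _ = k := by simp [h1, ZMod.card]

lemma card_word (hk : 2 ≤ k) : Fintype.card (Word k) + 2 = 2 ^ k := by
  classical
  have h1 := Fintype.card_subtype_compl (fun w : ZMod k → Fin 2 => ∃ b b', w b ≠ w b')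
  have h2 : Fintype.card {w : ZMod k → Fin 2 // ¬ ∃ b b', w b ≠ w b'} = 2 := by
    have e : Fin 2 ≃ {w : ZMod k → Fin 2 // ¬ ∃ b b', w b ≠ w b'} :=
      { toFun := fun a => ⟨fun _ => a, by simp⟩
        invFun := fun w => w.1 0
        left_inv := fun a => rfl
        right_inv := fun w => by
          apply Subtype.ext
          funext b
          have := w.2
          push Not at this
          exact this 0 b }
    simpa using (Fintype.card_congr e).symm
  have h3 := Fintype.card_subtype_le (fun w : ZMod k → Fin 2 => ∃ b b', w b ≠ w b')
  rw [h2] at h1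
  simp only [Fintype.card_fun, Fintype.card_fin, ZMod.card] at h1 h3
  have h4 : 4 ≤ 2 ^ k := by
    calc 4 = 2 ^ 2 := rfl
      _ ≤ 2 ^ k := Nat.pow_le_pow_right (by norm_num) hk
  have h5 : Fintype.card (Word k) =
      Fintype.card {w : ZMod k → Fin 2 // ∃ b b', w b ≠ w b'} := Fintype.card_congr (Equiv.refl _)
  rw [h5]
  omega

lemma abs_surplus_le (w : ZMod k → Fin 2) : |surplus w| ≤ k := by
  refine (Finset.abs_sum_le_sum_abs _ _).trans ?_
  calc _ ≤ ∑ _b : ZMod k, (1 : ℤ) := Finset.sum_le_sum fun b _ => by split_ifs <;> simp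
    _ = k := by simp [ZMod.card]

/-- Exchange of the two colors in a word. -/
def flipWord (w : Word k) : Word k :=
  ⟨fun b => w.1 b + 1, by
    obtain ⟨b, b', h⟩ := w.2
    exact ⟨b, b', fun e => h (add_right_cancel e)⟩⟩

lemma flipWord_involutive : Function.Involutive (flipWord (k := k)) := by
  intro w
  apply Subtype.ext
  funext b
  have : ∀ x : Fin 2, x + 1 + 1 = x := by decide
  exact this _

lemma surplus_flipWord (w : Word k) : surplus (flipWord w).1 = -surplus w.1 := by
  unfold surplus
  rw [← Finset.sum_neg_distrib]
  refine Finset.sum_congr rfl fun b _ => ?_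
  have : ∀ x : Fin 2, (if x + 1 = 0 then (1 : ℤ) else -1) = -(if x = 0 then 1 else -1) := by
    decide
  exact this _

/-- This serves the case of odd `r`, where `r * k` can be even only if `k` is. -/
lemma exists_surplus_eq_zero (hk : Even k) : ∃ w : Word k, surplus w.1 = 0 := by
  classical
  obtain ⟨q, hq⟩ := hk
  have hq0 : 0 < q := by
    have := NeZero.ne k
    omega
  obtain ⟨s, -, hs⟩ := Finset.exists_subset_card_eq
    (s := (Finset.univ : Finset (ZMod k))) (n := q) (by rw [Finset.card_univ, ZMod.card]; omega)
  have hs1 : s.Nonempty := Finset.card_pos.1 (by omega)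
  have hs2 : sᶜ.Nonempty := by
    apply Finset.card_pos.1
    rw [Finset.card_compl, ZMod.card]
    omega
  obtain ⟨b, hb⟩ := hs1
  obtain ⟨b', hb'⟩ := hs2
  rw [Finset.mem_compl] at hb'
  refine ⟨⟨fun z => if z ∈ s then 0 else 1, b, b', by simp [hb, hb']⟩, ?_⟩
  have e : ∀ z : ZMod k, (if (if z ∈ s then (0 : Fin 2) else 1) = 0 then (1 : ℤ) else -1) =
      if z ∈ s then 1 else -1 := by
    intro z
    by_cases hz : z ∈ s <;> simp [hz]
  simp only [surplus, e]
  rw [Finset.sum_ite]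
  have h1 : #{z | z ∉ s} = q := by
    have : ({z | z ∉ s} : Finset (ZMod k)) = sᶜ := by ext; simp
    rw [this, Finset.card_compl, ZMod.card]
    omega
  simp [h1, hs]

/-- Arrays without monochromatic rows are sequences of words. -/
def arrayOfWords {r : ℕ} (u : Fin r → Word k) : Slot r k → Fin 2 := fun s => (u s.1).1 s.2

lemma arrayOfWords_injective {r : ℕ} :
    Function.Injective (arrayOfWords (r := r) (k := k)) := by
  intro u v h
  funext a
  apply Subtype.ext
  funext b
  exact congrFun h (a, b)

lemma ncard_support_arrayOfWords {r : ℕ} (u : Fin r → Word k) (a : Fin 2) :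
    ({s | arrayOfWords u s = a ∧ IsSupportSlot (arrayOfWords u) s} : Set (Slot r k)).ncard =
      ∑ i, uniqueLetters a (u i).1 := by
  classical
  have e : ({s | arrayOfWords u s = a ∧ IsSupportSlot (arrayOfWords u) s} : Set (Slot r k)) =
      (({s : Slot r k | (u s.1).1 s.2 = a ∧ ∀ b', b' ≠ s.2 → (u s.1).1 b' ≠ (u s.1).1 s.2} :
        Finset (Slot r k)) : Set (Slot r k)) := by
    ext ⟨i, b⟩
    simp only [Set.mem_ofPred_eq, Finset.coe_filter, Finset.mem_univ, true_and, IsSupportSlot,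
      arrayOfWords]
    refine and_congr_right fun _ => ⟨fun h b' hb' => h (i, b') rfl fun e => hb' ?_, ?_⟩
    · exact congrArg Prod.snd e
    · rintro h ⟨i', b'⟩ hi hb'
      obtain rfl : i' = i := hi
      exact h b' fun e => hb' (by rw [e])
  rw [e, Set.ncard_coe_finset, Finset.card_filter, Fintype.sum_prod_type]
  refine Finset.sum_congr rfl fun i _ => ?_
  rw [uniqueLetters, Finset.card_filter]

open Classical in
-- Balance means that the surpluses of the rows add up to zero, which reduces color arrays to
-- sequences of words.
lemma mem_properArrays_iff {r : ℕ} {c : Slot r k → Fin 2} :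
    c ∈ properArrays r k ↔ ∃ u : Fin r → Word k, ∑ i, surplus (u i).1 = 0 ∧ arrayOfWords u = c := by
  have hsum : ∀ c : Slot r k → Fin 2, (∑ s, if c s = 0 then (1 : ℤ) else -1) =
      (#{s | c s = 0} : ℤ) - #{s | c s = 1} := by
    intro c
    have h1 : ∀ x : Fin 2, ¬ x = 0 ↔ x = 1 := by decide
    rw [Finset.sum_ite]
    simp [h1, sub_eq_add_neg]
  have hsur : ∀ u : Fin r → Word k, ∑ i, surplus (u i).1 =
      (#{s | arrayOfWords u s = 0} : ℤ) - #{s | arrayOfWords u s = 1} := by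
    intro u
    rw [← hsum, Fintype.sum_prod_type]
    rfl
  simp only [properArrays, Finset.mem_filter, Finset.mem_univ, true_and]
  constructor
  · rintro ⟨h1, h2⟩
    refine ⟨fun i => ⟨fun b => c (i, b), h1 i⟩, ?_, rfl⟩
    rw [hsur]
    change (#{s | c s = 0} : ℤ) - #{s | c s = 1} = 0
    rw [h2, sub_self]
  · rintro ⟨u, hu, rfl⟩
    refine ⟨fun i => (u i).2, ?_⟩
    rw [hsur] at hu
    omega

open Classical in
lemma card_word_pow_le {r : ℕ} (hr : Even (r * k)) :
    Fintype.card (Word k) ^ r ≤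
      (Fintype.card (Word k) + 1) * (r * k + 1) * #(properArrays r k) := by
  have h1 := card_pow_le_card_sum_zero (fun w : Word k => surplus w.1) (k := k)
    (fun w => abs_surplus_le w.1) flipWord flipWord_involutive surplus_flipWord r
    ((Nat.even_mul.1 hr).imp id exists_surplus_eq_zero)
  refine h1.trans ?_
  gcongr
  refine Finset.card_le_card_of_injOn arrayOfWords ?_ arrayOfWords_injective.injOn
  intro u hu
  exact mem_properArrays_iff.2 ⟨u, (Finset.mem_filter.1 hu).2, rfl⟩

open Classical in
-- Chernoff's bound is applied four times, to both tails for both colors. The balance condition is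
-- dropped, so the comparison is with all sequences of words.
lemma card_not_typical_le (hk : 2 ≤ k) {r : ℕ} {p ε : ℝ} (hp : p * Fintype.card (Word k) = k)
    (hε0 : 0 < ε) (hε : ε ≤ 1) :
    (#{c ∈ properArrays r k | ¬ IsTypical p ε c} : ℝ) ≤
      4 * ((Fintype.card (Word k) : ℝ) ^ r * Real.exp (-(ε ^ 2 / 4 * p) * r)) := by
  have hp0 : 0 ≤ p := by
    by_contra! hneg
    have h1 : p * Fintype.card (Word k) ≤ 0 :=
      mul_nonpos_of_nonpos_of_nonneg hneg.le (by positivity)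
    have h2 : (2 : ℝ) ≤ k := by exact_mod_cast hk
    linarith
  set dev : Fin 2 → ℝ → Finset (Fin r → Word k) := fun a s =>
    {u | s * (p * r) + |s| * (ε * (p * r)) ≤ s * ((∑ i, uniqueLetters a (u i).1 : ℕ) : ℝ)}
    with hdev
  have hdevc : ∀ a s, |s| = ε / 2 → (#(dev a s) : ℝ) ≤
      (Fintype.card (Word k) : ℝ) ^ r * Real.exp (-(ε ^ 2 / 4 * p) * r) := by
    intro a s hs
    exact card_deviation_le (fun w : Word k => uniqueLetters a w.1)
      (fun w => uniqueLetters_le_one a w.1) hp0 (by rw [sum_uniqueLetters hk a, hp]) hε hs r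
  have hsub : ({c ∈ properArrays r k | ¬ IsTypical p ε c} : Finset _) ⊆
      (dev 0 (ε / 2) ∪ dev 0 (-(ε / 2)) ∪ (dev 1 (ε / 2) ∪ dev 1 (-(ε / 2)))).image
        arrayOfWords := by
    intro c hc
    obtain ⟨hc1, hc2⟩ := Finset.mem_filter.1 hc
    obtain ⟨u, -, rfl⟩ := mem_properArrays_iff.1 hc1
    refine Finset.mem_image.2 ⟨u, ?_, rfl⟩
    have habs : |ε / 2| = ε / 2 := abs_of_pos (by linarith)
    have key : ∀ a, ¬ ((1 - ε) * (p * r) ≤ ((∑ i, uniqueLetters a (u i).1 : ℕ) : ℝ) ∧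
        ((∑ i, uniqueLetters a (u i).1 : ℕ) : ℝ) ≤ (1 + ε) * (p * r)) →
        u ∈ dev a (ε / 2) ∪ dev a (-(ε / 2)) := by
      intro a ha
      simp only [hdev, Finset.mem_union, Finset.mem_filter, Finset.mem_univ, true_and, abs_neg,
        habs]
      by_contra! hcon
      apply ha
      constructor
      · have := hcon.2
        nlinarith
      · have := hcon.1
        nlinarith
    simp only [IsTypical, not_forall, ncard_support_arrayOfWords] at hc2
    obtain ⟨a, ha⟩ := hc2
    have := key a ha
    fin_cases a
    · exact Finset.mem_union_left _ this
    · exact Finset.mem_union_right _ this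
  have hcard : #{c ∈ properArrays r k | ¬ IsTypical p ε c} ≤
      (#(dev 0 (ε / 2)) + #(dev 0 (-(ε / 2)))) + (#(dev 1 (ε / 2)) + #(dev 1 (-(ε / 2)))) := by
    refine (Finset.card_le_card hsub).trans (Finset.card_image_le.trans ?_)
    refine (Finset.card_union_le _ _).trans ?_
    exact add_le_add (Finset.card_union_le _ _) (Finset.card_union_le _ _)
  have hcard' : (#{c ∈ properArrays r k | ¬ IsTypical p ε c} : ℝ) ≤
      ((#(dev 0 (ε / 2)) : ℝ) + #(dev 0 (-(ε / 2)))) +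
        (#(dev 1 (ε / 2)) + #(dev 1 (-(ε / 2)))) := by exact_mod_cast hcard
  have habs : |ε / 2| = ε / 2 := abs_of_pos (by linarith)
  have habs' : |-(ε / 2)| = ε / 2 := by rw [abs_neg, habs]
  linarith [hdevc 0 _ habs, hdevc 0 _ habs', hdevc 1 _ habs, hdevc 1 _ habs']

open Classical in
/-- Almost all balanced arrays without monochromatic rows are typical. -/
lemma eventually_card_not_typical_le (hk : 2 ≤ k) {p ε τ : ℝ}
    (hp : p * Fintype.card (Word k) = k) (hp0 : 0 < p) (hε0 : 0 < ε) (hε : ε ≤ 1) (hτ : 0 < τ) :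
    ∀ᶠ r : ℕ in atTop, Even (r * k) →
      0 < #(properArrays r k) ∧
      (#{c ∈ properArrays r k | ¬ IsTypical p ε c} : ℝ) ≤ τ * #(properArrays r k) := by
  set w : ℝ := ((Fintype.card (Word k) : ℕ) : ℝ) with hw
  set b : ℝ := ε ^ 2 / 4 * p with hb
  have hb0 : 0 < b := by positivity
  have hlim : Tendsto (fun r : ℕ => 4 * (w + 1) * ((r * k + 1) * Real.exp (-b * r)))
      atTop (𝓝 0) := by
    have h1 := (Real.summable_pow_mul_exp_neg_nat_mul 1 hb0).tendsto_atTop_zero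
    have h2 := (Real.summable_pow_mul_exp_neg_nat_mul 0 hb0).tendsto_atTop_zero
    have h3 := ((h1.const_mul (k : ℝ)).add h2).const_mul (4 * (w + 1))
    simp only [mul_zero, add_zero] at h3
    refine h3.congr fun r => ?_
    ring
  filter_upwards [hlim.eventually (gt_mem_nhds hτ)] with r hr heven
  have h1 := card_word_pow_le heven
  have hw0 : 0 < Fintype.card (Word k) := by
    have := card_word hk
    have : 4 ≤ 2 ^ k := by
      calc 4 = 2 ^ 2 := rfl
        _ ≤ 2 ^ k := Nat.pow_le_pow_right (by norm_num) hk
    omega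
  have hpos : 0 < #(properArrays r k) := by
    by_contra! h0
    have h0' : #(properArrays r k) = 0 := by omega
    rw [h0', mul_zero] at h1
    have : 0 < Fintype.card (Word k) ^ r := by positivity
    omega
  refine ⟨hpos, (card_not_typical_le hk hp hε0 hε).trans ?_⟩
  have h2 : w ^ r ≤ (w + 1) * (r * k + 1) * #(properArrays r k) := by
    rw [hw]
    exact_mod_cast h1
  calc 4 * (w ^ r * Real.exp (-b * r))
      ≤ 4 * (((w + 1) * (r * k + 1) * #(properArrays r k)) * Real.exp (-b * r)) := by gcongr
    _ = (4 * (w + 1) * ((r * k + 1) * Real.exp (-b * r))) * #(properArrays r k) := by ring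
    _ ≤ _ := by gcongr

end Arrays

/-! ### Permutations all of whose cycles have length `k` -/

section CycleType

/-- Cycle lengths divide `k` by `hg`, while `hinj` excludes shorter cycles and fixed points. The
cycle type then depends only on `k` and the number of points, so all such permutations are
conjugate. -/
lemma cycleType_eq_replicate {V : Type*} [Fintype V] [DecidableEq V] {k : ℕ} (hk : 2 ≤ k)
    {g : Equiv.Perm V} (hg : g ^ k = 1) (hinj : ∀ v, Set.InjOn (fun j => (g ^ j) v) {j | j < k}) :
    g.cycleType = Multiset.replicate (Fintype.card V / k) k := by
  have hall : ∀ x ∈ g.cycleType, x = k := by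
    intro x hx
    apply le_antisymm
    · exact Nat.le_of_dvd (by omega) ((Equiv.Perm.dvd_of_mem_cycleType hx).trans
        (orderOf_dvd_of_pow_eq_one hg))
    · by_contra! hlt
      obtain ⟨c, τ, rfl, hdis, hc, hx'⟩ := Equiv.Perm.mem_cycleType_iff.1 hx
      obtain ⟨v, hv, -⟩ := id hc
      have hτ : τ v = v := (hdis v).resolve_left hv
      have hτx : (τ ^ x) v = v := Equiv.Perm.pow_apply_eq_self_of_apply_eq_self hτ x
      have hcx : c ^ x = 1 := by
        rw [← hx', ← hc.orderOf]
        exact pow_orderOf_eq_one c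
      have hvx : ((c * τ) ^ x) v = v := by
        rw [hdis.commute.mul_pow, hcx, one_mul, hτx]
      have h2 := Equiv.Perm.two_le_of_mem_cycleType hx
      have := hinj v (show x ∈ {j | j < k} from hlt) (show 0 ∈ {j | j < k} from (by omega : 0 < k))
        (by simpa using hvx)
      omega
  have hsupp : g.support = Finset.univ := by
    ext v
    simp only [Equiv.Perm.mem_support, Finset.mem_univ, iff_true]
    intro hv
    have := hinj v (show 1 ∈ {j | j < k} from (by omega : 1 < k)) (show 0 ∈ {j | j < k} from (by omega : 0 < k))
      (by simpa using hv)
    omega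
  have hrep := Multiset.eq_replicate_card.2 hall
  have hsum := g.sum_cycleType
  rw [hsupp, Finset.card_univ, hrep, Multiset.sum_replicate, smul_eq_mul] at hsum
  rw [hrep, ← hsum, Nat.mul_div_cancel _ (by omega)]

end CycleType

/-! ### From homomorphisms to families of bijections -/

section Rotation

variable {V : Type*} {r k d : ℕ} [NeZero k]

/-- The cyclic shift of all rows. -/
def rotation (r k : ℕ) : Equiv.Perm (Slot r k) :=
  Equiv.prodCongr (Equiv.refl _) (Equiv.addRight 1)

/-- The permutation that moves every vertex to the next one in its row. -/
def conjRotation (β : V ≃ Slot r k) : Equiv.Perm V :=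
  (β.trans (rotation r k)).trans β.symm

lemma conjRotation_pow_apply (β : V ≃ Slot r k) (j : ℕ) (v : V) :
    (conjRotation β ^ j) v = β.symm ((β v).1, (β v).2 + j) := by
  induction j with
  | zero => simp
  | succ j ih =>
    rw [pow_succ', Equiv.Perm.mul_apply, ih]
    simp [conjRotation, rotation, add_assoc]

lemma conjRotation_pow (β : V ≃ Slot r k) : conjRotation β ^ k = 1 := by
  ext v
  rw [conjRotation_pow_apply]
  simp

/-- The homomorphism whose generators rotate the rows of the given bijections. -/
def toHom (β : Fin d → V ≃ Slot r k) : Gam k d →* Equiv.Perm V :=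
  PresentedGroup.toGroup (f := fun i => conjRotation (β i)) (by
    rintro _ ⟨i, rfl⟩
    simp [conjRotation_pow])

@[simp] lemma toHom_gen (β : Fin d → V ≃ Slot r k) (i : Fin d) :
    toHom β (gen k d i) = conjRotation (β i) :=
  PresentedGroup.toGroup.of _

lemma hom_ext {G : Type*} [Group G] {σ τ : Gam k d →* G}
    (h : ∀ i, σ (gen k d i) = τ (gen k d i)) : σ = τ :=
  PresentedGroup.ext h

lemma gen_pow (i : Fin d) : gen k d i ^ k = 1 := by
  have : PresentedGroup.mk (Set.range fun i : Fin d => FreeGroup.of i ^ k)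
      (FreeGroup.of i ^ k) = 1 :=
    PresentedGroup.one_of_mem ⟨i, rfl⟩
  simpa [gen, PresentedGroup.of] using this

instance finite_hom [Finite V] : Finite (Gam k d →* Equiv.Perm V) := by
  refine Finite.of_injective
    (fun σ : Gam k d →* Equiv.Perm V => fun i : Fin d => σ (gen k d i)) ?_
  intro σ τ h
  exact hom_ext fun i => congrFun h i

lemma orbit_conjRotation (β : Fin d → V ≃ Slot r k) (i : Fin d) (v : V) :
    {w | ∃ j < k, w = toHom β (gen k d i ^ j) v} = block β i v := by
  ext w
  simp only [map_pow, toHom_gen, conjRotation_pow_apply, block, Set.mem_ofPred_eq]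
  constructor
  · rintro ⟨j, -, rfl⟩
    simp
  · intro hw
    refine ⟨((β i w).2 - (β i v).2).val, ZMod.val_lt _, ?_⟩
    rw [ZMod.natCast_zmod_val, add_sub_cancel, ← hw]
    simp

lemma actionHypergraph_toHom (β : Fin d → V ≃ Slot r k) :
    actionHypergraph (toHom β) = blockHypergraph β := by
  unfold actionHypergraph blockHypergraph
  congr 1
  ext e
  simp only [orbit_conjRotation]

lemma encard_block (β : Fin d → V ≃ Slot r k) (i : Fin d) (v : V) :
    (block β i v).encard = k := by
  have e : block β i v = (β i).symm '' (({(β i v).1} : Set (Fin r)) ×ˢ (Set.univ)) := by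
    ext w
    simp [block]
  rw [e, ((β i).symm.injective.injOn).encard_image, Set.encard_prod]
  simp [Set.encard_univ, ENat.card_eq_coe_fintype_card, ZMod.card]

/-- No row of the bijection is monochromatic. -/
def RowsProper (χ : V → Fin 2) (β : V ≃ Slot r k) : Prop :=
  ∀ a, ∃ b b', χ (β.symm (a, b)) ≠ χ (β.symm (a, b'))

/-- Rows always have `k` elements, so uniformity is automatic and only properness is at stake. -/
lemma toHom_mem_plantedHom_iff {n : ℕ} {χ : Fin n → Fin 2} (β : Fin d → Fin n ≃ Slot r k) :
    toHom β ∈ plantedHom k d χ ↔ ∀ i, RowsProper χ (β i) := by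
  simp only [plantedHom, Set.mem_ofPred_eq, actionHypergraph_toHom]
  have hU : IsUniform (blockHypergraph β) k := by
    rintro _ ⟨i, v, rfl⟩
    exact encard_block β i v
  rw [and_iff_right hU]
  constructor
  · intro h i a
    by_contra! hcon
    apply h (block β i ((β i).symm (a, 0))) ⟨i, _, rfl⟩
    rw [IsMonochromatic, Set.encard_eq_one]
    refine ⟨χ ((β i).symm (a, 0)), ?_⟩
    ext x
    simp only [Set.mem_image, Set.mem_singleton_iff]
    constructor
    · rintro ⟨w, hw, rfl⟩
      have hw' : (β i w).1 = a := by simpa [block] using hw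
      have := hcon (β i w).2 0
      rw [← hw'] at this ⊢
      simpa using this
    · rintro rfl
      exact ⟨_, mem_block_self _ _, rfl⟩
  · rintro h _ ⟨i, v, rfl⟩ hm
    rw [IsMonochromatic, Set.encard_eq_one] at hm
    obtain ⟨x, hx⟩ := hm
    obtain ⟨b, b', hb⟩ := h i (β i v).1
    have h1 : ∀ b, χ ((β i).symm ((β i v).1, b)) = x := by
      intro b
      have : χ ((β i).symm ((β i v).1, b)) ∈ χ '' block β i v :=
        ⟨_, by simp [block], rfl⟩
      rw [hx] at this
      exact this
    exact hb ((h1 b).trans (h1 b').symm)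

/-- A reference rotation has the same cycle type as `g`; the conjugating permutation relabels the
slots. -/
lemma exists_conjRotation_eq [Fintype V] (hk : 2 ≤ k) (hV : Fintype.card V = r * k)
    {g : Equiv.Perm V} (hg : g ^ k = 1)
    (hinj : ∀ v, Set.InjOn (fun j => (g ^ j) v) {j | j < k}) :
    ∃ β : V ≃ Slot r k, conjRotation β = g := by
  classical
  obtain ⟨β₀⟩ : Nonempty (V ≃ Slot r k) := by
    apply Fintype.card_eq.1
    simp [hV, ZMod.card]
  have h0 : ∀ v, Set.InjOn (fun j => (conjRotation β₀ ^ j) v) {j | j < k} := by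
    intro v a ha b hb hab
    simp only [conjRotation_pow_apply, EmbeddingLike.apply_eq_iff_eq, Prod.mk.injEq,
      add_right_inj, true_and] at hab
    rw [ZMod.natCast_eq_natCast_iff'] at hab
    rwa [Nat.mod_eq_of_lt ha, Nat.mod_eq_of_lt hb] at hab
  have hconj : IsConj g (conjRotation β₀) := by
    rw [Equiv.Perm.isConj_iff_cycleType_eq, cycleType_eq_replicate hk hg hinj,
      cycleType_eq_replicate hk (conjRotation_pow β₀) h0]
  obtain ⟨c, hc⟩ := isConj_iff.1 hconj
  refine ⟨c.trans β₀, ?_⟩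
  have e : conjRotation (c.trans β₀) = c⁻¹ * conjRotation β₀ * c := by
    ext v
    simp [conjRotation]
  rw [e, ← hc]
  group

lemma exists_toHom_eq {n : ℕ} (hk : 2 ≤ k) (hn : n = r * k) {χ : Fin n → Fin 2}
    {σ : Gam k d →* Equiv.Perm (Fin n)} (hσ : σ ∈ plantedHom k d χ) :
    ∃ β : Fin d → Fin n ≃ Slot r k, toHom β = σ := by
  classical
  have h : ∀ i, ∃ β : Fin n ≃ Slot r k, conjRotation β = σ (gen k d i) := by
    intro i
    refine exists_conjRotation_eq hk (by simp [hn]) ?_ ?_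
    · rw [← map_pow, gen_pow, map_one]
    · intro v
      have h1 := hσ.1 _ ⟨i, v, rfl⟩
      have e : {w | ∃ j < k, w = σ (gen k d i ^ j) v} =
          (((Finset.range k).image fun j => (σ (gen k d i) ^ j) v : Finset (Fin n)) :
            Set (Fin n)) := by
        ext w
        simp only [Set.mem_ofPred_eq, Finset.coe_image, Set.mem_image, Finset.mem_coe,
          Finset.mem_range, map_pow]
        exact ⟨fun ⟨j, h1, h2⟩ => ⟨j, h1, h2.symm⟩, fun ⟨j, h1, h2⟩ => ⟨j, h1, h2.symm⟩⟩
      rw [e, Set.encard_coe_eq_coe_finsetCard] at h1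
      have h2 : #((Finset.range k).image fun j => (σ (gen k d i) ^ j) v) = #(Finset.range k) := by
        rw [Finset.card_range]
        exact_mod_cast h1
      have h3 := Finset.card_image_iff.1 h2
      intro a ha b hb hab
      exact h3 (by simpa using ha) (by simpa using hb) hab
  choose β hβ using h
  exact ⟨β, hom_ext fun i => by rw [toHom_gen, hβ]⟩

open Classical in
-- Two families induce the same homomorphism exactly when they differ by slot permutations commuting
-- with the rotation. All fibers therefore have the size of this centralizer, and uniform families
-- induce uniform homomorphisms.
lemma card_fiber_toHom [Fintype V] (β₀ : Fin d → V ≃ Slot r k) :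
    #{β : Fin d → V ≃ Slot r k | toHom β = toHom β₀} =
      #{γ : Fin d → Equiv.Perm (Slot r k) | ∀ i, Commute (γ i) (rotation r k)} := by
  have hiff : ∀ β : Fin d → V ≃ Slot r k, toHom β = toHom β₀ ↔
      ∀ i, Commute ((β₀ i).symm.trans (β i)) (rotation r k) := by
    intro β
    have h1 : toHom β = toHom β₀ ↔ ∀ i, conjRotation (β i) = conjRotation (β₀ i) := by
      constructor
      · intro h i
        rw [← toHom_gen, h, toHom_gen]
      · intro h
        exact hom_ext fun i => by rw [toHom_gen, toHom_gen, h]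
    rw [h1]
    refine forall_congr' fun i => ?_
    constructor
    · intro h
      ext1 s
      have := congrArg (fun g : Equiv.Perm V => β i (g ((β₀ i).symm s))) h
      simpa [conjRotation] using this.symm
    · intro h
      ext1 v
      have := congrArg (fun g : Equiv.Perm (Slot r k) => (β i).symm (g (β₀ i v))) h
      simpa [conjRotation] using this.symm
  refine Finset.card_bij' (fun β _ i => (β₀ i).symm.trans (β i))
    (fun γ _ i => (β₀ i).trans (γ i)) ?_ ?_ ?_ ?_
  · intro β hβ
    simp only [Finset.mem_filter, Finset.mem_univ, true_and] at hβ ⊢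
    exact (hiff β).1 hβ
  · intro γ hγ
    simp only [Finset.mem_filter, Finset.mem_univ, true_and] at hγ ⊢
    rw [hiff]
    intro i
    have e : (β₀ i).symm.trans ((β₀ i).trans (γ i)) = γ i := by ext1 s; simp
    rw [e]
    exact hγ i
  · intro β _; funext i; ext1 v; simp
  · intro γ _; funext i; ext1 v; simp

open Classical in
/-- An event that is rare among the families of bijections with proper rows is rare in the
planted model. -/
lemma plantedMeasure_le {n : ℕ} (hk : 2 ≤ k) (hn : n = r * k) {χ : Fin n → Fin 2}
    (E : Set (Gam k d →* Equiv.Perm (Fin n))) {τ : ℝ}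
    (hpos : 0 < #{β : Fin d → Fin n ≃ Slot r k | ∀ i, RowsProper χ (β i)})
    (hE : (#{β : Fin d → Fin n ≃ Slot r k | (∀ i, RowsProper χ (β i)) ∧ toHom β ∈ E} : ℝ) ≤
      τ * #{β : Fin d → Fin n ≃ Slot r k | ∀ i, RowsProper χ (β i)}) :
    (plantedHom k d χ).Nonempty ∧ plantedMeasure k d χ E ≤ ENNReal.ofReal τ := by
  have : Fintype (Gam k d →* Equiv.Perm (Fin n)) := Fintype.ofFinite _
  set K := #{γ : Fin d → Equiv.Perm (Slot r k) | ∀ i, Commute (γ i) (rotation r k)} with hK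
  have hKpos : 0 < K := by
    apply Finset.card_pos.2
    exact ⟨fun _ => 1, by simp [Commute.one_left]⟩
  set P : Finset (Gam k d →* Equiv.Perm (Fin n)) := {σ | σ ∈ plantedHom k d χ} with hP
  have hcount : ∀ F : Set (Gam k d →* Equiv.Perm (Fin n)),
      #{β : Fin d → Fin n ≃ Slot r k | (∀ i, RowsProper χ (β i)) ∧ toHom β ∈ F} =
        #{σ ∈ P | σ ∈ F} * K := by
    intro F
    rw [Finset.card_eq_sum_card_fiberwise (f := toHom) (t := {σ ∈ P | σ ∈ F})]
    · rw [← smul_eq_mul, ← Finset.sum_const]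
      refine Finset.sum_congr rfl fun σ hσ => ?_
      simp only [hP, Finset.mem_filter, Finset.mem_univ, true_and] at hσ
      obtain ⟨β₀, rfl⟩ := exists_toHom_eq hk hn hσ.1
      rw [hK, ← card_fiber_toHom β₀, Finset.filter_filter]
      congr 1
      ext β
      simp only [Finset.mem_filter, Finset.mem_univ, true_and]
      constructor
      · exact fun h => h.2
      · intro h
        refine ⟨⟨(toHom_mem_plantedHom_iff β).1 ?_, ?_⟩, h⟩
        · rw [h]; exact hσ.1
        · rw [h]; exact hσ.2
    · intro β hβ
      simp only [hP, Finset.coe_filter, Finset.mem_filter, Finset.mem_univ, true_and,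
        Set.mem_ofPred_eq] at hβ ⊢
      exact ⟨(toHom_mem_plantedHom_iff β).2 hβ.1, hβ.2⟩
  have hcard : #{β : Fin d → Fin n ≃ Slot r k | ∀ i, RowsProper χ (β i)} = #P * K := by
    have := hcount Set.univ
    simpa using this
  rw [hcard] at hpos hE
  rw [hcount] at hE
  have hPpos : 0 < #P := Nat.pos_of_mul_pos_right hpos
  have hPE : (#{σ ∈ P | σ ∈ E} : ℝ) ≤ τ * #P := by
    have hK0 : (0 : ℝ) < K := by exact_mod_cast hKpos
    push_cast at hE
    rw [← mul_assoc] at hE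
    exact le_of_mul_le_mul_right hE hK0
  have hPcoe : plantedHom k d χ = (P : Set _) := by ext σ; simp [hP]
  constructor
  · obtain ⟨σ, hσ⟩ := Finset.card_pos.1 hPpos
    exact ⟨σ, by rw [hPcoe]; exact hσ⟩
  · have hinter : plantedHom k d χ ∩ E = (({σ ∈ P | σ ∈ E} : Finset _) : Set _) := by
      ext σ; simp [hP]
    have hm : ∀ s : Set (Gam k d →* Equiv.Perm (Fin n)), MeasurableSet s := fun _ => trivial
    rw [plantedMeasure, ProbabilityTheory.uniformOn, ProbabilityTheory.cond_apply (hm _), hinter,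
      hPcoe, MeasureTheory.Measure.count_apply (hm _), MeasureTheory.Measure.count_apply (hm _),
      Set.encard_coe_eq_coe_finsetCard, Set.encard_coe_eq_coe_finsetCard]
    simp only [ENat.toENNReal_coe]
    have hne : (#P : ENNReal) ≠ 0 := by exact_mod_cast hPpos.ne'
    rw [← ENNReal.div_eq_inv_mul, ENNReal.div_le_iff hne (ENNReal.natCast_ne_top _)]
    have hτ : 0 ≤ τ := by
      by_contra! hneg
      have h1 : (0 : ℝ) < #P := by exact_mod_cast hPpos
      have h2 : (0 : ℝ) ≤ #{σ ∈ P | σ ∈ E} := Nat.cast_nonneg _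
      nlinarith
    rw [← ENNReal.ofReal_natCast, ← ENNReal.ofReal_natCast, ← ENNReal.ofReal_mul hτ]
    exact ENNReal.ofReal_le_ofReal hPE

end Rotation

/-! ### Conditioning on the colors of the slots -/

section Conditioning

variable {V : Type} [Fintype V] {r k d : ℕ} [NeZero k]

/-- The colors of the slots. -/
def slotColors (χ : V → Fin 2) (β : V ≃ Slot r k) : Slot r k → Fin 2 := fun s => χ (β.symm s)

lemma mem_placements_iff {χ : V → Fin 2} {c : Fin d → Slot r k → Fin 2}
    {β : Fin d → V ≃ Slot r k} :
    β ∈ placements χ c ↔ ∀ i, slotColors χ (β i) = c i := by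
  rw [mem_placements]
  refine forall_congr' fun i => ⟨fun h => ?_, fun h v => ?_⟩
  · funext s
    rw [slotColors, ← h, Equiv.apply_symm_apply]
  · rw [← h, slotColors, Equiv.symm_apply_apply]

open Classical in
lemma card_slotColors_eq {χ : V → Fin 2} {h : ℕ} (hχ : ∀ a, Fintype.card {x // χ x = a} = h)
    {c : Slot r k → Fin 2} (hc : ∀ a, Fintype.card {s // c s = a} = h) :
    ∃ β : V ≃ Slot r k, slotColors χ β = c := by
  have e : ∀ a, Nonempty ({x // χ x = a} ≃ {s // c s = a}) :=
    fun a => Fintype.card_eq.1 ((hχ a).trans (hc a).symm)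
  refine ⟨Equiv.ofFiberEquiv fun a => (e a).some, ?_⟩
  funext s
  have := Equiv.ofFiberEquiv_map (fun a => (e a).some)
    ((Equiv.ofFiberEquiv fun a => (e a).some).symm s)
  rw [Equiv.apply_symm_apply] at this
  exact this.symm

open Classical in
-- Arrays with equal color counts differ by a permutation of the slots, and composition with it
-- matches the fibers.
lemma card_fiber_slotColors {χ : V → Fin 2} {h : ℕ} {c c' : Slot r k → Fin 2}
    (hc : ∀ a, Fintype.card {s // c s = a} = h) (hc' : ∀ a, Fintype.card {s // c' s = a} = h) :
    #{β : V ≃ Slot r k | slotColors χ β = c} = #{β : V ≃ Slot r k | slotColors χ β = c'} := by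
  have e : ∀ a, Nonempty ({s // c s = a} ≃ {s // c' s = a}) :=
    fun a => Fintype.card_eq.1 ((hc a).trans (hc' a).symm)
  set τ : Slot r k ≃ Slot r k := Equiv.ofFiberEquiv fun a => (e a).some
  have hτ : ∀ s, c' (τ s) = c s := Equiv.ofFiberEquiv_map _
  have hτ' : ∀ s, c (τ.symm s) = c' s := fun s => by rw [← hτ, Equiv.apply_symm_apply]
  refine Finset.card_bij' (fun β _ => β.trans τ) (fun β _ => β.trans τ.symm) ?_ ?_ ?_ ?_
  · intro β hβ
    simp only [Finset.mem_filter, Finset.mem_univ, true_and] at hβ ⊢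
    funext s
    rw [← hτ', ← hβ]
    rfl
  · intro β hβ
    simp only [Finset.mem_filter, Finset.mem_univ, true_and] at hβ ⊢
    funext s
    rw [← hτ, ← hβ]
    rfl
  · intro β _; ext1 v; simp
  · intro β _; ext1 v; simp

open Classical in
lemma card_color_of_mem_properArrays {h : ℕ} (hr : r * k = 2 * h) {c : Slot r k → Fin 2}
    (hc : c ∈ properArrays r k) (a : Fin 2) : Fintype.card {s // c s = a} = h := by
  have h1 := (Finset.mem_filter.1 hc).2.2
  have h2 : #{s | c s = 0} + #{s | c s = 1} = r * k := by
    have h3 : ∀ x : Fin 2, x = 1 ↔ ¬ x = 0 := by decide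
    simp only [h3]
    rw [Finset.card_filter_add_card_filter_not, Finset.card_univ]
    simp [ZMod.card]
  rw [Fintype.card_subtype]
  fin_cases a
  · simp only [Fin.zero_eta]; omega
  · simp only [Fin.mk_one]; omega

open Classical in
lemma rowsProper_iff {χ : V → Fin 2} {h : ℕ} (hχ : ∀ a, Fintype.card {x // χ x = a} = h)
    (β : V ≃ Slot r k) : RowsProper χ β ↔ slotColors χ β ∈ properArrays r k := by
  simp only [properArrays, Finset.mem_filter, Finset.mem_univ, true_and]
  refine (and_iff_left ?_).symm
  have h1 : ∀ a, #{s | slotColors χ β s = a} = h := by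
    intro a
    rw [← hχ a, Fintype.card_subtype]
    refine Finset.card_bij' (fun s _ => β.symm s) (fun x _ => β x) ?_ ?_ ?_ ?_
    · intro s hs
      simp only [Finset.mem_filter, Finset.mem_univ, true_and] at hs ⊢
      exact hs
    · intro x hx
      refine Finset.mem_filter.2 ⟨Finset.mem_univ _, ?_⟩
      rw [slotColors, Equiv.symm_apply_apply]
      exact (Finset.mem_filter.1 hx).2
    · intro s _; simp
    · intro x _; simp
  rw [h1, h1]

open Classical in
-- Here `F` is the common fiber size: the slot colors of a uniform bijection with proper rows are
-- uniform on `properArrays`. This transfers the rarity of atypical arrays to bijections.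
lemma card_filter_slotColors {χ : V → Fin 2} {h : ℕ} (hr : r * k = 2 * h)
    (hχ : ∀ a, Fintype.card {x // χ x = a} = h) :
    ∃ F : ℕ, 0 < F ∧ ∀ Q : (Slot r k → Fin 2) → Prop,
      #{β : V ≃ Slot r k | RowsProper χ β ∧ Q (slotColors χ β)} =
        #{c ∈ properArrays r k | Q c} * F := by
  by_cases hne : (properArrays r k).Nonempty
  · obtain ⟨c₀, hc₀⟩ := hne
    refine ⟨#{β : V ≃ Slot r k | slotColors χ β = c₀}, ?_, fun Q => ?_⟩
    · obtain ⟨β, hβ⟩ := card_slotColors_eq hχ (card_color_of_mem_properArrays hr hc₀)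
      exact Finset.card_pos.2 ⟨β, by simp [hβ]⟩
    · rw [Finset.card_eq_sum_card_fiberwise (f := slotColors χ) (t := {c ∈ properArrays r k | Q c})]
      · rw [← smul_eq_mul, ← Finset.sum_const]
        refine Finset.sum_congr rfl fun c hc => ?_
        obtain ⟨hc1, hc2⟩ := Finset.mem_filter.1 hc
        rw [← card_fiber_slotColors (card_color_of_mem_properArrays hr hc1)
          (card_color_of_mem_properArrays hr hc₀), Finset.filter_filter]
        congr 1
        ext β
        simp only [Finset.mem_filter, Finset.mem_univ, true_and, rowsProper_iff hχ]
        constructor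
        · exact fun h => h.2
        · rintro rfl
          exact ⟨⟨hc1, hc2⟩, rfl⟩
      · intro β hβ
        simp only [Finset.coe_filter, Finset.mem_univ, true_and, Set.mem_ofPred_eq,
          rowsProper_iff hχ] at hβ ⊢
        exact hβ
  · rw [Finset.not_nonempty_iff_eq_empty] at hne
    refine ⟨1, one_pos, fun Q => ?_⟩
    simp [rowsProper_iff hχ, hne]

lemma card_piFinset_filter_mul {X : Type*} [DecidableEq X] (B : Finset X) (Q : X → Prop)
    [DecidablePred Q] (i : Fin d) :
    #{β ∈ Fintype.piFinset fun _ : Fin d => B | Q (β i)} * #B =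
      #{x ∈ B | Q x} * #(Fintype.piFinset fun _ : Fin d => B) := by
  have e : ({β ∈ Fintype.piFinset fun _ : Fin d => B | Q (β i)} : Finset _) =
      Fintype.piFinset fun j => if j = i then {x ∈ B | Q x} else B := by
    ext β
    simp only [Finset.mem_filter, Fintype.mem_piFinset]
    constructor
    · rintro ⟨h1, h2⟩ j
      split_ifs with hj
      · subst hj; exact Finset.mem_filter.2 ⟨h1 _, h2⟩
      · exact h1 j
    · intro h
      have hi := h i
      rw [if_pos rfl, Finset.mem_filter] at hi
      refine ⟨fun j => ?_, hi.2⟩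
      by_cases hj : j = i
      · subst hj; exact hi.1
      · simpa [hj] using h j
  rw [e, Fintype.card_piFinset, Fintype.card_piFinset,
    ← Finset.mul_prod_erase Finset.univ _ (Finset.mem_univ i),
    ← Finset.mul_prod_erase Finset.univ (fun _ : Fin d => #B) (Finset.mem_univ i), if_pos rfl]
  have : ∏ j ∈ Finset.univ.erase i, #(if j = i then {x ∈ B | Q x} else B) =
      ∏ j ∈ Finset.univ.erase i, #B :=
    Finset.prod_congr rfl fun j hj => by rw [if_neg (Finset.ne_of_mem_erase hj)]
  rw [this]
  ring

open Classical in
/-- To show that an event is rare it suffices to consider typical color arrays. -/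
lemma card_rowsProper_filter_le {χ : V → Fin 2} {h : ℕ} (hr : r * k = 2 * h)
    (hχ : ∀ a, Fintype.card {x // χ x = a} = h) (Q : (Slot r k → Fin 2) → Prop) {τ τ' : ℝ}
    (hτ' : 0 ≤ τ')
    (hpos : 0 < #(properArrays r k))
    (hQ : (#{c ∈ properArrays r k | ¬ Q c} : ℝ) ≤ τ * #(properArrays r k))
    (E : (Fin d → V ≃ Slot r k) → Prop)
    (hE : ∀ c : Fin d → Slot r k → Fin 2, (∀ i, c i ∈ properArrays r k) → (∀ i, Q (c i)) →
      (#{β ∈ placements χ c | E β} : ℝ) ≤ τ' * #(placements χ c)) :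
    0 < #{β : Fin d → V ≃ Slot r k | ∀ i, RowsProper χ (β i)} ∧
    (#{β : Fin d → V ≃ Slot r k | (∀ i, RowsProper χ (β i)) ∧ E β} : ℝ) ≤
      (d * τ + τ') * #{β : Fin d → V ≃ Slot r k | ∀ i, RowsProper χ (β i)} := by
  obtain ⟨F, hF, hcount⟩ := card_filter_slotColors hr hχ
  set B : Finset (V ≃ Slot r k) := {β | RowsProper χ β} with hB
  have hBc : #B = #(properArrays r k) * F := by
    have := hcount fun _ => True
    simpa [hB] using this
  have hBpos : 0 < #B := by rw [hBc]; positivity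
  have hpi : ({β : Fin d → V ≃ Slot r k | ∀ i, RowsProper χ (β i)} : Finset _) =
      Fintype.piFinset fun _ => B := by
    ext β
    simp [hB]
  rw [hpi]
  have hpipos : 0 < #(Fintype.piFinset fun _ : Fin d => B) := by
    rw [Fintype.card_piFinset]
    exact Finset.prod_pos fun _ _ => hBpos
  refine ⟨hpipos, ?_⟩
  have hatyp : ∀ i : Fin d,
      (#{β ∈ Fintype.piFinset fun _ : Fin d => B | ¬ Q (slotColors χ (β i))} : ℝ) ≤
        τ * #(Fintype.piFinset fun _ : Fin d => B) := by
    intro i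
    have h1 := card_piFinset_filter_mul B (fun x => ¬ Q (slotColors χ x)) i
    have h2 : (#{x ∈ B | ¬ Q (slotColors χ x)} : ℝ) ≤ τ * #B := by
      have h3 : #{x ∈ B | ¬ Q (slotColors χ x)} = #{c ∈ properArrays r k | ¬ Q c} * F := by
        rw [hB, Finset.filter_filter]
        convert hcount fun c => ¬ Q c
      rw [h3, hBc]
      push_cast
      rw [← mul_assoc]
      gcongr
    have hB0 : (0 : ℝ) < #B := by exact_mod_cast hBpos
    refine le_of_mul_le_mul_right ?_ hB0
    calc _ = (#{x ∈ B | ¬ Q (slotColors χ x)} : ℝ) * #(Fintype.piFinset fun _ : Fin d => B) := by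
          exact_mod_cast h1
      _ ≤ (τ * #B) * #(Fintype.piFinset fun _ : Fin d => B) := by gcongr
      _ = _ := by ring
  set C : Finset (Fin d → Slot r k → Fin 2) :=
    Fintype.piFinset fun _ => {c ∈ properArrays r k | Q c} with hC
  have hCmem : ∀ c ∈ C, (∀ i, c i ∈ properArrays r k) ∧ ∀ i, Q (c i) := by
    intro c hc
    rw [hC, Fintype.mem_piFinset] at hc
    exact ⟨fun i => (Finset.mem_filter.1 (hc i)).1, fun i => (Finset.mem_filter.1 (hc i)).2⟩
  -- Either some array is atypical, or the family is a placement for typical color arrays.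
  have hsub : ({β : Fin d → V ≃ Slot r k | (∀ i, RowsProper χ (β i)) ∧ E β} : Finset _) ⊆
      (Finset.univ.biUnion fun i =>
        {β ∈ Fintype.piFinset fun _ : Fin d => B | ¬ Q (slotColors χ (β i))}) ∪
      C.biUnion fun c => {β ∈ placements χ c | E β} := by
    intro β hβ
    obtain ⟨h1, h2⟩ := (Finset.mem_filter.1 hβ).2
    by_cases hq : ∀ i, Q (slotColors χ (β i))
    · refine Finset.mem_union_right _ (Finset.mem_biUnion.2
        ⟨fun i => slotColors χ (β i), ?_, Finset.mem_filter.2 ⟨?_, h2⟩⟩)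
      · rw [hC, Fintype.mem_piFinset]
        exact fun i => Finset.mem_filter.2 ⟨(rowsProper_iff hχ _).1 (h1 i), hq i⟩
      · exact mem_placements_iff.2 fun i => rfl
    · push Not at hq
      obtain ⟨i, hi⟩ := hq
      refine Finset.mem_union_left _ (Finset.mem_biUnion.2 ⟨i, Finset.mem_univ _,
        Finset.mem_filter.2 ⟨?_, hi⟩⟩)
      rw [Fintype.mem_piFinset]
      exact fun j => Finset.mem_filter.2 ⟨Finset.mem_univ _, h1 j⟩
  have hsumC : ∑ c ∈ C, #(placements χ c) ≤ #(Fintype.piFinset fun _ : Fin d => B) := by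
    rw [← Finset.card_biUnion]
    · refine Finset.card_le_card fun β hβ => ?_
      obtain ⟨c, hc, hβc⟩ := Finset.mem_biUnion.1 hβ
      rw [mem_placements_iff] at hβc
      rw [Fintype.mem_piFinset]
      intro i
      refine Finset.mem_filter.2 ⟨Finset.mem_univ _, (rowsProper_iff hχ _).2 ?_⟩
      rw [hβc i]
      exact (hCmem c hc).1 i
    · intro c _ c' _ hcc'
      rw [Function.onFun, Finset.disjoint_left]
      intro β h1 h2
      rw [mem_placements_iff] at h1 h2
      exact hcc' (funext fun i => (h1 i).symm.trans (h2 i))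
  have hcard := (Finset.card_le_card hsub).trans ((Finset.card_union_le _ _).trans
    (add_le_add Finset.card_biUnion_le Finset.card_biUnion_le))
  have hcard' : (#{β : Fin d → V ≃ Slot r k | (∀ i, RowsProper χ (β i)) ∧ E β} : ℝ) ≤
      (∑ i, (#{β ∈ Fintype.piFinset fun _ : Fin d => B | ¬ Q (slotColors χ (β i))} : ℝ)) +
      ∑ c ∈ C, (#{β ∈ placements χ c | E β} : ℝ) := by exact_mod_cast hcard
  refine hcard'.trans ?_
  rw [add_mul]
  refine add_le_add ?_ ?_
  · refine (Finset.sum_le_sum fun i _ => hatyp i).trans (le_of_eq ?_)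
    simp
    ring
  · calc _ ≤ ∑ c ∈ C, τ' * (#(placements χ c) : ℝ) :=
          Finset.sum_le_sum fun c hc => hE c (hCmem c hc).1 (hCmem c hc).2
      _ = τ' * ((∑ c ∈ C, #(placements χ c) : ℕ) : ℝ) := by
          rw [← Finset.mul_sum]; push_cast; rfl
      _ ≤ _ := by
          gcongr

end Conditioning

/-! ### Rarity of many uncovered vertices for typical colors -/

section Typical

lemma tendsto_div_sub_pow (m d : ℕ) :
    Tendsto (fun h : ℕ => ((h : ℝ) / ((h - m : ℕ) : ℝ)) ^ d) atTop (𝓝 1) := by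
  have h1 : Tendsto (fun h : ℕ => (1 - (m : ℝ) / h)⁻¹) atTop (𝓝 1) := by
    have h2 : Tendsto (fun h : ℕ => (m : ℝ) / h) atTop (𝓝 0) :=
      tendsto_const_div_atTop_nhds_zero_nat (m : ℝ)
    simpa using (h2.const_sub 1).inv₀ (by norm_num)
  have h3 : Tendsto (fun h : ℕ => (h : ℝ) / ((h - m : ℕ) : ℝ)) atTop (𝓝 1) := by
    refine h1.congr' ?_
    filter_upwards [eventually_gt_atTop m] with h hm
    rw [Nat.cast_sub hm.le]
    have h4 : (h : ℝ) ≠ 0 := by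
      have : 0 < h := by omega
      positivity
    have h5 : (h : ℝ) - m ≠ 0 := by
      have : (m : ℝ) < h := by exact_mod_cast hm
      linarith
    field_simp
  simpa using h3.pow d

variable {V : Type} [Fintype V] {r k d : ℕ} [NeZero k] {χ : V → Fin 2}
  {c : Fin d → Slot r k → Fin 2} {h : ℕ}

open Classical in
-- In the bound for few support slots, `exp 3` collects the `exp 1` of `numChoices_lowSet_mul_le`
-- and the factors `exp (ε * lam)` and `exp (lam / k)`, each at most `e`. In the number of links, `8
-- * lam * k` arises from `d` arrays with at most `4 * ρ₀ * h` support slots each, `k` partners and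
-- two orientations.
lemma weightBounds_of_typical (hk : 3 ≤ k) {m : ℕ} (hm : m < h) {ρ₀ ε lam : ℝ} (hρ₀ : 0 < ρ₀)
    (hρ₁ : ρ₀ ≤ 1) (hε0 : 0 ≤ ε) (hε : ε ≤ 1) (hlam : lam = d * ρ₀) (hlamk : lam ≤ k)
    (hεlam : ε * lam ≤ 1)
    (hr : r * k = 2 * h) (hχ : ∀ a, Fintype.card {x // χ x = a} = h)
    (hc : ∀ i, c i ∈ properArrays r k)
    (htyp : ∀ i, IsTypical (ρ₀ * k / 2) ε (c i)) :
    WeightBounds χ c h (((h - m : ℕ) : ℝ) ^ d) (((h : ℝ) / ((h - m : ℕ) : ℝ)) ^ d)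
      (Real.exp 3 * k ^ 3 * Real.exp (-lam))
      ((((h : ℝ) / ((h - m : ℕ) : ℝ)) ^ d) * (Real.exp (ε * lam) * Real.exp (-lam)))
      (8 * lam * k) := by
  have hsub : 0 < h - m := by omega
  have hsub' : (0 : ℝ) < ((h - m : ℕ) : ℝ) := by exact_mod_cast hsub
  have hh : 0 < h := by omega
  have hh' : (0 : ℝ) < h := by exact_mod_cast hh
  have hD : (0 : ℝ) < ((h - m : ℕ) : ℝ) ^ d := by positivity
  have hpow : (h : ℝ) ^ d = ((h : ℝ) / ((h - m : ℕ) : ℝ)) ^ d * ((h - m : ℕ) : ℝ) ^ d := by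
    rw [← mul_pow, div_mul_cancel₀ _ hsub'.ne']
  have hlam0 : 0 ≤ lam := by rw [hlam]; positivity
  have hk0 : (0 : ℝ) < k := by positivity
  have hcard : ∀ i a, Fintype.card {s // c i s = a} = h :=
    fun i a => card_color_of_mem_properArrays hr (hc i) a
  have hpr : ρ₀ * k / 2 * r = ρ₀ * h := by
    have : (r : ℝ) * k = 2 * h := by exact_mod_cast hr
    linear_combination ρ₀ / 2 * this
  have hncard : ∀ i a, (({s | c i s = a ∧ IsSupportSlot (c i) s} : Set (Slot r k)).ncard : ℝ) =
      #{s | c i s = a ∧ IsSupportSlot (c i) s} := by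
    intro i a
    rw [← Set.ncard_coe_finset, Finset.coe_filter]
    simp
  have hlow : ∀ i a, ((1 - ε) * ρ₀) * h ≤ #{s | c i s = a ∧ IsSupportSlot (c i) s} := by
    intro i a
    have := (htyp i a).1
    rw [hncard, hpr] at this
    linarith
  have hup : ∀ i a, (#{s | c i s = a ∧ IsSupportSlot (c i) s} : ℝ) ≤ 2 * ρ₀ * h := by
    intro i a
    have := (htyp i a).2
    rw [hncard, hpr] at this
    have h2 : 0 ≤ ρ₀ * h := by positivity
    nlinarith
  have hsup : ∀ i, (#{s | IsSupportSlot (c i) s} : ℝ) ≤ 4 * ρ₀ * h := by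
    intro i
    have e : ({s | IsSupportSlot (c i) s} : Finset (Slot r k)) ⊆
        ({s | c i s = 0 ∧ IsSupportSlot (c i) s} : Finset (Slot r k)) ∪
          ({s | c i s = 1 ∧ IsSupportSlot (c i) s} : Finset (Slot r k)) := by
      intro s hs
      have hs' := (Finset.mem_filter.1 hs).2
      have h01 : ∀ x : Fin 2, x = 0 ∨ x = 1 := by decide
      rcases h01 (c i s) with h0 | h0
      · exact Finset.mem_union_left _ (Finset.mem_filter.2 ⟨Finset.mem_univ _, h0, hs'⟩)
      · exact Finset.mem_union_right _ (Finset.mem_filter.2 ⟨Finset.mem_univ _, h0, hs'⟩)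
    have h1 := (Finset.card_le_card e).trans (Finset.card_union_le _ _)
    have h2 : (#{s | IsSupportSlot (c i) s} : ℝ) ≤
        (#{s | c i s = 0 ∧ IsSupportSlot (c i) s} : ℝ) +
          #{s | c i s = 1 ∧ IsSupportSlot (c i) s} := by exact_mod_cast h1
    linarith [hup i 0, hup i 1]
  have hρ1 : (1 - ε) * ρ₀ ≤ 1 := by nlinarith
  have hρ0 : 0 ≤ (1 - ε) * ρ₀ := mul_nonneg (by linarith) hρ₀.le
  refine ⟨hh, hD, by positivity, by positivity, by positivity, hpow.le, fun i a => (hcard i a).le,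
    hχ, ?_, ?_, ?_⟩
  · intro x q
    have h1 := numChoices_lowSet_mul_le (χ := χ) hρ0 hρ1 hcard hlow x q
    rw [div_le_div_iff₀ hD hh']
    refine h1.trans ?_
    rw [hpow]
    have h2 : Real.exp 1 * k ^ 3 * Real.exp (-((1 - ε) * ρ₀ * (1 - 1 / k) * d)) ≤
        Real.exp 3 * k ^ 3 * Real.exp (-lam) := by
      rw [mul_right_comm, mul_right_comm (Real.exp 3), ← Real.exp_add, ← Real.exp_add]
      refine mul_le_mul_of_nonneg_right (Real.exp_le_exp.2 ?_) (by positivity)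
      have e : (1 - ε) * ρ₀ * (1 - 1 / k) * d = lam - ε * lam - lam / k + ε * lam / k := by
        rw [hlam]; ring
      have h3 : lam / k ≤ 1 := by rw [div_le_one hk0]; exact hlamk
      have h4 : 0 ≤ ε * lam / k := by positivity
      rw [e]
      linarith
    calc _ ≤ ((h : ℝ) / ((h - m : ℕ) : ℝ)) ^ d * ((h - m : ℕ) : ℝ) ^ d *
          (Real.exp 3 * k ^ 3 * Real.exp (-lam)) := by gcongr
      _ = _ := by ring
  · intro x
    have h1 := numChoices_isolatedSet_le (χ := χ) hcard hlow x
    rw [div_le_iff₀ hD]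
    refine h1.trans (le_of_eq ?_)
    rw [hpow, ← Real.exp_add]
    have : -((1 - ε) * ρ₀ * d) = ε * lam + -lam := by rw [hlam]; ring
    rw [this]
    ring
  · intro a
    have h1 := card_linked_le hsup
    calc ∑ e, linkInd c e a ≤ ∑ e, if Linked c e then (1 : ℝ) else 0 := by
          refine Finset.sum_le_sum fun e _ => ?_
          unfold linkInd
          split_ifs with h2 h3 h3
          · exact le_rfl
          · exact absurd h2.1 h3
          · exact zero_le_one
          · exact le_rfl
      _ = #{e : Fin d × Slot r k × Slot r k | Linked c e} := by simp
      _ ≤ 2 * (d * (4 * ρ₀ * h) * k) := h1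
      _ = 8 * lam * k * h := by rw [hlam]; ring

/-- With `A = 4 P` and `θ ≤ 2` the three secondary terms are at most 32, 8 and 16 times `κ² P²`, in
total 56. -/
lemma witness_total_le {κ P θ Z δ e₀ : ℝ} (hκ : 1 ≤ κ) (hθ0 : 0 ≤ θ) (hθ : θ ≤ 2)
    (hZ : Z ≤ (1 + δ / 8) * e₀) (hsmall : 56 * κ ^ 2 * P ^ 2 ≤ δ / 8 * e₀) :
    Z + κ ^ 2 * θ * (4 * P) ^ 2 + κ * θ * P * (4 * P) + κ ^ 2 * θ ^ 2 * P * (4 * P) ≤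
      (1 + δ / 4) * e₀ := by
  have h1 : κ ^ 2 * θ * (4 * P) ^ 2 ≤ 32 * (κ ^ 2 * P ^ 2) := by
    have : 0 ≤ κ ^ 2 * P ^ 2 := by positivity
    nlinarith
  have h2 : κ * θ * P * (4 * P) ≤ 8 * (κ ^ 2 * P ^ 2) := by
    have e1 : κ ≤ κ ^ 2 := by nlinarith
    calc κ * θ * P * (4 * P) = 4 * (κ * θ) * P ^ 2 := by ring
      _ ≤ 4 * (κ ^ 2 * 2) * P ^ 2 := by gcongr
      _ = _ := by ring
  have h3 : κ ^ 2 * θ ^ 2 * P * (4 * P) ≤ 16 * (κ ^ 2 * P ^ 2) := by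
    have e1 : θ ^ 2 ≤ 4 := by nlinarith
    calc κ ^ 2 * θ ^ 2 * P * (4 * P) = 4 * (κ ^ 2 * θ ^ 2) * P ^ 2 := by ring
      _ ≤ 4 * (κ ^ 2 * 4) * P ^ 2 := by gcongr
      _ = _ := by ring
  linarith

open Classical in
/-- The number of vertices that are not covered. -/
noncomputable def uncoveredCount {V : Type} [Fintype V] (H : Hypergraph V) (χ : V → Fin 2)
    (l : ℕ) : ℕ := #{x | x ∉ covered H χ l}

set_option maxHeartbeats 1000000 in
open Classical in
-- The tolerance is split as follows. Witnesses have expected density at most `(1 + δ/4) e₀`, clean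
-- uncovered vertices are allowed `(1 + δ/2) e₀`, of which the greedy choice loses at most `δ/8 *
-- e₀`, and vertices that are not clean are allowed `δ/2 * e₀`. From `κ ≤ 8 k²` come the constants
-- `3584 = 56 * 64` and `1024 = 16 * 64`.
lemma eventually_card_bad_le (hk : 3 ≤ k) (l : ℕ) {ρ₀ ε lam δ τ : ℝ} (hδ : 0 < δ)
    (hρ₀ : 0 < ρ₀)
    (hρ₁ : ρ₀ ≤ 1) (hε0 : 0 ≤ ε) (hε : ε ≤ 1) (hlam : lam = d * ρ₀) (hlam1 : 1 ≤ lam)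
    (hlamk : lam ≤ k) (hεlam : ε * lam ≤ 1) (hεexp : Real.exp (ε * lam) ≤ 1 + δ / 16)
    (hsmall : 3584 * Real.exp 6 * k ^ 10 * Real.exp (-lam) ≤ δ / 8)
    (hcontr : 1024 * Real.exp 3 * k ^ 7 * Real.exp (-lam) ≤ 1) (hτ : 0 < τ) :
    ∀ᶠ h : ℕ in atTop, ∀ (V : Type) [Fintype V] (r : ℕ) (χ : V → Fin 2)
      (c : Fin d → Slot r k → Fin 2), r * k = 2 * h → (∀ a, Fintype.card {x // χ x = a} = h) →
      (∀ i, c i ∈ properArrays r k) → (∀ i, IsTypical (ρ₀ * k / 2) ε (c i)) →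
      (#{β ∈ placements χ c | 2 * h * ((1 + δ) * Real.exp (-lam)) ≤
        uncoveredCount (blockHypergraph β) χ l} : ℝ) ≤ τ * #(placements χ c) := by
  set e₀ : ℝ := Real.exp (-lam) with he₀
  have he₀pos : 0 < e₀ := Real.exp_pos _
  set M₁ : ℕ := 2 ^ (l + 2) with hM₁
  set M₂ : ℕ := 2 * l + 4 with hM₂
  set C₁ : ℕ := (d * k + 1) ^ (l + 2) with hC₁
  set C₂ : ℕ := (d * k + 1) ^ (l + 2 + M₂) with hC₂
  have hk0 : (0 : ℝ) < k := by
    have : 0 < k := by omega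
    exact_mod_cast this
  have hk1 : (1 : ℝ) ≤ k := by
    have : 1 ≤ k := by omega
    exact_mod_cast this
  -- The ratio of the expected density to the threshold after the greedy loss; `p` is then chosen to
  -- make `q ^ p` small.
  set q : ℝ := (1 + δ / 4) / (1 + 3 * δ / 8) with hq
  have hq0 : 0 ≤ q := by positivity
  have hq1 : q < 1 := by
    rw [hq, div_lt_one (by positivity)]
    linarith
  obtain ⟨p, hp⟩ := exists_pow_lt_of_lt_one (half_pos hτ) hq1
  -- Enough exposed vertices for `p` witnesses of length at most `M₁`, and also for one loop of
  -- length at most `M₂`.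
  set m : ℕ := p * M₁ + M₂ with hm
  set W₂ : ℝ := ∑ j : Fin M₂, (4 * (d : ℝ) * k * 2) ^ (j + 1 : ℕ) with hW₂
  have hratio := tendsto_div_sub_pow m d
  have ev1 := hratio.eventually (gt_mem_nhds (show (1 : ℝ) < 2 by norm_num))
  have ev2 : ∀ᶠ h : ℕ in atTop,
      ((h : ℝ) / ((h - m : ℕ) : ℝ)) ^ d * (1 + δ / 16) < 1 + δ / 8 := by
    have := hratio.mul_const (1 + δ / 16)
    rw [one_mul] at this
    exact this.eventually (gt_mem_nhds (by linarith))
  have ev3 : ∀ᶠ h : ℕ in atTop,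
      (C₁ * (p * M₁) : ℝ) ≤ 2 * h * (e₀ * (δ / 8)) := by
    have : Tendsto (fun h : ℕ => (h : ℝ) * (2 * (e₀ * (δ / 8)))) atTop atTop :=
      tendsto_natCast_atTop_atTop.atTop_mul_const (by positivity)
    filter_upwards [this.eventually_ge_atTop (C₁ * (p * M₁) : ℝ)] with h hh
    linarith
  have ev4 : ∀ᶠ h : ℕ in atTop,
      W₂ / (τ / 2) ≤ 2 * h * (e₀ * (δ / 2)) / C₂ := by
    have hC₂pos : (0 : ℝ) < C₂ := by positivity
    have : Tendsto (fun h : ℕ => (h : ℝ) * (2 * (e₀ * (δ / 2)) / C₂)) atTop atTop :=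
      tendsto_natCast_atTop_atTop.atTop_mul_const (by positivity)
    filter_upwards [this.eventually_ge_atTop (W₂ / (τ / 2))] with h hh
    refine hh.trans (le_of_eq ?_)
    ring
  filter_upwards [ev1, ev2, ev3, ev4, eventually_gt_atTop m] with h h1 h2 h3 h4 hmh V _ r χ c hr
    hχ hc htyp
  have hh' : (0 : ℝ) < h := by
    have : 0 < h := by omega
    exact_mod_cast this
  have B := weightBounds_of_typical hk hmh hρ₀ hρ₁ hε0 hε hlam hlamk hεlam hr hχ hc htyp
  set θ : ℝ := ((h : ℝ) / ((h - m : ℕ) : ℝ)) ^ d with hθ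
  set P : ℝ := Real.exp 3 * k ^ 3 * e₀ with hP
  set κ : ℝ := 8 * lam * k with hκ
  have hcard : ∀ i a, h ≤ #{s | c i s = a} := by
    intro i a
    rw [← card_color_of_mem_properArrays hr (hc i) a, Fintype.card_subtype]
  have hκ1 : 1 ≤ κ := by rw [hκ]; nlinarith
  have hκk : κ ≤ 8 * k ^ 2 := by rw [hκ]; nlinarith
  have hP0 : 0 ≤ P := by positivity
  have hκ2 : κ ^ 2 ≤ 64 * (k : ℝ) ^ 4 := by
    calc κ ^ 2 ≤ (8 * (k : ℝ) ^ 2) ^ 2 := by gcongr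
      _ = _ := by ring
  have hexp6 : Real.exp 3 ^ 2 = Real.exp 6 := by
    rw [← Real.exp_nat_mul]; norm_num
  -- As `θ ≤ 2`, the value `4 P` closes the tree recursion once `16 κ² P ≤ 1`.
  have hA : θ * (P + κ ^ 2 * (4 * P) ^ 2) ≤ 4 * P := by
    have e1 : 16 * κ ^ 2 * P ≤ 1 := by
      calc 16 * κ ^ 2 * P ≤ 16 * (64 * (k : ℝ) ^ 4) * P := by gcongr
        _ = 1024 * Real.exp 3 * k ^ 7 * e₀ := by rw [hP]; ring
        _ ≤ 1 := hcontr
    have e2 : κ ^ 2 * (4 * P) ^ 2 ≤ P := by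
      calc κ ^ 2 * (4 * P) ^ 2 = (16 * κ ^ 2 * P) * P := by ring
        _ ≤ 1 * P := by gcongr
        _ = P := one_mul P
    calc θ * (P + κ ^ 2 * (4 * P) ^ 2) ≤ 2 * (P + P) := by
          have := B.θ_nonneg
          gcongr
      _ = 4 * P := by ring
  have hsm : 56 * κ ^ 2 * P ^ 2 ≤ δ / 8 * e₀ := by
    calc 56 * κ ^ 2 * P ^ 2 ≤ 56 * (64 * (k : ℝ) ^ 4) * P ^ 2 := by gcongr
      _ = (3584 * Real.exp 6 * k ^ 10 * e₀) * e₀ := by rw [hP, ← hexp6]; ring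
      _ ≤ _ := by gcongr
  have hZ : θ * (Real.exp (ε * lam) * e₀) ≤ (1 + δ / 8) * e₀ := by
    calc θ * (Real.exp (ε * lam) * e₀) ≤ θ * ((1 + δ / 16) * e₀) := by
          have := B.θ_nonneg
          gcongr
      _ = (θ * (1 + δ / 16)) * e₀ := by ring
      _ ≤ _ := by gcongr
  have hWsum : ∑ T : Witness V r k d l,
      listWeight χ c (((h - m : ℕ) : ℝ) ^ d) (witnessList c l T) ≤
        2 * h * ((1 + δ / 4) * e₀) := by
    refine (B.sum_witness_le (A := 4 * P) (by positivity) hA l).trans ?_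
    gcongr
    exact witness_total_le hκ1 B.θ_nonneg h1.le hZ hsm
  set bad : (Fin d → V ≃ Slot r k) → Finset V := fun β =>
    {x | x ∉ covered (blockHypergraph β) χ l ∧ Clean β M₂ (l + 2) x} with hbad
  set N₁ : ℕ := ⌈2 * h * ((1 + δ / 2) * e₀)⌉₊ with hN₁
  set N₂ : ℕ := ⌈2 * h * (e₀ * (δ / 2)) / C₂⌉₊ with hN₂
  have hmoment := card_many_bad_mul_le (χ := χ) (N := N₁) (C := C₁) hcard hmh (witnessList c l)
    (length_witnessList c l) hWsum p (by rw [hm]; exact Nat.le_add_right _ _) bad (fun β x => {y | Near β (l + 2) x y})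
    (fun β x => card_near_le (l + 2) x) (by
      intro β hβ v hv
      obtain ⟨hv1, hv2⟩ := (Finset.mem_filter.1 hv).2
      obtain ⟨T, t1, t2, t3, t4⟩ := exists_witness hβ hk (by omega) hv2 hv1
      exact ⟨T, t1, t2, t3, fun x hx => Finset.mem_filter.2 ⟨Finset.mem_univ _, t4 x hx⟩⟩)
  have hrare1 : (#{β ∈ placements χ c | N₁ ≤ #(bad β)} : ℝ) ≤ τ / 2 * #(placements χ c) := by
    have hlow : 2 * h * ((1 + 3 * δ / 8) * e₀) ≤ ((N₁ - C₁ * (p * M₁) : ℕ) : ℝ) := by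
      have e1 : 2 * h * ((1 + δ / 2) * e₀) ≤ N₁ := Nat.le_ceil _
      have e2 : (N₁ : ℝ) ≤ ((N₁ - C₁ * (p * M₁) : ℕ) : ℝ) + C₁ * (p * M₁) := by
        have : N₁ ≤ (N₁ - C₁ * (p * M₁)) + C₁ * (p * M₁) := by omega
        exact_mod_cast this
      linarith
    have hbase : 0 < 2 * h * ((1 + 3 * δ / 8) * e₀) := by positivity
    have e3 : (#{β ∈ placements χ c | N₁ ≤ #(bad β)} : ℝ) *
        (2 * h * ((1 + 3 * δ / 8) * e₀)) ^ p ≤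
        #(placements χ c) * (2 * h * ((1 + δ / 4) * e₀)) ^ p := by
      refine le_trans ?_ hmoment
      gcongr
    have e4 : 2 * h * ((1 + δ / 4) * e₀) = q * (2 * h * ((1 + 3 * δ / 8) * e₀)) := by
      rw [hq]
      field_simp
    rw [e4] at e3
    generalize 2 * h * ((1 + 3 * δ / 8) * e₀) = b at hbase e3
    rw [mul_pow q, ← mul_assoc] at e3
    have e5 := le_of_mul_le_mul_right e3 (pow_pos hbase p)
    refine e5.trans ?_
    rw [mul_comm]
    gcongr
  have hloops := sum_loopList_le (χ := χ) B.h_pos B.D_pos B.pow_le B.card_slot B.card_eq hr M₂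
  have hW₂' : ∑ j : Fin M₂, (4 * (d : ℝ) * k * θ) ^ (j + 1 : ℕ) ≤ W₂ := by
    rw [hW₂]
    refine Finset.sum_le_sum fun j _ => ?_
    have := B.θ_nonneg
    gcongr
  have hmarkov := card_many_roots_mul_le (χ := χ) (N := N₂) hcard hmh
    (loopList (V := V) (r := r) (k := k) (d := d) (M := M₂)) (fun T => by
      have := T.1.2
      simp only [loopList, List.length_ofFn]
      omega) (hloops.trans hW₂') (loopRoots M₂) fun β v hv => exists_loopList hv
  have hrare2 : (#{β ∈ placements χ c | N₂ ≤ #(loopRoots M₂ β)} : ℝ) ≤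
      τ / 2 * #(placements χ c) := by
    have hN₂' : W₂ / (τ / 2) ≤ N₂ := h4.trans (Nat.le_ceil _)
    have hN₂pos : (0 : ℝ) < N₂ := by
      have : 0 < 2 * h * (e₀ * (δ / 2)) / C₂ := by
        have : (0 : ℝ) < C₂ := by positivity
        positivity
      exact this.trans_le (Nat.le_ceil _)
    rw [div_le_iff₀ (by positivity)] at hN₂'
    refine le_of_mul_le_mul_right (hmarkov.trans ?_) hN₂pos
    calc #(placements χ c) * W₂ ≤ #(placements χ c) * (N₂ * (τ / 2)) := by gcongr
      _ = _ := by ring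
  have hsub : ({β ∈ placements χ c | 2 * h * ((1 + δ) * e₀) ≤
        uncoveredCount (blockHypergraph β) χ l} : Finset _) ⊆
      {β ∈ placements χ c | N₁ ≤ #(bad β)} ∪
        {β ∈ placements χ c | N₂ ≤ #(loopRoots M₂ β)} := by
    intro β hβ
    obtain ⟨hβ1, hβ2⟩ := Finset.mem_filter.1 hβ
    by_contra hcon
    simp only [Finset.mem_union, Finset.mem_filter, hβ1, true_and, not_or, not_le] at hcon
    obtain ⟨g1, g2⟩ := hcon
    have g1' : (#(bad β) : ℝ) < 2 * h * ((1 + δ / 2) * e₀) := Nat.lt_ceil.1 g1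
    have g2' : (#(loopRoots M₂ β) : ℝ) < 2 * h * (e₀ * (δ / 2)) / C₂ := Nat.lt_ceil.1 g2
    have hC₂pos : (0 : ℝ) < C₂ := by positivity
    rw [lt_div_iff₀ hC₂pos] at g2'
    have g3 : uncoveredCount (blockHypergraph β) χ l ≤
        #(bad β) + #(loopRoots M₂ β) * C₂ := by
      refine le_trans ?_ (add_le_add_right (card_not_clean_le M₂ (l + 2) β) _)
      refine le_trans (Finset.card_le_card ?_) (Finset.card_union_le _ _)
      intro x hx
      have hx' := (Finset.mem_filter.1 hx).2
      by_cases hcl : Clean β M₂ (l + 2) x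
      · exact Finset.mem_union_left _ (Finset.mem_filter.2 ⟨Finset.mem_univ _, hx', hcl⟩)
      · exact Finset.mem_union_right _ (Finset.mem_filter.2 ⟨Finset.mem_univ _, hcl⟩)
    have g4 : (uncoveredCount (blockHypergraph β) χ l : ℝ) ≤
        #(bad β) + #(loopRoots M₂ β) * C₂ := by exact_mod_cast g3
    linarith
  have hfin := (Finset.card_le_card hsub).trans (Finset.card_union_le _ _)
  have hfin' : (#{β ∈ placements χ c | 2 * h * ((1 + δ) * e₀) ≤
        uncoveredCount (blockHypergraph β) χ l} : ℝ) ≤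
      (#{β ∈ placements χ c | N₁ ≤ #(bad β)} : ℝ) +
        #{β ∈ placements χ c | N₂ ≤ #(loopRoots M₂ β)} := by exact_mod_cast hfin
  linarith

end Typical

/-! ### Asymptotics in `k` -/

section Asymptotics

lemma eventually_pow_mul_exp_le (C : ℝ) (m : ℕ) {b : ℝ} (hb : 0 < b) :
    ∀ᶠ k : ℕ in atTop, C * k ^ m * Real.exp (-(k / 2)) ≤ b := by
  have h1 := ((Real.summable_pow_mul_exp_neg_nat_mul m
    (show (0 : ℝ) < 1 / 2 by norm_num)).tendsto_atTop_zero).const_mul C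
  rw [mul_zero] at h1
  filter_upwards [h1.eventually (gt_mem_nhds hb)] with k hk
  refine le_trans (le_of_eq ?_) hk.le
  rw [mul_assoc]
  congr 4
  ring

/-- Put `X = 2 ^ (k - 1)` and `L = log 2`, so that `λ / k = (L X - (1 + L) / 2 + η) / (X - 1)`. At
the upper end `η = (1 - L) / 2` this quotient is exactly `L ≤ 1`. At `η = 0` it is at least `1 / 2`,
because `L ≥ 2 / 3` and `X ≥ 2`. -/
lemma lam_bounds {k d : ℕ} (hk : 2 ≤ k) {η : ℝ} (hη₀ : 0 ≤ η) (hη₁ : η ≤ (1 - Real.log 2) / 2)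
    (hd : (d : ℝ) / k = Real.log 2 / 2 * 2 ^ k - (1 + Real.log 2) / 2 + η) :
    (k : ℝ) / 2 ≤ lam k d ∧ lam k d ≤ k := by
  obtain ⟨m, rfl⟩ : ∃ m, k = m + 1 := ⟨k - 1, by omega⟩
  have hk0 : (0 : ℝ) < (m + 1 : ℕ) := by positivity
  have hX : (2 : ℝ) ≤ 2 ^ m := by
    calc (2 : ℝ) = 2 ^ 1 := (pow_one 2).symm
      _ ≤ 2 ^ m := pow_le_pow_right₀ (by norm_num) (by omega)
  rw [div_eq_iff hk0.ne'] at hd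
  unfold lam
  rw [Nat.add_sub_cancel, hd, pow_succ]
  have hL := Real.log_two_gt_d9
  have hL' := Real.log_two_lt_d9
  have hX1 : (0 : ℝ) < 2 ^ m - 1 := by linarith
  generalize (2 : ℝ) ^ m = X at *
  generalize Real.log 2 = L at *
  generalize ((m + 1 : ℕ) : ℝ) = K at *
  constructor
  · rw [le_div_iff₀ hX1]
    have : (X - 1) / 2 ≤ L / 2 * (X * 2) - (1 + L) / 2 + η := by nlinarith
    nlinarith
  · rw [div_le_iff₀ hX1]
    have : L / 2 * (X * 2) - (1 + L) / 2 + η ≤ X - 1 := by nlinarith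
    nlinarith

end Asymptotics

/-! ### Passage to the planted measure and the limit in `n` -/

section Limit

lemma card_eq_of_isEquitable {n h : ℕ} (hn : n = 2 * h) {χ : Fin n → Fin 2}
    (hχ : IsEquitable χ) (a : Fin 2) : Fintype.card {x // χ x = a} = h := by
  have e : ∀ b : Fin 2, (χ ⁻¹' {b}).ncard = Fintype.card {x // χ x = b} := by
    intro b
    rw [← Nat.card_eq_fintype_card]
    rfl
  have h1 : Fintype.card {x // χ x = 0} = Fintype.card {x // χ x = 1} := by
    rw [← e, ← e]
    exact hχ
  have h2 : ∑ b : Fin 2, Fintype.card {x // χ x = b} = n := by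
    simp_rw [Fintype.card_subtype]
    rw [← Finset.card_eq_sum_card_fiberwise fun x _ => Finset.mem_coe.2 (Finset.mem_univ (χ x))]
    simp
  rw [Fin.sum_univ_two] at h2
  have h01 : a = 0 ∨ a = 1 := by
    revert a
    decide
  rcases h01 with rfl | rfl <;> omega

lemma ncard_covered_add_uncoveredCount {V : Type} [Fintype V] (H : Hypergraph V) (χ : V → Fin 2)
    (l : ℕ) : (covered H χ l).ncard + uncoveredCount H χ l = Fintype.card V := by
  classical
  have h1 := Set.ncard_add_ncard_compl (covered H χ l)
  rw [Nat.card_eq_fintype_card] at h1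
  rw [← h1]
  congr 1
  unfold uncoveredCount
  rw [← Set.ncard_coe_finset]
  congr 1
  ext x
  simp

lemma exists_exp_mul_le {a b : ℝ} (ha : 0 < a) (hb : 0 < b) :
    ∃ ε : ℝ, 0 < ε ∧ ε ≤ 1 ∧ ε * a ≤ 1 ∧ Real.exp (ε * a) ≤ 1 + b := by
  have hlog : 0 < Real.log (1 + b) := Real.log_pos (by linarith)
  have hle : min 1 (min 1 (Real.log (1 + b)) / a) * a ≤ min 1 (Real.log (1 + b)) := by
    calc _ ≤ min 1 (Real.log (1 + b)) / a * a := by gcongr; exact min_le_right _ _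
      _ = _ := div_mul_cancel₀ _ ha.ne'
  refine ⟨min 1 (min 1 (Real.log (1 + b)) / a), ?_, min_le_left _ _, hle.trans (min_le_left _ _),
    ?_⟩
  · exact lt_min one_pos (div_pos (lt_min one_pos hlog) ha)
  · rw [← Real.le_log_iff_exp_le (by linarith)]
    exact hle.trans (min_le_right _ _)

lemma sizes_neBot {k : ℕ} (hk : 0 < k) : (sizes k).NeBot := by
  unfold sizes
  rw [← frequently_mem_iff_neBot, frequently_atTop]
  intro a
  exact ⟨2 * k * a, Nat.le_mul_of_pos_left a (by positivity),
    ⟨⟨k * a, by ring⟩, ⟨2 * a, by ring⟩⟩⟩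

variable {k d : ℕ} [NeZero k]

lemma card_filter_univ_eq_natCard {α : Type*} [Fintype α] (p : α → Prop) [DecidablePred p] :
    #{a | p a} = Nat.card {a // p a} := by
  rw [Nat.card_eq_fintype_card, Fintype.card_subtype]

lemma uncoveredCount_ge {r n : ℕ} (hn0 : 0 < n) (hnh : n = 2 * (n / 2)) {χ : Fin n → Fin 2}
    {δ : ℝ} {l : ℕ} {β : Fin d → Fin n ≃ Slot r k} (hβ : toHom β ∈ (denseEvent k d χ δ l)ᶜ) :
    2 * ((n / 2 : ℕ) : ℝ) * ((1 + δ) * Real.exp (-lam k d)) ≤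
      uncoveredCount (blockHypergraph β) χ l := by
  have g3 : ¬ (((covered (actionHypergraph (toHom β)) χ l).ncard : ℝ) / n
      > 1 - Real.exp (-lam k d) * (1 + δ)) := hβ
  rw [actionHypergraph_toHom, gt_iff_lt, not_lt] at g3
  have g4 := ncard_covered_add_uncoveredCount (blockHypergraph β) χ l
  rw [Fintype.card_fin] at g4
  have g5 : ((covered (blockHypergraph β) χ l).ncard : ℝ) +
      uncoveredCount (blockHypergraph β) χ l = n := by exact_mod_cast g4
  have hn0' : (0 : ℝ) < n := by exact_mod_cast hn0
  have hnh' : 2 * ((n / 2 : ℕ) : ℝ) = n := by exact_mod_cast hnh.symm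
  rw [div_le_iff₀ hn0'] at g3
  rw [hnh']
  linarith

open Classical in
lemma eventually_measure_compl_le (hk : 3 ≤ k) (l : ℕ) {δ : ℝ} (hδ : 0 < δ)
    (hlam1 : 1 ≤ lam k d) (hlamk : lam k d ≤ k)
    (hsmall : 3584 * Real.exp 6 * k ^ 10 * Real.exp (-lam k d) ≤ δ / 8)
    (hcontr : 1024 * Real.exp 3 * k ^ 7 * Real.exp (-lam k d) ≤ 1)
    {χ : (n : ℕ) → Fin n → Fin 2} (hχ : ∀ n, 2 ∣ n → k ∣ n → IsEquitable (χ n))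
    {τ : ℝ} (hτ : 0 < τ) :
    ∀ᶠ n in sizes k, (plantedHom k d (χ n)).Nonempty ∧
      plantedMeasure k d (χ n) (denseEvent k d (χ n) δ l)ᶜ ≤ ENNReal.ofReal τ := by
  have hw : ((Fintype.card (Word k) : ℕ) : ℝ) = 2 * (2 ^ (k - 1) - 1) := by
    have h1 : ((Fintype.card (Word k) : ℕ) : ℝ) + 2 = 2 ^ k := by
      exact_mod_cast card_word (k := k) (by omega)
    have h2 : (2 : ℝ) ^ k = 2 ^ (k - 1) * 2 := by
      rw [← pow_succ, Nat.sub_add_cancel (by omega)]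
    linarith
  have hX : (4 : ℝ) ≤ 2 ^ (k - 1) := by
    calc (4 : ℝ) = 2 ^ 2 := by norm_num
      _ ≤ 2 ^ (k - 1) := pow_le_pow_right₀ (by norm_num) (by omega)
  have hk0 : (0 : ℝ) < k := by
    have : 0 < k := by omega
    exact_mod_cast this
  have hX1 : (0 : ℝ) < 2 ^ (k - 1) - 1 := by linarith
  set ρ₀ : ℝ := ((2 : ℝ) ^ (k - 1) - 1)⁻¹ with hρ₀
  have hρpos : 0 < ρ₀ := by positivity
  have hρ1 : ρ₀ ≤ 1 := inv_le_one_of_one_le₀ (by linarith)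
  have hlam : lam k d = d * ρ₀ := div_eq_mul_inv _ _
  obtain ⟨ε, hε0, hε1, hεlam, hεexp⟩ :=
    exists_exp_mul_le (a := lam k d) (b := δ / 16) (by linarith) (by positivity)
  -- The parameter `ρ₀ * k / 2` is the mean number of unique letters of one color in a random word.
  have hp : ρ₀ * k / 2 * Fintype.card (Word k) = k := by
    rw [hw, hρ₀]
    field_simp
  -- The union over the `d` arrays consumes at most half of `τ`; using `d + 1` avoids a division by
  -- zero.
  have ev1 := eventually_card_not_typical_le (k := k) (p := ρ₀ * k / 2) (ε := ε)
    (τ := τ / 2 / (d + 1)) (by omega) hp (by positivity) hε0 hε1 (by positivity)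
  have ev2 := eventually_card_bad_le (k := k) (d := d) (τ := τ / 2) hk l hδ hρpos hρ1 hε0.le hε1
    hlam hlam1 hlamk hεlam hεexp hsmall hcontr (by positivity)
  have hdivk : Tendsto (fun n : ℕ => n / k) (sizes k) atTop :=
    (Nat.tendsto_div_const_atTop (NeZero.ne k)).mono_left inf_le_left
  have hdiv2 : Tendsto (fun n : ℕ => n / 2) (sizes k) atTop :=
    (Nat.tendsto_div_const_atTop two_ne_zero).mono_left inf_le_left
  have hmem : ∀ᶠ n in sizes k, 2 ∣ n ∧ k ∣ n := mem_inf_of_right (mem_principal_self _)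
  have hpos : ∀ᶠ n in sizes k, 0 < n := (eventually_gt_atTop 0).filter_mono inf_le_left
  filter_upwards [hdivk.eventually ev1, hdiv2.eventually ev2, hmem, hpos] with n h1 h2 hn hn0
  obtain ⟨hn2, hnk⟩ := hn
  have hnr : n = n / k * k := (Nat.div_mul_cancel hnk).symm
  have hnh : n = 2 * (n / 2) := (Nat.mul_div_cancel' hn2).symm
  have hr : n / k * k = 2 * (n / 2) := hnr.symm.trans hnh
  obtain ⟨h3, h4⟩ := h1 (by rw [← hnr]; exact even_iff_two_dvd.2 hn2)
  have hcard := card_eq_of_isEquitable hnh (hχ n hn2 hnk)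
  obtain ⟨h5, h6⟩ := card_rowsProper_filter_le (d := d) hr hcard (IsTypical (ρ₀ * k / 2) ε)
    (τ' := τ / 2) (by positivity) h3 h4 (fun β => 2 * ((n / 2 : ℕ) : ℝ) * ((1 + δ) * Real.exp (-lam k d)) ≤
        uncoveredCount (blockHypergraph β) (χ n) l)
    (fun c hc htyp => h2 (Fin n) (n / k) (χ n) c hr hcard hc htyp)
  have hτ' : d * (τ / 2 / (d + 1)) + τ / 2 ≤ τ := by
    have : d * (τ / 2 / (d + 1)) ≤ τ / 2 := by
      rw [mul_div_assoc', div_le_iff₀ (by positivity)]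
      nlinarith
    linarith
  have h7 := h6.trans (mul_le_mul_of_nonneg_right hτ' (Nat.cast_nonneg _))
  -- `Nat.card` makes the counts independent of the decidability instances.
  simp only [card_filter_univ_eq_natCard] at h5 h7
  have h8 : Nat.card {β : Fin d → Fin n ≃ Slot (n / k) k // (∀ i, RowsProper (χ n) (β i)) ∧
      toHom β ∈ (denseEvent k d (χ n) δ l)ᶜ} ≤
      Nat.card {β : Fin d → Fin n ≃ Slot (n / k) k // (∀ i, RowsProper (χ n) (β i)) ∧
        2 * ((n / 2 : ℕ) : ℝ) * ((1 + δ) * Real.exp (-lam k d)) ≤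
          uncoveredCount (blockHypergraph β) (χ n) l} :=
    Nat.card_mono (Set.toFinite _) fun β hβ => ⟨hβ.1, uncoveredCount_ge hn0 hnh hβ.2⟩
  refine plantedMeasure_le (by omega) hnr _ ?_ ?_
  · rw [card_filter_univ_eq_natCard]
    exact h5
  · rw [card_filter_univ_eq_natCard, card_filter_univ_eq_natCard]
    exact (Nat.cast_le.2 h8).trans h7

lemma tendsto_plantedMeasure_denseEvent (hk : 3 ≤ k) (l : ℕ) {δ : ℝ} (hδ : 0 < δ)
    (hlam1 : 1 ≤ lam k d) (hlamk : lam k d ≤ k)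
    (hsmall : 3584 * Real.exp 6 * k ^ 10 * Real.exp (-lam k d) ≤ δ / 8)
    (hcontr : 1024 * Real.exp 3 * k ^ 7 * Real.exp (-lam k d) ≤ 1)
    {χ : (n : ℕ) → Fin n → Fin 2} (hχ : ∀ n, 2 ∣ n → k ∣ n → IsEquitable (χ n)) :
    Tendsto (fun n : ℕ => plantedMeasure k d (χ n) (denseEvent k d (χ n) δ l)) (sizes k)
      (𝓝 1) := by
  rw [ENNReal.tendsto_nhds ENNReal.one_ne_top]
  intro ε hε
  have hmin : min ε 1 ≠ ⊤ := ne_top_of_le_ne_top ENNReal.one_ne_top (min_le_right _ _)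
  have hτ : 0 < (min ε 1).toReal :=
    ENNReal.toReal_pos (lt_min hε one_pos).ne' hmin
  filter_upwards [eventually_measure_compl_le hk l hδ hlam1 hlamk hsmall hcontr hχ hτ]
    with n hn
  obtain ⟨hne, hle⟩ := hn
  rw [ENNReal.ofReal_toReal hmin] at hle
  have hprob : MeasureTheory.IsProbabilityMeasure (plantedMeasure k d (χ n)) :=
    ProbabilityTheory.isProbabilityMeasure_uniformOn (Set.toFinite _) hne
  have hmeas : MeasurableSet (denseEvent k d (χ n) δ l) := trivial
  have hadd := MeasureTheory.prob_add_prob_compl (μ := plantedMeasure k d (χ n)) hmeas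
  refine ⟨?_, MeasureTheory.prob_le_one.trans le_self_add⟩
  rw [tsub_le_iff_right, ← hadd]
  gcongr
  exact hle.trans (min_le_left _ _)

end Limit

end PlantedColoring

open PlantedColoring in
theorem lemma5p1 (η₀ η₁ : ℝ) (hη₀ : 0 < η₀) (hη : η₀ < η₁) (hη₁ : η₁ < (1 - Real.log 2) / 2)
    (δ : ℝ) (hδ : 0 < δ) :
    ∃ k₀ : ℕ, ∀ k : ℕ, k₀ ≤ k → ∀ (d : ℕ) (η : ℝ), η₀ ≤ η → η ≤ η₁ →
      (d : ℝ) / k = Real.log 2 / 2 * 2 ^ k - (1 + Real.log 2) / 2 + η →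
      ∀ χ : (n : ℕ) → Fin n → Fin 2, (∀ n, 2 ∣ n → k ∣ n → IsEquitable (χ n)) →
        Tendsto (fun l : ℕ =>
            liminf (fun n : ℕ => plantedMeasure k d (χ n) (denseEvent k d (χ n) δ l)) (sizes k))
          atTop (𝓝 1) := by
  have ev1 := eventually_pow_mul_exp_le (3584 * Real.exp 6) 10 (show 0 < δ / 8 by positivity)
  have ev2 := eventually_pow_mul_exp_le (1024 * Real.exp 3) 7 one_pos
  obtain ⟨k₀, hk₀⟩ := eventually_atTop.1 (ev1.and (ev2.and (eventually_ge_atTop 3)))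
  refine ⟨k₀, fun k hk d η hηl hηu hd χ hχ => ?_⟩
  obtain ⟨h1, h2, h3⟩ := hk₀ k hk
  have : NeZero k := ⟨by omega⟩
  have : (sizes k).NeBot := sizes_neBot (by omega)
  have h3' : (3 : ℝ) ≤ k := by exact_mod_cast h3
  obtain ⟨h4, h5⟩ := lam_bounds (k := k) (d := d) (by omega) (by linarith) (by linarith) hd
  have h6 : Real.exp (-lam k d) ≤ Real.exp (-(k / 2)) := Real.exp_le_exp.2 (neg_le_neg h4)
  -- For each depth the probability already tends to one in `n`, so the sequence in `l` is constant.
  refine tendsto_const_nhds.congr fun l => ?_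
  refine (Tendsto.liminf_eq ?_).symm
  refine tendsto_plantedMeasure_denseEvent h3 l hδ (by linarith) h5
    (le_trans ?_ h1) (le_trans ?_ h2) hχ
  · gcongr
  · gcongr
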